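/- In the (optimization version of the) Strongly Connected Steiner Subgraph problem, the input is a finite directed graph $G=(V,E)$ and a set $T\subseteq V$ of terminals. A feasible solution is a set $E'\subseteq E$ such that $(V,E')$ contains a directed path from $s$ to $t$ for all distinct $s,t\in T$; the goal is to minimize $|E'|$. Let $OPT$ denote the minimum of $|E'|$ over all feasible solutions. For every constant $\varepsilon>0$, this problem has a $2\cdot OPT^{\varepsilon}$-approximation in polynomial time: there is an algorithm that halts on every input after a number of steps polynomial in $|V|+|E|+|T|$ and that, whenever a feasible solution exists, outputs a feasible solution $E'$ with $$|E'|\le 2\cdot OPT^{\varepsilon}\cdot OPT .$$ -/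

import Mathlib

/-! ### The machine model: a random access machine with structured control flow

A state consists of natural-number registers and natural-number arrays (infinite memories accessed
by indirect addressing).  The arithmetic is addition and truncated subtraction; every evaluated
node of an expression, every assignment and every test costs one unit.  There is no unit-cost
multiplication, so in `t` steps the bit length of numbers grows by `O(t)` only, and polynomial time
on this machine is polynomial time on Turing machines. -/

namespace RAM

/-- A machine state: `reg r` is the content of register `r`, and `arr a i` is the content of
cell `i` of array `a`. -/
@[ext]
structure State where
  reg : ℕ → ℕ
  arr : ℕ → ℕ → ℕ

/-- Write the value `v` to register `r`. -/
def State.setReg (s : State) (r v : ℕ) : State :=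
  { s with reg := Function.update s.reg r v }

/-- Write the value `v` to cell `i` of array `a`. -/
def State.setArr (s : State) (a i v : ℕ) : State :=
  { s with arr := Function.update s.arr a (Function.update (s.arr a) i v) }

/-- Arithmetic expressions. The names of registers and arrays are fixed in the program text,
whereas the index of an array access is itself computed. -/
inductive Expr where
  | const (c : ℕ)
  | reg (r : ℕ)
  | arr (a : ℕ) (i : Expr)
  | add (e₁ e₂ : Expr)
  | sub (e₁ e₂ : Expr)

/-- The value of an expression (subtraction is truncated at `0`). -/
def Expr.eval (s : State) : Expr → ℕ
  | .const c => c
  | .reg r => s.reg r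
  | .arr a i => s.arr a (i.eval s)
  | .add e₁ e₂ => e₁.eval s + e₂.eval s
  | .sub e₁ e₂ => e₁.eval s - e₂.eval s

/-- The number of steps needed to evaluate an expression: its number of nodes. -/
def Expr.cost : Expr → ℕ
  | .const _ => 1
  | .reg _ => 1
  | .arr _ i => i.cost + 1
  | .add e₁ e₂ => e₁.cost + e₂.cost + 1
  | .sub e₁ e₂ => e₁.cost + e₂.cost + 1

/-- Programs. A test `e` counts as true if the value of `e` is nonzero. -/
inductive Program where
  | skip
  | assign (r : ℕ) (e : Expr)
  | store (a : ℕ) (i e : Expr)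
  | seq (p q : Program)
  | cond (e : Expr) (p q : Program)
  | loop (e : Expr) (p : Program)

/-- `Exec p s s' t` : started in state `s`, the program `p` halts in state `s'` after exactly `t`
steps. -/
inductive Exec : Program → State → State → ℕ → Prop
  | skip (s : State) : Exec .skip s s 1
  | assign (s : State) (r : ℕ) (e : Expr) :
      Exec (.assign r e) s (s.setReg r (e.eval s)) (e.cost + 1)
  | store (s : State) (a : ℕ) (i e : Expr) :
      Exec (.store a i e) s (s.setArr a (i.eval s) (e.eval s)) (i.cost + e.cost + 1)
  | seq {p q : Program} {s s' s'' : State} {t t' : ℕ} :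
      Exec p s s' t → Exec q s' s'' t' → Exec (.seq p q) s s'' (t + t')
  | condTrue {e : Expr} {p q : Program} {s s' : State} {t : ℕ} :
      e.eval s ≠ 0 → Exec p s s' t → Exec (.cond e p q) s s' (e.cost + 1 + t)
  | condFalse {e : Expr} {p q : Program} {s s' : State} {t : ℕ} :
      e.eval s = 0 → Exec q s s' t → Exec (.cond e p q) s s' (e.cost + 1 + t)
  | loopTrue {e : Expr} {p : Program} {s s' s'' : State} {t t' : ℕ} :
      e.eval s ≠ 0 → Exec p s s' t → Exec (.loop e p) s' s'' t' →
        Exec (.loop e p) s s'' (e.cost + 1 + t + t')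
  | loopFalse {e : Expr} {p : Program} {s : State} :
      e.eval s = 0 → Exec (.loop e p) s s (e.cost + 1)

/-- The machine is deterministic: the final state and the running time are determined by the
program and the initial state. -/
theorem Exec.deterministic {p : Program} {s s₁ s₂ : State} {t₁ t₂ : ℕ}
    (h₁ : Exec p s s₁ t₁) (h₂ : Exec p s s₂ t₂) : s₁ = s₂ ∧ t₁ = t₂ := by
  induction h₁ generalizing s₂ t₂ with
  | skip => cases h₂; exact ⟨rfl, rfl⟩
  | assign => cases h₂; exact ⟨rfl, rfl⟩
  | store => cases h₂; exact ⟨rfl, rfl⟩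
  | seq _ _ ih ih' =>
    cases h₂ with
    | seq k k' =>
      obtain ⟨rfl, rfl⟩ := ih k
      obtain ⟨rfl, rfl⟩ := ih' k'
      exact ⟨rfl, rfl⟩
  | condTrue h _ ih =>
    cases h₂ with
    | condTrue _ k => obtain ⟨rfl, rfl⟩ := ih k; exact ⟨rfl, rfl⟩
    | condFalse h' _ => exact absurd h' h
  | condFalse h _ ih =>
    cases h₂ with
    | condTrue h' _ => exact absurd h h'
    | condFalse _ k => obtain ⟨rfl, rfl⟩ := ih k; exact ⟨rfl, rfl⟩
  | loopTrue h _ _ ih ih' =>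
    cases h₂ with
    | loopTrue _ k k' =>
      obtain ⟨rfl, rfl⟩ := ih k
      obtain ⟨rfl, rfl⟩ := ih' k'
      exact ⟨rfl, rfl⟩
    | loopFalse h' => exact absurd h' h
  | loopFalse h =>
    cases h₂ with
    | loopTrue h' _ _ => exact absurd h h'
    | loopFalse _ => exact ⟨rfl, rfl⟩

end RAM

/-! ### Strongly Connected Steiner Subgraph -/

namespace SCSS

/-- An instance: a finite directed graph `G = (V, E)` with vertex set `V = {0, …, n - 1}` and a set
`T ⊆ V` of terminals. -/
structure Instance where
  n : ℕ
  E : Finset (Fin n × Fin n)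
  T : Finset (Fin n)

/-- There is a directed path from `u` to `v` in the graph with edge set `F`. -/
def HasPath {n : ℕ} (F : Finset (Fin n × Fin n)) (u v : Fin n) : Prop :=
  Relation.ReflTransGen (fun a b => (a, b) ∈ F) u v

/-- `F` is a feasible solution: `F ⊆ E`, and `(V, F)` has a directed path from each terminal to
each other terminal. -/
def Instance.IsSolution (x : Instance) (F : Finset (Fin x.n × Fin x.n)) : Prop :=
  F ⊆ x.E ∧ ∀ s ∈ x.T, ∀ t ∈ x.T, s ≠ t → HasPath F s t

/-- The instance has a feasible solution. -/
def Instance.Feasible (x : Instance) : Prop :=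
  ∃ F, x.IsSolution F

/-- The minimum number of edges of a feasible solution (meaningful for feasible instances). -/
noncomputable def Instance.opt (x : Instance) : ℕ :=
  sInf {k | ∃ F, x.IsSolution F ∧ F.card = k}

/-- The size of an instance: number of vertices, edges and terminals. -/
def Instance.size (x : Instance) : ℕ :=
  x.n + x.E.card + x.T.card

/-- The initial machine state for the input `x`: register `0` holds the number `n` of vertices,
array `0` holds the adjacency matrix in row-major order, and array `1` holds the indicator vector of
the terminals; all other registers and cells are `0`. -/
def Instance.input (x : Instance) : RAM.State where
  reg r := if r = 0 then x.n else 0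
  arr a k :=
    if a = 0 then
      if ∃ u v : Fin x.n, (u, v) ∈ x.E ∧ k = u.val * x.n + v.val then 1 else 0
    else if a = 1 then
      if ∃ u : Fin x.n, u ∈ x.T ∧ k = u.val then 1 else 0
    else 0

/-- The set of vertex pairs described by a final state: `(u, v)` is output if the entry in row `u`
and column `v` of the `n × n` matrix stored in array `2` (in row-major order) is nonzero. -/
def output (n : ℕ) (s : RAM.State) : Finset (Fin n × Fin n) :=
  Finset.univ.filter fun e => s.arr 2 (e.1.val * n + e.2.val) ≠ 0

/-- The program `P` is a polynomial-time approximation algorithm with ratio `ρ(OPT)`: it halts on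
every instance within a number of steps that is polynomial in the size of the instance, and on
every feasible instance it outputs a feasible solution with at most `ρ(OPT) · OPT` edges. -/
def IsPolyTimeApproxAlgorithm (P : RAM.Program) (ρ : ℕ → ℝ) : Prop :=
  ∃ p : Polynomial ℕ, ∀ x : Instance, ∃ (s : RAM.State) (t : ℕ),
    RAM.Exec P x.input s t ∧ t ≤ p.eval x.size ∧
      (x.Feasible → x.IsSolution (output x.n s) ∧
        ((output x.n s).card : ℝ) ≤ ρ x.opt * x.opt)

end SCSS

/-! The algorithm applies the recursive greedy method for directed Steiner trees twice. Fix a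
terminal r. A feasible solution reaches every terminal from r and r from every terminal, so an
optimal one yields a tree in either direction with at most OPT arcs; conversely, the union of an
out-tree from r and an in-tree to r that serve all terminals is feasible. An approximation with
ratio ρ for out-trees, run on the digraph and on its reverse, therefore gives ratio 2ρ.

A partial covering is measured by its density, the cost per newly covered terminal; a chosen pair
(u, v) costs the distance from u to v. The lowest level of recursion takes the nearest terminal. The
next level tries every vertex u: it pays the distance to u, calls the lower level from u again and
again, and records the best density seen over all u and all prefixes of these runs. To analyse this,
compare with any tree that has c arcs and at most q^(e+1) terminals. Some piece of it holds roughly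
a fraction 1/(2q) of the terminals, has at most twice the density, and hangs at distance at most c
(`Tree.exists_piece`). Running the lower level from the root of that piece until half of the piece
is covered loses a constant factor only (`Track.step`, `Quality.of_seen`). Hence i + 1 levels lose
the factor `blockConst i * q` in density whenever |T| ≤ q^(i+1); the program does not depend on q.
Repeating until every terminal is covered costs a further harmonic factor (`iter_block_run`).

If |T| ≥ 2, every terminal is the head of an arc of each solution, so |T| ≤ OPT. With i large and q
about |T|^(1/(i+1)), the factor const · q · H(|T|) is at most OPT^ε except for OPT ≤ C, where C
depends on ε only (`exists_ratio_le`). These small values are settled by exhaustive search through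
the arc sets with at most C arcs (`tryAll_run`).

Since i and C are constants, the recursion unfolds into a fixed program whose loops all run n times,
and a polynomial time bound can be read off its syntax (`exec_toProgram`). -/

namespace RAM

/-! ### Machine states and programs built from counting loops -/

@[simp] theorem State.setReg_reg (s : State) (r v x : ℕ) :
    (s.setReg r v).reg x = if x = r then v else s.reg x := by
  simp [State.setReg, Function.update_apply]

@[simp] theorem State.setReg_arr (s : State) (r v : ℕ) : (s.setReg r v).arr = s.arr := rfl

@[simp] theorem State.setArr_reg (s : State) (a i v : ℕ) : (s.setArr a i v).reg = s.reg := rfl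

@[simp] theorem State.setArr_arr (s : State) (a i v b : ℕ) :
    (s.setArr a i v).arr b = if b = a then Function.update (s.arr a) i v else s.arr b := by
  simp [State.setArr, Function.update_apply]

/-- Commands whose only loops are counting loops: `iter r p` runs `p` with `r = 0, 1, …, n - 1`,
where `n` is the content of register `0`. -/
inductive Cmd where
  | skip
  | assign (r : ℕ) (e : Expr)
  | store (a : ℕ) (i e : Expr)
  | seq (p q : Cmd)
  | cond (e : Expr) (p q : Cmd)
  | iter (r : ℕ) (p : Cmd)

infixr:60 " ;; " => Cmd.seq

namespace Cmd

/-- The program that implements a command. -/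
def toProgram : Cmd → Program
  | skip => .skip
  | assign r e => .assign r e
  | store a i e => .store a i e
  | seq p q => .seq p.toProgram q.toProgram
  | cond e p q => .cond e p.toProgram q.toProgram
  | iter r p => .seq (.assign r (.const 0)) (.loop (.sub (.reg 0) (.reg r))
      (.seq p.toProgram (.assign r (.add (.reg r) (.const 1)))))

/-- The state after `j` rounds of a counting loop with body `f` and counter `r`. -/
def iterRun (f : State → State) (r : ℕ) (s : State) : ℕ → State
  | 0 => s.setReg r 0
  | j + 1 => (f (iterRun f r s j)).setReg r (j + 1)

/-- The final state of a command. -/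
def run : Cmd → State → State
  | skip, s => s
  | assign r e, s => s.setReg r (e.eval s)
  | store a i e, s => s.setArr a (i.eval s) (e.eval s)
  | seq p q, s => q.run (p.run s)
  | cond e p q, s => if e.eval s ≠ 0 then p.run s else q.run s
  | iter r p, s => iterRun p.run r s (s.reg 0)

/-- The registers that a command may write. -/
def regs : Cmd → Finset ℕ
  | skip => ∅
  | assign r _ => {r}
  | store _ _ _ => ∅
  | seq p q => p.regs ∪ q.regs
  | cond _ p q => p.regs ∪ q.regs
  | iter r p => insert r p.regs

/-- The arrays that a command may write. -/
def arrs : Cmd → Finset ℕ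
  | skip => ∅
  | assign _ _ => ∅
  | store a _ _ => {a}
  | seq p q => p.arrs ∪ q.arrs
  | cond _ p q => p.arrs ∪ q.arrs
  | iter _ p => p.arrs

/-- Loop bodies write neither their counter nor the bound in register `0`. -/
def WF : Cmd → Prop
  | seq p q => p.WF ∧ q.WF
  | cond _ p q => p.WF ∧ q.WF
  | iter r p => p.WF ∧ r ≠ 0 ∧ r ∉ p.regs ∧ 0 ∉ p.regs
  | _ => True

/-- A bound for the running time, in terms of the content of register `0`. -/
noncomputable def time : Cmd → Polynomial ℕ
  | skip => 1
  | assign _ e => .C (e.cost + 1)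
  | store _ i e => .C (i.cost + e.cost + 1)
  | seq p q => p.time + q.time
  | cond e p q => .C (e.cost + 1) + p.time + q.time
  | iter _ p => .C 6 + .X * (p.time + .C 8)

theorem run_seq (p q : Cmd) (s : State) : (p ;; q).run s = q.run (p.run s) := rfl

theorem run_reg (p : Cmd) (s : State) {x : ℕ} (h : x ∉ p.regs) : (p.run s).reg x = s.reg x := by
  induction p generalizing s with
  | skip => rfl
  | assign r e => simp_all [run, regs]
  | store a i e => rfl
  | seq p q ihp ihq =>
    simp only [regs, Finset.mem_union, not_or] at h
    rw [run_seq, ihq _ h.2, ihp _ h.1]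
  | cond e p q ihp ihq =>
    simp only [regs, Finset.mem_union, not_or] at h
    simp only [run]
    split
    · exact ihp _ h.1
    · exact ihq _ h.2
  | iter r p ih =>
    simp only [regs, Finset.mem_insert, not_or] at h
    suffices ∀ j, (iterRun p.run r s j).reg x = s.reg x from this _
    intro j
    induction j with
    | zero => simp [iterRun, h.1]
    | succ j ihj => simp [iterRun, h.1, ih _ h.2, ihj]

theorem run_arr (p : Cmd) (s : State) {a : ℕ} (h : a ∉ p.arrs) : (p.run s).arr a = s.arr a := by
  induction p generalizing s with
  | skip => rfl
  | assign r e => rfl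
  | store b i e => simp_all [run, arrs]
  | seq p q ihp ihq =>
    simp only [arrs, Finset.mem_union, not_or] at h
    rw [run_seq, ihq _ h.2, ihp _ h.1]
  | cond e p q ihp ihq =>
    simp only [arrs, Finset.mem_union, not_or] at h
    simp only [run]
    split
    · exact ihp _ h.1
    · exact ihq _ h.2
  | iter r p ih =>
    simp only [arrs] at h
    suffices ∀ j, (iterRun p.run r s j).arr a = s.arr a from this _
    intro j
    induction j with
    | zero => simp [iterRun]
    | succ j ihj => simp [iterRun, ih _ h, ihj]

theorem iterRun_reg_counter (f : State → State) (r : ℕ) (s : State) (j : ℕ) :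
    (iterRun f r s j).reg r = j := by
  cases j <;> simp [iterRun]

theorem iterRun_reg (p : Cmd) (r : ℕ) (s : State) (j : ℕ) {x : ℕ}
    (h : x ∉ (iter r p).regs) : (iterRun p.run r s j).reg x = s.reg x := by
  simp only [regs, Finset.mem_insert, not_or] at h
  induction j with
  | zero => simp [iterRun, h.1]
  | succ j ihj => simp [iterRun, h.1, p.run_reg _ h.2, ihj]

theorem iterRun_arr (p : Cmd) (r : ℕ) (s : State) (j : ℕ) {a : ℕ}
    (h : a ∉ (iter r p).arrs) : (iterRun p.run r s j).arr a = s.arr a := by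
  simp only [arrs] at h
  induction j with
  | zero => simp [iterRun]
  | succ j ihj => simp [iterRun, p.run_arr _ h, ihj]

/-- The invariant rule for counting loops. -/
theorem iter_induction {r : ℕ} {p : Cmd} {s : State} (I : ℕ → State → Prop)
    (h0 : I 0 (s.setReg r 0))
    (hs : ∀ j s', j < s.reg 0 → s'.reg r = j →
      (∀ x, x ∉ (iter r p).regs → s'.reg x = s.reg x) →
      (∀ a, a ∉ (iter r p).arrs → s'.arr a = s.arr a) →
      I j s' → I (j + 1) ((p.run s').setReg r (j + 1))) :
    I (s.reg 0) ((iter r p).run s) := by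
  suffices ∀ j ≤ s.reg 0, I j (iterRun p.run r s j) from this _ le_rfl
  intro j hj
  induction j with
  | zero => exact h0
  | succ j ih =>
    exact hs j _ hj (iterRun_reg_counter _ _ _ _) (fun x hx => iterRun_reg p r s j hx)
      (fun a ha => iterRun_arr p r s j ha) (ih (by omega))

/-- Register `0` is never written, so every inner loop starts with the same bound n. This is what
makes a bound by a polynomial in the initial value of register `0` possible, by recursion on the
syntax. -/
theorem exec_toProgram (p : Cmd) (hp : p.WF) (h0 : 0 ∉ p.regs) (s : State) :
    ∃ t, Exec p.toProgram s (p.run s) t ∧ t ≤ p.time.eval (s.reg 0) := by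
  induction p generalizing s with
  | skip => exact ⟨1, .skip s, by simp [time]⟩
  | assign r e => exact ⟨_, .assign s r e, by simp [time]⟩
  | store a i e => exact ⟨_, .store s a i e, by simp [time]⟩
  | seq p q ihp ihq =>
    simp only [regs, Finset.mem_union, not_or] at h0
    obtain ⟨t, ht, hle⟩ := ihp hp.1 h0.1 s
    obtain ⟨t', ht', hle'⟩ := ihq hp.2 h0.2 (p.run s)
    rw [p.run_reg s h0.1] at hle'
    exact ⟨_, .seq ht ht', by simp only [time, Polynomial.eval_add]; omega⟩
  | cond e p q ihp ihq =>
    simp only [regs, Finset.mem_union, not_or] at h0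
    by_cases h : e.eval s = 0
    · obtain ⟨t, ht, hle⟩ := ihq hp.2 h0.2 s
      refine ⟨_, .condFalse h (by simpa [run, h] using ht), ?_⟩
      simp only [time, Polynomial.eval_add, Polynomial.eval_C]; omega
    · obtain ⟨t, ht, hle⟩ := ihp hp.1 h0.1 s
      refine ⟨_, .condTrue h (by simpa [run, h] using ht), ?_⟩
      simp only [time, Polynomial.eval_add, Polynomial.eval_C]; omega
  | iter r p ih =>
    obtain ⟨hp, hr, hrp, h0p⟩ := hp
    set n := s.reg 0 with hn
    -- A test costs 4 steps and an increment 4, hence the 8 per round and the 4 for the last,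
    -- failing test. Together with the 2 steps that initialise the counter this gives the constant 6
    -- in `time`.
    have key : ∀ k j, j + k = n → ∃ t, Exec (.loop (.sub (.reg 0) (.reg r))
        (.seq p.toProgram (.assign r (.add (.reg r) (.const 1))))) (iterRun p.run r s j)
        (iterRun p.run r s n) t ∧ t ≤ 4 + k * (p.time.eval n + 8) := by
      intro k
      induction k with
      | zero =>
        intro j hj
        obtain rfl : j = n := by omega
        refine ⟨_, .loopFalse ?_, ?_⟩
        · simp [Expr.eval, iterRun_reg_counter, iterRun_reg p r s _ (x := 0) (by
            simp [regs, h0p, hr.symm]), ← hn]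
        · simp [Expr.cost]
      | succ k ihk =>
        intro j hj
        obtain ⟨t, ht, hle⟩ := ih hp h0p (iterRun p.run r s j)
        obtain ⟨t', ht', hle'⟩ := ihk (j + 1) (by omega)
        have hreg0 : (iterRun p.run r s j).reg 0 = n :=
          iterRun_reg p r s _ (by simp [regs, h0p, hr.symm])
        have hstep : (p.run (iterRun p.run r s j)).setReg r
            ((Expr.add (.reg r) (.const 1)).eval (p.run (iterRun p.run r s j))) =
            iterRun p.run r s (j + 1) := by
          simp [iterRun, Expr.eval, p.run_reg _ hrp, iterRun_reg_counter]
        refine ⟨_, .loopTrue (t' := t') ?_ (.seq ht (.assign _ _ _)) (by rw [hstep]; exact ht'), ?_⟩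
        · simp only [Expr.eval, iterRun_reg_counter, hreg0]
          omega
        · simp only [Expr.cost]
          rw [hreg0] at hle
          rw [Nat.succ_mul]
          omega
    obtain ⟨t, ht, hle⟩ := key n 0 (by omega)
    refine ⟨_, .seq (.assign _ _ _) (by simpa [iterRun, run, ← hn, Expr.eval] using ht), ?_⟩
    simp only [time, Polynomial.eval_add, Polynomial.eval_C, Polynomial.eval_mul,
      Polynomial.eval_X, Expr.cost]
    omega

end Cmd

end RAM

/-! ### Trees in digraphs and how to cut them -/

namespace SCSS

/-- `Tree G v S c`: in the digraph `G` there is a tree with root `v` and `c` edges that contains a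
directed path from `v` to every vertex of `S`. -/
inductive Tree (G : ℕ → ℕ → Prop) : ℕ → Finset ℕ → ℕ → Prop
  | empty (v : ℕ) : Tree G v ∅ 0
  | single (v : ℕ) : Tree G v {v} 0
  | edge {u v : ℕ} {S : Finset ℕ} {c : ℕ} : G u v → Tree G v S c → Tree G u S (c + 1)
  | join {v : ℕ} {S S' : Finset ℕ} {c c' : ℕ} :
      Tree G v S c → Tree G v S' c' → Disjoint S S' → Tree G v (S ∪ S') (c + c')

/-- `IsDist G n D`: for vertices below `n`, `D` is the distance in `G` truncated at `n`. -/
structure IsDist (G : ℕ → ℕ → Prop) (n : ℕ) (D : ℕ → ℕ → ℕ) : Prop where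
  bound : ∀ u v, G u v → u < n ∧ v < n
  self : ∀ v < n, D v v = 0
  head : ∀ u v w, G u w → v < n → D u v ≤ D w v + 1
  tail : ∀ u v w, G w v → u < n → D u v ≤ D u w + 1
  lt_of_reach : ∀ u v, v < n → Relation.ReflTransGen G u v → D u v < n
  step : ∀ u < n, ∀ v < n, D u v < n → D u v ≠ 0 → ∃ w, G u w ∧ D w v + 1 = D u v
  eq_of_zero : ∀ u < n, ∀ v < n, D u v = 0 → u = v

namespace Tree

variable {G : ℕ → ℕ → Prop} {n : ℕ} {D : ℕ → ℕ → ℕ}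

/-- The cost is not reduced along with the targets: a tree stays a valid comparison of the same cost
after some of its targets have been covered. -/
theorem mono {v : ℕ} {S : Finset ℕ} {c : ℕ} (h : Tree G v S c) :
    ∀ {S' : Finset ℕ}, S' ⊆ S → Tree G v S' c := by
  induction h with
  | empty v => intro S' h; rw [Finset.subset_empty.1 h]; exact .empty v
  | single v =>
    intro S' h
    rcases Finset.subset_singleton_iff.1 h with rfl | rfl
    · exact .empty v
    · exact .single v
  | edge hG _ ih => intro S' h; exact .edge hG (ih h)
  | @join v S₁ S₂ c c' _ _ hd ih ih' =>
    intro S' h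
    have : S' = (S' ∩ S₁) ∪ (S' ∩ S₂) := by
      rw [← Finset.inter_union_distrib_left, Finset.inter_eq_left.2 h]
    rw [this]
    exact .join (ih Finset.inter_subset_right) (ih' Finset.inter_subset_right)
      (hd.mono Finset.inter_subset_right Finset.inter_subset_right)

theorem reach {v : ℕ} {S : Finset ℕ} {c : ℕ} (h : Tree G v S c) :
    ∀ t ∈ S, Relation.ReflTransGen G v t := by
  induction h with
  | empty v => simp
  | single v => intro t ht; rw [Finset.mem_singleton.1 ht]
  | edge hG _ ih => intro t ht; exact .head hG (ih t ht)
  | join _ _ _ ih ih' =>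
    intro t ht
    rcases Finset.mem_union.1 ht with h | h
    · exact ih t h
    · exact ih' t h

theorem dist_le (hD : IsDist G n D) {v : ℕ} {S : Finset ℕ} {c : ℕ} (h : Tree G v S c) :
    ∀ t ∈ S, t < n → D v t ≤ c := by
  induction h with
  | empty v => simp
  | single v => intro t ht hn; rw [Finset.mem_singleton.1 ht] at *; simp [hD.self _ hn]
  | edge hG _ ih =>
    intro t ht hn
    have h1 := hD.head _ t _ hG hn
    have h2 := ih t ht hn
    omega
  | join _ _ _ ih ih' =>
    intro t ht hn
    rcases Finset.mem_union.1 ht with h | h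
    · have := ih t h hn; omega
    · have := ih' t h hn; omega

/-- Cutting a tree into pieces with between `s` and `2 s - 1` vertices to be reached, which leaves
over a tree with fewer than `s` of them. -/
theorem exists_remainder (hD : IsDist G n D) {r : ℕ} (hr : r < n) {s B : ℕ} {S₀ : Finset ℕ} (a b : ℕ)
    (hpiece : ∀ u S' c', S' ⊆ S₀ → Relation.ReflTransGen G r u → D r u ≤ B → Tree G u S' c' →
      s ≤ S'.card → S'.card < 2 * s → a * S'.card ≤ b * c')
    {v : ℕ} {S : Finset ℕ} {c : ℕ} (h : Tree G v S c) (hs : 0 < s) (hS : S ⊆ S₀)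
    (hv : Relation.ReflTransGen G r v) (hB : D r v + c ≤ B) :
    ∃ R c₀, R ⊆ S ∧ R.card < s ∧ c₀ ≤ c ∧ Tree G v R c₀ ∧
      a * (S.card - R.card) ≤ b * (c - c₀) := by
  induction h with
  | empty v => exact ⟨∅, 0, by simp, by simpa using hs, le_rfl, .empty v, by simp⟩
  | single v =>
    -- For s = 1 a single target is itself a piece and is cut off; for larger s it is left over.
    rcases eq_or_ne s 1 with rfl | hs1
    · exact ⟨∅, 0, by simp, by simp, le_rfl, .empty v, by
        simpa using hpiece v {v} 0 hS hv (by omega) (.single v) (by simp) (by simp)⟩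
    · exact ⟨{v}, 0, by simp, by simp; omega, le_rfl, .single v, by simp⟩
  | @edge u v S c hG _ ih =>
    -- Going down an arc raises the distance from r by at most one and lowers the remaining cost by
    -- one. So the bound B persists, and every piece is rooted within distance B of r.
    have := hD.tail _ _ _ hG hr
    obtain ⟨R, c₀, hRS, hRs, hc, hT, hab⟩ := ih hS (hv.tail hG) (by omega)
    exact ⟨R, c₀ + 1, hRS, hRs, by omega, .edge hG hT, by
      rwa [Nat.add_sub_add_right]⟩
  | @join v S₁ S₂ c c' _ _ hd ih ih' =>
    obtain ⟨R₁, c₁, hRS₁, hRs₁, hc₁, hT₁, hab₁⟩ :=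
      ih (Finset.union_subset_left hS) hv (by omega)
    obtain ⟨R₂, c₂, hRS₂, hRs₂, hc₂, hT₂, hab₂⟩ :=
      ih' (Finset.union_subset_right hS) hv (by omega)
    have hdR : Disjoint R₁ R₂ := hd.mono hRS₁ hRS₂
    have hcard := Finset.card_union_of_disjoint hdR
    have hcardS := Finset.card_union_of_disjoint hd
    have h₁ := Finset.card_le_card hRS₁
    have h₂ := Finset.card_le_card hRS₂
    obtain ⟨x₁, hx₁⟩ := Nat.exists_eq_add_of_le h₁
    obtain ⟨x₂, hx₂⟩ := Nat.exists_eq_add_of_le h₂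
    obtain ⟨y₁, rfl⟩ := Nat.exists_eq_add_of_le hc₁
    obtain ⟨y₂, rfl⟩ := Nat.exists_eq_add_of_le hc₂
    rw [hx₁] at hab₁ hcardS
    rw [hx₂] at hab₂ hcardS
    rw [Nat.add_sub_cancel_left, Nat.add_sub_cancel_left] at hab₁ hab₂
    -- Two remainders have fewer than 2 s targets in total, so their union is either again a
    -- remainder or a piece of admissible size, which is cut off completely.
    by_cases hlt : (R₁ ∪ R₂).card < s
    · refine ⟨R₁ ∪ R₂, c₁ + c₂, Finset.union_subset_union hRS₁ hRS₂, hlt, by omega,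
        .join hT₁ hT₂ hdR, ?_⟩
      rw [hcardS, hcard, show R₁.card + x₁ + (R₂.card + x₂) - (R₁.card + R₂.card) = x₁ + x₂ by omega,
        show c₁ + y₁ + (c₂ + y₂) - (c₁ + c₂) = y₁ + y₂ by omega]
      linarith
    · refine ⟨∅, 0, by simp, by simp; omega, by omega, .empty v, ?_⟩
      have := hpiece v (R₁ ∪ R₂) (c₁ + c₂)
        ((Finset.union_subset_union hRS₁ hRS₂).trans hS) hv (by omega) (.join hT₁ hT₂ hdR) (by omega) (by omega)
      rw [hcard] at this
      simp only [hcardS, Finset.card_empty, Nat.sub_zero]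
      linarith

/-- A tree has a piece with between `s` and `2 s - 1` vertices to be reached whose density is at
most twice that of the tree. -/
theorem exists_piece (hD : IsDist G n D) {r : ℕ} (hr : r < n) {s : ℕ} {S : Finset ℕ} {c : ℕ}
    (h : Tree G r S c) (hs : 0 < s) (hsS : s ≤ S.card) :
    ∃ u S' c', Relation.ReflTransGen G r u ∧ D r u ≤ c ∧ Tree G u S' c' ∧ S' ⊆ S ∧
      s ≤ S'.card ∧ S'.card < 2 * s ∧ c' * S.card ≤ 2 * c * S'.card := by
  have hrr := hD.self r hr
  by_cases hlt : S.card < 2 * s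
  · exact ⟨r, S, c, .refl, by omega, h, subset_rfl, hsS, hlt, by nlinarith⟩
  -- Otherwise every piece has more than twice the density of the tree. Since fewer than s ≤ |S| / 2
  -- targets are left over, more than half of S is cut off, and the pieces together would cost more
  -- than c.
  by_contra hcon
  push Not at hcon
  have hrem := fun a b hp => exists_remainder hD hr (s := s) (B := c) (S₀ := S) a b hp h hs
    subset_rfl .refl (by omega)
  -- For c = 0 the pair (2 c, |S|) carries no information. Here each piece has cost at least 1, so
  -- the pair (1, |S|) serves instead.
  rcases Nat.eq_zero_or_pos c with rfl | hc
  · obtain ⟨R, c₀, hRS, hRs, hc, -, hab⟩ := hrem 1 S.card (by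
      intro u S' c' hS' hu hDu hT h1 h2
      have h3 := hcon u S' c' hu hDu hT hS' h1 h2
      have h4 := Finset.card_le_card hS'
      have h5 : 1 ≤ c' := Nat.pos_of_ne_zero (by rintro rfl; simp at h3)
      nlinarith)
    simp at hab
    omega
  · obtain ⟨R, c₀, hRS, hRs, hc', -, hab⟩ := hrem (2 * c) S.card (by
      intro u S' c' hS' hu hDu hT h1 h2
      have h3 := hcon u S' c' hu hDu hT hS' h1 h2
      linarith)
    have h1 : S.card * (c - c₀) ≤ S.card * c := Nat.mul_le_mul_left _ (Nat.sub_le _ _)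
    have h2 : S.card + 1 ≤ 2 * (S.card - R.card) := by omega
    nlinarith

end Tree

/-! ### From reachability to a tree -/

/-- A set of vertices that can be grown from `r` along arcs of `G`. -/
inductive Grown (G : ℕ → ℕ → Prop) (r : ℕ) : Finset ℕ → Prop
  | root : Grown G r {r}
  | step {W : Finset ℕ} {w x : ℕ} : Grown G r W → w ∈ W → x ∉ W → G w x → Grown G r (insert x W)

namespace Grown

variable {G : ℕ → ℕ → Prop} {r : ℕ} {W : Finset ℕ}

theorem card_pos (h : Grown G r W) : 0 < W.card := by
  cases h <;> simp

/-- Trees attached to the vertices of a grown set combine to one tree. -/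
theorem tree (h : Grown G r W) : ∀ (X : Finset ℕ) (g : ℕ → ℕ) (c : ℕ → ℕ), (∀ t ∈ X, g t ∈ W) →
    (∀ w ∈ W, Tree G w (X.filter (g · = w)) (c w)) →
    Tree G r X (∑ w ∈ W, c w + (W.card - 1)) := by
  induction h with
  | root =>
    intro X g c hg hT
    have := hT r (by simp)
    rw [Finset.filter_true_of_mem (fun t ht => by simpa using hg t ht)] at this
    simpa using this
  | @step W w x hW hw hx hG ih =>
    intro X g c hg hT
    have hwx : w ≠ x := by rintro rfl; exact hx hw
    -- The new vertex x is folded into w: the targets assigned to x are reassigned to w, whose tree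
    -- is joined with the arc to x and the tree at x.
    have := ih X (fun t => if g t = x then w else g t)
      (fun z => if z = w then c w + (c x + 1) else c z) (by
        intro t ht
        have := hg t ht
        simp only [Finset.mem_insert] at this
        by_cases h : g t = x <;> simp_all) (by
        intro z hz
        by_cases hzw : z = w
        · subst hzw
          have hj := Tree.join (hT z (by simp [hz])) (.edge hG (hT x (by simp))) (by
            rw [Finset.disjoint_filter]; intro t _ h1 h2; exact hwx (h1.symm.trans h2))
          simp only [if_true]
          convert hj using 1
          ext t
          simp only [Finset.mem_filter, Finset.mem_union]
          by_cases h : g t = x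
          · simp only [h, if_true]; tauto
          · simp [h]
        · have hzx : z ≠ x := by rintro rfl; exact hx hz
          simp only [hzw, if_false]
          convert hT z (by simp [hz]) using 1
          ext t
          simp only [Finset.mem_filter]
          by_cases h : g t = x
          · simp [h, hzx.symm, Ne.symm hzw]
          · simp [h])
    convert this using 1
    rw [Finset.sum_insert hx, Finset.card_insert_of_notMem hx]
    have h1 := Finset.add_sum_erase W c hw
    have h2 := Finset.add_sum_erase W (fun z => if z = w then c w + (c x + 1) else c z) hw
    have h3 : ∑ z ∈ W.erase w, (if z = w then c w + (c x + 1) else c z) = ∑ z ∈ W.erase w, c z :=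
      Finset.sum_congr rfl (fun z hz => by simp [Finset.ne_of_mem_erase hz])
    simp only [if_true] at h2
    have := hW.card_pos
    omega

/-- A grown set is a tree that reaches all its vertices. -/
theorem tree_of_subset (h : Grown G r W) {X : Finset ℕ} (hX : X ⊆ W) :
    Tree G r X (W.card - 1) := by
  have := h.tree X id (fun _ => 0) (fun t ht => hX ht) (fun w _ => by
    by_cases hw : w ∈ X
    · convert Tree.single (G := G) w using 1
      ext t; simp; rintro rfl; exact hw
    · convert Tree.empty (G := G) w using 1
      ext t; simp; rintro ht rfl; exact hw ht)
  simpa using this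

theorem subset_insert (h : Grown G r W) {F : Finset (ℕ × ℕ)} (hF : ∀ u v, G u v → (u, v) ∈ F) :
    W ⊆ insert r (F.image Prod.snd) := by
  induction h with
  | root => simp
  | @step W w x _ _ _ hG ih =>
    refine Finset.insert_subset ?_ ih
    exact Finset.mem_insert_of_mem (Finset.mem_image_of_mem Prod.snd (hF w x hG))

end Grown

/-- If `r` reaches all of `X` by a finite set `F` of arcs, then there is a tree for `X` with at most
`|F|` arcs. -/
theorem exists_tree {F : Finset (ℕ × ℕ)} {r : ℕ} {X : Finset ℕ}
    (hX : ∀ t ∈ X, Relation.ReflTransGen (fun a b => (a, b) ∈ F) r t) :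
    ∃ c ≤ F.card, Tree (fun a b => (a, b) ∈ F) r X c := by
  have hsub : ∀ W, Grown (fun a b => (a, b) ∈ F) r W → W ⊆ insert r (F.image Prod.snd) :=
    fun W hW => hW.subset_insert (fun u v h => h)
  classical
  -- A grown set of maximal size is closed under the arcs of F, hence contains X. Each of its
  -- vertices other than r is the head of an arc of F, which bounds its size by |F| + 1.
  obtain ⟨W, hW, hmax⟩ : ∃ W, Grown (fun a b => (a, b) ∈ F) r W ∧
      ∀ W', Grown (fun a b => (a, b) ∈ F) r W' → W'.card ≤ W.card := by
    have hne : (((insert r (F.image Prod.snd)).powerset).filter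
        (fun W => Grown (fun a b => (a, b) ∈ F) r W)).Nonempty :=
      ⟨{r}, by simpa using Grown.root⟩
    obtain ⟨W, hW, hmax⟩ := Finset.exists_max_image _ Finset.card hne
    simp only [Finset.mem_filter, Finset.mem_powerset] at hW hmax
    exact ⟨W, hW.2, fun W' hW' => hmax W' ⟨hsub W' hW', hW'⟩⟩
  have hclosed : ∀ w ∈ W, ∀ x, (w, x) ∈ F → x ∈ W := by
    intro w hw x hx
    by_contra hxW
    have := hmax _ (Grown.step hW hw hxW hx)
    rw [Finset.card_insert_of_notMem hxW] at this
    omega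
  have hr : r ∈ W := by
    have : ∀ W, Grown (fun a b => (a, b) ∈ F) r W → r ∈ W := by
      intro W h
      induction h with
      | root => simp
      | step _ _ _ _ ih => exact Finset.mem_insert_of_mem ih
    exact this W hW
  refine ⟨W.card - 1, ?_, hW.tree_of_subset ?_⟩
  · have h1 := Finset.card_le_card (hsub W hW)
    have h2 := Finset.card_insert_le r (F.image Prod.snd)
    have h3 := Finset.card_image_le (s := F) (f := Prod.snd)
    omega
  · intro t ht
    have hrt := hX t ht
    clear ht
    induction hrt with
    | refl => exact hr
    | tail _ hG ih => exact hclosed _ ih _ hG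

theorem Tree.mono_graph {G G' : ℕ → ℕ → Prop} (hG : ∀ u v, G u v → G' u v) {v : ℕ} {S : Finset ℕ}
    {c : ℕ} (h : Tree G v S c) : Tree G' v S c := by
  induction h with
  | empty v => exact .empty v
  | single v => exact .single v
  | edge h _ ih => exact .edge (hG _ _ h) ih
  | join _ _ hd ih ih' => exact .join ih ih' hd

end SCSS

/-! ### Truncated distances from local conditions -/

namespace SCSS

variable {G : ℕ → ℕ → Prop} {n : ℕ} {D : ℕ → ℕ → ℕ}

/-- The local properties of truncated distances, which determine them. -/
structure IsLocalDist (G : ℕ → ℕ → Prop) (n : ℕ) (D : ℕ → ℕ → ℕ) : Prop where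
  bound : ∀ u v, G u v → u < n ∧ v < n
  le : ∀ u < n, ∀ v < n, D u v ≤ n
  self : ∀ v < n, D v v = 0
  head : ∀ u v w, G u w → v < n → D w v < n → D u v ≤ D w v + 1
  step : ∀ u < n, ∀ v < n, D u v < n → D u v ≠ 0 → ∃ w, G u w ∧ D w v + 1 = D u v
  eq_of_zero : ∀ u < n, ∀ v < n, D u v = 0 → u = v

namespace IsLocalDist

/-- By `step` one can descend towards v so that the value drops by exactly one each time, hence no
value is skipped. -/
theorem exists_eq (h : IsLocalDist G n D) {w v m : ℕ} (hw : w < n) (hv : v < n) (hm : D w v = m)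
    (hmn : m < n) : ∀ j ≤ m, ∃ x < n, D x v = j := by
  induction m generalizing w with
  | zero => intro j hj; exact ⟨w, hw, by omega⟩
  | succ m ih =>
    intro j hj
    rcases Nat.lt_or_ge m j with hlt | hle
    · exact ⟨w, hw, by omega⟩
    · obtain ⟨x, hx, hxv⟩ := h.step w hw v hv (by omega) (by omega)
      exact ih (h.bound _ _ hx).2 (by omega) (by omega) j hle

/-- Pigeonhole: along an arc the value grows by at most one, so if it first reached n at u, then all
the n + 1 values 0, …, n would occur among n vertices. -/
theorem lt_of_reach (h : IsLocalDist G n D) (u v : ℕ) (hv : v < n)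
    (hr : Relation.ReflTransGen G u v) : D u v < n := by
  induction hr using Relation.ReflTransGen.head_induction_on with
  | refl => rw [h.self v hv]; omega
  | @head u w hG _ ih =>
    obtain ⟨hu, hw⟩ := h.bound _ _ hG
    have h1 := h.head u v w hG hv ih
    by_contra hge
    have hsub : Finset.range (n + 1) ⊆ (Finset.range n).image (fun x => D x v) := by
      intro j hj
      simp only [Finset.mem_range, Finset.mem_image] at hj ⊢
      rcases Nat.lt_or_ge (D w v) j with hlt | hle
      · exact ⟨u, hu, by have := h.le u hu v hv; omega⟩
      · exact h.exists_eq hw hv rfl ih j hle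
    have h2 := (Finset.card_le_card hsub).trans Finset.card_image_le
    simp at h2

theorem isDist (h : IsLocalDist G n D) : IsDist G n D where
  bound := h.bound
  self := h.self
  head u v w hG hv := by
    by_cases hlt : D w v < n
    · exact h.head u v w hG hv hlt
    · have := h.le u (h.bound _ _ hG).1 v hv; omega
  tail u v w hG hu := by
    obtain ⟨hw, hv⟩ := h.bound _ _ hG
    by_cases hlt : D u w < n
    -- The local condition `head` concerns the first arc of a path, `tail` the last one. Induction
    -- on the distance from u to w peels off first arcs until u = w.
    · have : ∀ m u, u < n → D u w = m → m < n → D u v ≤ m + 1 := by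
        intro m
        induction m with
        | zero =>
          intro u hu hm _
          obtain rfl := h.eq_of_zero u hu w hw hm
          have := h.head u v v hG hv (by rw [h.self v hv]; omega)
          rwa [h.self v hv] at this
        | succ m ih =>
          intro u hu hm hmn
          obtain ⟨x, hx, hxw⟩ := h.step u hu w hw (by omega) (by omega)
          have hx' := (h.bound _ _ hx).2
          have h1 := ih x hx' (by omega) (by omega)
          by_cases hlt' : D x v < n
          · have := h.head u v x hx hv hlt'; omega
          · have := h.le u hu v hv; omega
      exact this _ u hu rfl hlt
    · have := h.le u hu v hv; omega
  lt_of_reach := h.lt_of_reach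
  step := h.step
  eq_of_zero := h.eq_of_zero

end IsLocalDist

/-! ### Densities and the analysis of the recursive greedy covering -/

/-- The total length of a set of vertex pairs. -/
def weight (D : ℕ → ℕ → ℕ) (M : Finset (ℕ × ℕ)) : ℕ := ∑ p ∈ M, D p.1 p.2

theorem weight_insert_le (D : ℕ → ℕ → ℕ) (M : Finset (ℕ × ℕ)) (u v : ℕ) :
    weight D (insert (u, v) M) ≤ weight D M + D u v := by
  unfold weight
  by_cases h : (u, v) ∈ M
  · rw [Finset.insert_eq_of_mem h]; omega
  · rw [Finset.sum_insert h]; exact (Nat.add_comm _ _).le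

/-- Reachability by the pairs in `M`. -/
def Reach (M : Finset (ℕ × ℕ)) : ℕ → ℕ → Prop := Relation.ReflTransGen fun a b => (a, b) ∈ M

theorem Reach.mono {M M' : Finset (ℕ × ℕ)} (h : M ⊆ M') {u v : ℕ} (hr : Reach M u v) :
    Reach M' u v :=
  Relation.ReflTransGen.mono (fun _ _ hab => h hab) _ _ hr

/-- The set `M` of pairs was enlarged to `M'` at cost `c`, and the pairs lead from `v` to the `k`
elements of `X` that are not in `X'`. -/
structure Sound (n : ℕ) (D : ℕ → ℕ → ℕ) (v : ℕ) (X : Finset ℕ) (M : Finset (ℕ × ℕ))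
    (X' : Finset ℕ) (M' : Finset (ℕ × ℕ)) (c k : ℕ) : Prop where
  sub : X' ⊆ X
  card : k + X'.card = X.card
  mono : M ⊆ M'
  lt : ∀ p ∈ M', p ∉ M → D p.1 p.2 < n
  weight_le : weight D M' ≤ weight D M + c
  reach : ∀ x ∈ X, x ∉ X' → Reach M' v x

namespace Sound

variable {v u c c' k k' : ℕ} {X X' X'' : Finset ℕ} {M M' M'' : Finset (ℕ × ℕ)}

theorem refl (n : ℕ) (D : ℕ → ℕ → ℕ) (v : ℕ) (X : Finset ℕ) (M : Finset (ℕ × ℕ)) :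
    Sound n D v X M X M 0 0 :=
  ⟨subset_rfl, by simp, subset_rfl, fun _ h h' => absurd h h', le_rfl, fun _ h h' => absurd h h'⟩

theorem trans (h : Sound n D v X M X' M' c k) (h' : Sound n D v X' M' X'' M'' c' k') :
    Sound n D v X M X'' M'' (c + c') (k + k') where
  sub := h'.sub.trans h.sub
  card := by have := h.card; have := h'.card; omega
  mono := h.mono.trans h'.mono
  lt p hp hpM := by
    by_cases hp' : p ∈ M'
    · exact h.lt p hp' hpM
    · exact h'.lt p hp hp'
  weight_le := by have := h.weight_le; have := h'.weight_le; omega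
  reach x hx hx' := by
    by_cases hxX : x ∈ X'
    · exact h'.reach x hxX hx'
    · exact (h.reach x hx hxX).mono h'.mono

/-- The pair (v, u) leads from v to u, so whatever is reached from u is also reached from v. Its
price is paid once, however many coverings from u follow. -/
theorem of_insert (h : Sound n D u X (insert (v, u) M) X' M' c k) (hD : D v u < n) :
    Sound n D v X M X' M' (D v u + c) k where
  sub := h.sub
  card := h.card
  mono := (Finset.subset_insert _ _).trans h.mono
  lt p hp hpM := by
    by_cases hp' : p = (v, u)
    · subst hp'; exact hD
    · exact h.lt p hp (by simp [hp', hpM])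
  weight_le := by have := h.weight_le; have := weight_insert_le D M v u; omega
  reach x hx hx' := .head (h.mono (Finset.mem_insert_self _ _)) (h.reach x hx hx')

end Sound

/-- The cost `cost` of covering `cov` elements of `X` has a density that is at most `C * q` times
that of every tree with root `v` for at most `q ^ e` elements of `X`. -/
def Quality (G : ℕ → ℕ → Prop) (C e v : ℕ) (X : Finset ℕ) (cost cov : ℕ) : Prop :=
  ∀ q S c, Tree G v S c → S ⊆ X → S.Nonempty → S.card ≤ q ^ e →
    0 < cov ∧ cost * S.card ≤ C * q * c * cov

/-- The density `c / k` is at most `b / a`. -/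
def Good (a b c k : ℕ) : Prop := 0 < k ∧ c * a ≤ b * k

/-- Densities are compared by cross-multiplication, exactly as the program does. A strict win forces
k > 0, since otherwise the right-hand side vanishes. -/
theorem Good.of_lt {a b c k bc bk : ℕ} (h : Good a b bc bk) (hlt : c * bk < bc * k) :
    Good a b c k := by
  refine ⟨Nat.pos_of_ne_zero (by rintro rfl; simp at hlt), ?_⟩
  refine Nat.le_of_mul_le_mul_right (c := bk) ?_ h.1
  calc c * a * bk = c * bk * a := by ring
    _ ≤ bc * k * a := Nat.mul_le_mul_right _ hlt.le
    _ = bc * a * k := by ring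
    _ ≤ b * bk * k := Nat.mul_le_mul_right _ h.2
    _ = b * k * bk := by ring

/-- The hypothesis `hb` describes the initial record 1 / 0, an infinite density. Every candidate
with k > 0 beats it, so a candidate that does not win shows bk > 0, and the record is at least as
good. -/
theorem Good.of_not_lt {a b c k bc bk : ℕ} (h : Good a b c k) (hlt : ¬ c * bk < bc * k)
    (hb : bk = 0 → bc = 1) : Good a b bc bk := by
  have hbk : 0 < bk := by
    refine Nat.pos_of_ne_zero (fun h0 => ?_)
    have := h.1
    simp [hb h0, h0] at hlt
    omega
  refine ⟨hbk, Nat.le_of_mul_le_mul_right (c := k) ?_ h.1⟩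
  calc bc * a * k = bc * k * a := by ring
    _ ≤ c * bk * a := Nat.mul_le_mul_right _ (not_lt.1 hlt)
    _ = c * a * bk := by ring
    _ ≤ b * k * bk := Nat.mul_le_mul_right _ h.2
    _ = b * bk * k := by ring

/-- The best density `bc / bk` is not worse than what the greedy covering from `u`, which is reached
at cost `d`, guarantees by the time it has covered half of the vertices of some tree. -/
def SeenFor (d C q c' m bc bk : ℕ) : Prop :=
  ∀ a b, (∀ c k, 0 < k → c * m ≤ d * m + 2 * (C * q * c' * k) → m ≤ 2 * k → c * a ≤ b * k) →
    Good a b bc bk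

/-- `SeenFor` for all trees with root `u` to which the guarantee applies. -/
def Seen (G : ℕ → ℕ → Prop) (d C e u : ℕ) (X : Finset ℕ) (bc bk : ℕ) : Prop :=
  ∀ q S c, Tree G u S c → S ⊆ X → S.Nonempty → S.card ≤ q ^ e → SeenFor d C q c S.card bc bk

/-- The invariant of the greedy covering from `u` after `j` rounds, with cost `c` so far and `k`
vertices covered. -/
def Track (G : ℕ → ℕ → Prop) (d C e u : ℕ) (X : Finset ℕ) (j c k bc bk : ℕ) : Prop :=
  ∀ q S c', Tree G u S c' → S ⊆ X → S.Nonempty → S.card ≤ q ^ e →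
    SeenFor d C q c' S.card bc bk ∨
      2 * k < S.card ∧ j ≤ k ∧ c * S.card ≤ d * S.card + 2 * (C * q * c' * k)

variable {d C e u : ℕ} {X : Finset ℕ} {j c k bc bk : ℕ}

theorem Seen.of_lt (h : Seen G d C e u X bc bk) (hlt : c * bk < bc * k) : Seen G d C e u X c k :=
  fun q S c' hT hS hne hq a b hab => (h q S c' hT hS hne hq a b hab).of_lt hlt

theorem Track.zero : Track G d C e u X 0 d 0 bc bk :=
  fun q S c' _ _ hne _ => .inr ⟨by simpa using hne, le_rfl, by simp⟩

/-- As long as the alternative in `Track` persists, each round covers a new vertex. After n rounds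
this makes n covered vertices, yet fewer than half of |S| ≤ n: a contradiction. -/
theorem Track.seen (h : Track G d C e u X n c k bc bk) (hX : X ⊆ Finset.range n) :
    Seen G d C e u X bc bk := by
  intro q S c' hT hS hne hq
  rcases h q S c' hT hS hne hq with h | ⟨h1, h2, -⟩
  · exact h
  · have := Finset.card_le_card (hS.trans hX)
    rw [Finset.card_range] at this
    omega

/-- While less than half of S is covered, the same tree still serves at least half of S, so the next
covering has at most twice the density that the guarantee allows for all of S. This is the origin of
the factor 2 in `SeenFor`. Once half of S is covered, the current candidate either becomes the
record or has lost to a better one. -/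
theorem Track.step (h : Track G d C e u X j c k bc bk) {X' : Finset ℕ} (hX : X' ⊆ X)
    (hcard : k + X'.card = X.card) {cost cov : ℕ} (hQ : Quality G C e u X' cost cov)
    (hb : bk = 0 → bc = 1) :
    (((c + cost) * bk < bc * (k + cov)) →
      Track G d C e u X (j + 1) (c + cost) (k + cov) (c + cost) (k + cov)) ∧
    ((¬ (c + cost) * bk < bc * (k + cov)) →
      Track G d C e u X (j + 1) (c + cost) (k + cov) bc bk) := by
  have key : ∀ q S c', Tree G u S c' → S ⊆ X → S.Nonempty → S.card ≤ q ^ e →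
      SeenFor d C q c' S.card bc bk ∨ (j + 1 ≤ k + cov ∧
        (c + cost) * S.card ≤ d * S.card + 2 * (C * q * c' * (k + cov))) := by
    intro q S c' hT hS hne hq
    rcases h q S c' hT hS hne hq with h | ⟨h1, h2, h3⟩
    · exact .inl h
    · right
      -- At most k elements of S have been covered, since X loses only k elements altogether.
      have hS' : S.card ≤ (S ∩ X').card + k := by
        have h4 := Finset.card_inter_add_card_sdiff S X'
        have h5 : S \ X' ⊆ X \ X' := Finset.sdiff_subset_sdiff hS subset_rfl
        have h6 := Finset.card_le_card h5
        rw [Finset.card_sdiff_of_subset hX] at h6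
        omega
      obtain ⟨hcov, hle⟩ := hQ q (S ∩ X') c' (hT.mono Finset.inter_subset_left)
        Finset.inter_subset_right (Finset.card_pos.1 (by omega))
        ((Finset.card_le_card Finset.inter_subset_left).trans hq)
      refine ⟨by omega, ?_⟩
      have h7 : cost * S.card ≤ 2 * (cost * (S ∩ X').card) := by
        rw [← Nat.mul_left_comm]; exact Nat.mul_le_mul_left _ (by omega)
      rw [Nat.add_mul, Nat.mul_add]
      omega
  constructor
  · intro hlt q S c' hT hS hne hq
    rcases key q S c' hT hS hne hq with h | ⟨h1, h2⟩
    · exact .inl fun a b hab => (h a b hab).of_lt hlt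
    · by_cases hk : 2 * (k + cov) < S.card
      · exact .inr ⟨hk, h1, h2⟩
      · exact .inl fun a b hab => ⟨by omega, hab _ _ (by omega) h2 (by omega)⟩
  · intro hlt q S c' hT hS hne hq
    rcases key q S c' hT hS hne hq with h | ⟨h1, h2⟩
    · exact .inl h
    · by_cases hk : 2 * (k + cov) < S.card
      · exact .inr ⟨hk, h1, h2⟩
      · exact .inl fun a b hab => Good.of_not_lt
          ⟨by omega, hab _ _ (by omega) h2 (by omega)⟩ hlt hb

/-- The guarantee for one more level of recursion. -/
theorem Quality.of_seen (hD : IsDist G n D) {v : ℕ} (hv : v < n)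
    (h : ∀ u < n, D v u < n → Seen G (D v u) C e u X bc bk) :
    Quality G (4 * (C + 1)) (e + 1) v X bc bk := by
  intro q S c hT hS hne hq
  have hS0 : 0 < S.card := Finset.card_pos.2 hne
  have hq0 : 0 < q := Nat.pos_of_ne_zero (by rintro rfl; rw [zero_pow (by omega)] at hq; omega)
  -- This is |S| / (2 q) rounded up: large enough for |S| ≤ 2 q s, and small enough that pieces,
  -- with at most 2 s - 1 targets, satisfy the size bound q ^ e of the lower level.
  obtain ⟨s, hs⟩ : ∃ s, s = (S.card - 1) / (2 * q) + 1 := ⟨_, rfl⟩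
  have hdiv := Nat.div_mul_le_self (S.card - 1) (2 * q)
  have hlt := Nat.lt_div_mul_add (a := S.card - 1) (b := 2 * q) (by omega)
  have hsq : S.card ≤ 2 * q * s := by
    have : 2 * q * s = (S.card - 1) / (2 * q) * (2 * q) + 2 * q := by rw [hs]; ring
    rw [this]; omega
  have hsS : s ≤ S.card := by
    have := Nat.div_le_self (S.card - 1) (2 * q); omega
  have hse : 2 * s ≤ q ^ e + 1 := by
    rw [pow_succ] at hq
    have h1 : ((S.card - 1) / (2 * q) * 2) * q < q ^ e * q := by
      calc _ = (S.card - 1) / (2 * q) * (2 * q) := by ring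
        _ < _ := by omega
    have := Nat.lt_of_mul_lt_mul_right h1
    omega
  obtain ⟨u, S', c', hr, hDu, hT', hS', hs1, hs2, hden⟩ :=
    hT.exists_piece hD hv (hs ▸ Nat.succ_pos _) hsS
  have hu : u < n := by
    rcases Relation.ReflTransGen.cases_tail hr with rfl | ⟨w, -, hw⟩
    · exact hv
    · exact (hD.bound _ _ hw).2
  -- `SeenFor` is applied to the piece with the target density 4 (C + 1) q c / |S|. It remains to
  -- check that any candidate (t, k) covering half as many vertices as the piece has, within the
  -- greedy cost bound, meets this target.
  refine h u hu (hD.lt_of_reach _ _ hu hr) q S' c' hT' (hS'.trans hS)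
    (Finset.card_pos.1 (by omega)) (by omega) S.card (4 * (C + 1) * q * c) ?_
  intro t k hk ht hk2
  have hS'0 : 0 < S'.card := by omega
  refine Nat.le_of_mul_le_mul_right (c := S'.card) ?_ hS'0
  -- The way to u costs at most c and is shared by k ≥ |S'| / 2 vertices, where |S'| ≥ |S| / (2 q):
  -- this contributes 4 q c / |S|. The lower level contributes 4 C q c / |S|, because the piece has
  -- at most twice the density of the tree.
  have h1 : D v u * S'.card * S.card ≤ c * (2 * k) * (2 * q * S'.card) := by
    refine Nat.mul_le_mul (Nat.mul_le_mul hDu hk2) (hsq.trans (Nat.mul_le_mul_left _ hs1))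
  have h2 : 2 * (C * q * c' * k) * S.card ≤ 2 * C * q * k * (2 * c * S'.card) := by
    calc 2 * (C * q * c' * k) * S.card = 2 * C * q * k * (c' * S.card) := by ring
      _ ≤ _ := Nat.mul_le_mul_left _ hden
  have h3 := Nat.mul_le_mul_right S.card ht
  rw [Nat.add_mul] at h3
  calc t * S.card * S'.card = t * S'.card * S.card := by ring
    _ ≤ c * (2 * k) * (2 * q * S'.card) + 2 * C * q * k * (2 * c * S'.card) := by omega
    _ = 4 * (C + 1) * q * c * k * S'.card := by ring

/-- The guarantee of covering the nearest vertex. -/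
theorem Quality.of_nearest (hD : IsDist G n D) {v cost cov : ℕ} (hX : X ⊆ Finset.range n)
    (h : ∀ t ∈ X, D v t < n → 0 < cov ∧ cost ≤ D v t) : Quality G 1 1 v X cost cov := by
  intro q S c hT hS ⟨t, ht⟩ hq
  have htn : t < n := Finset.mem_range.1 (hX (hS ht))
  obtain ⟨h1, h2⟩ := h t (hS ht) (hD.lt_of_reach _ _ htn (hT.reach t ht))
  refine ⟨h1, ?_⟩
  have h3 := hT.dist_le hD t ht htn
  rw [pow_one] at hq
  calc cost * S.card ≤ c * q := Nat.mul_le_mul (h2.trans h3) hq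
    _ = 1 * q * c * 1 := by ring
    _ ≤ _ := Nat.mul_le_mul_left _ h1

/-- The difference consists of the k terms 1 / (x' + 1), …, 1 / x, each at least 1 / x. It
telescopes when the costs of successive coverings are added. -/
theorem div_le_harmonic_sub {x x' k : ℕ} (h : k + x' = x) (hx : 0 < x) :
    (k : ℝ) / x ≤ harmonic x - harmonic x' := by
  obtain rfl := h
  -- The denominator is decoupled from k, so that it stays fixed during the induction.
  have : ∀ k, ∀ y : ℕ, k + x' ≤ y → 0 < y → (k : ℝ) / y ≤ harmonic (k + x') - harmonic x' := by
    intro k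
    induction k with
    | zero => intro y _ _; simp
    | succ k ih =>
      intro y hy hy0
      have h1 := ih y (by omega) hy0
      rw [show k + 1 + x' = (k + x') + 1 by omega, harmonic_succ]
      push_cast
      rw [add_div]
      have h2 : (1 : ℝ) / y ≤ ((k : ℝ) + x' + 1)⁻¹ := by
        rw [one_div]
        apply inv_anti₀ (by positivity)
        exact_mod_cast (by omega : k + x' + 1 ≤ y)
      linarith
  exact this k _ le_rfl hx

end SCSS

/-! ### Matrices, expressions and loop rules on the machine -/

namespace RAM

theorem idx_inj {n u v u' v' : ℕ} (hv : v < n) (hv' : v' < n) :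
    u * n + v = u' * n + v' ↔ u = u' ∧ v = v' := by
  refine ⟨fun h => ?_, fun ⟨h1, h2⟩ => by rw [h1, h2]⟩
  have hn : 0 < n := by omega
  have h1 := congrArg (· / n) h
  have h2 := congrArg (· % n) h
  simp only [Nat.mul_comm _ n, Nat.mul_add_div hn, Nat.div_eq_of_lt hv, Nat.div_eq_of_lt hv',
    Nat.mul_add_mod, Nat.mod_eq_of_lt hv, Nat.mod_eq_of_lt hv', Nat.add_zero] at h1 h2
  exact ⟨h1, h2⟩

theorem idx_lt {n u v : ℕ} (hu : u < n) (hv : v < n) : u * n + v < n * n := by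
  calc u * n + v < u * n + n := by omega
    _ = (u + 1) * n := by ring
    _ ≤ n * n := Nat.mul_le_mul_right _ hu

/-- The set of indices below `n` that are marked in the array `A`. -/
def marked (n : ℕ) (A : ℕ → ℕ) : Finset ℕ := (Finset.range n).filter (A · ≠ 0)

/-- The set of pairs that are marked in the `n × n` matrix stored in the array `A`. -/
def markedPairs (n : ℕ) (A : ℕ → ℕ) : Finset (ℕ × ℕ) :=
  (Finset.range n ×ˢ Finset.range n).filter fun p => A (p.1 * n + p.2) ≠ 0

section marked

variable {n : ℕ} {A B : ℕ → ℕ}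

@[simp] theorem mem_marked {i : ℕ} : i ∈ marked n A ↔ i < n ∧ A i ≠ 0 := by simp [marked]

@[simp] theorem mem_markedPairs {p : ℕ × ℕ} :
    p ∈ markedPairs n A ↔ (p.1 < n ∧ p.2 < n) ∧ A (p.1 * n + p.2) ≠ 0 := by simp [markedPairs]

theorem marked_subset_range : marked n A ⊆ Finset.range n := Finset.filter_subset _ _

theorem marked_congr (h : ∀ i < n, A i = B i) : marked n A = marked n B := by
  ext i
  simp only [mem_marked, and_congr_right_iff]
  intro hi; rw [h i hi]

theorem markedPairs_congr (h : ∀ u < n, ∀ v < n, A (u * n + v) = B (u * n + v)) :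
    markedPairs n A = markedPairs n B := by
  ext p
  simp only [mem_markedPairs, and_congr_right_iff]
  intro hi; rw [h _ hi.1 _ hi.2]

theorem marked_update_zero (i : ℕ) : marked n (Function.update A i 0) = (marked n A).erase i := by
  ext j
  simp only [mem_marked, Finset.mem_erase, Function.update_apply]
  split_ifs with h <;> simp [h]

theorem markedPairs_update {u v x : ℕ} (hu : u < n) (hv : v < n) (hx : x ≠ 0) :
    markedPairs n (Function.update A (u * n + v) x) = insert (u, v) (markedPairs n A) := by
  ext ⟨a, b⟩
  simp only [mem_markedPairs, Finset.mem_insert, Function.update_apply, Prod.mk.injEq]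
  by_cases hb : b < n
  · simp only [idx_inj hb hv]
    by_cases h : a = u ∧ b = v
    · simp [h, hu, hv, hx]
    · simp [h]
  · have : b ≠ v := by omega
    simp [hb, this]

theorem markedPairs_update_zero {u v : ℕ} (hv : v < n) :
    markedPairs n (Function.update A (u * n + v) 0) = (markedPairs n A).erase (u, v) := by
  ext ⟨a, b⟩
  simp only [mem_markedPairs, Finset.mem_erase, Function.update_apply, Ne, Prod.mk.injEq]
  by_cases hb : b < n
  · simp only [idx_inj hb hv]
    by_cases h : a = u ∧ b = v
    · simp [h]
    · simp [h]
  · simp [hb]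

end marked

namespace Expr

/-- The index of the matrix entry in row `reg r` and column `reg r'`; array `3` holds the multiples
of the number of columns. -/
def idx (r r' : ℕ) : Expr := .add (.arr 3 (.reg r)) (.reg r')

/-- Equality as an expression. -/
def eq (a b : Expr) : Expr := .sub (.const 1) (.add (.sub a b) (.sub b a))

/-- Conjunction as an expression. -/
def and (a b : Expr) : Expr :=
  .sub (.add (.sub (.const 1) (.sub (.const 1) a)) (.sub (.const 1) (.sub (.const 1) b))) (.const 1)

theorem eval_eq (s : State) (a b : Expr) : (eq a b).eval s ≠ 0 ↔ a.eval s = b.eval s := by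
  simp only [eq, eval]; omega

theorem eval_and (s : State) (a b : Expr) :
    (and a b).eval s ≠ 0 ↔ a.eval s ≠ 0 ∧ b.eval s ≠ 0 := by
  simp only [and, eval]; omega

end Expr

/-- Register `0` holds `n`, and array `3` holds the multiples of `n`. -/
def Rows (n : ℕ) (s : State) : Prop := s.reg 0 = n ∧ ∀ u < n, s.arr 3 u = u * n

theorem Rows.eval_idx {n : ℕ} {s : State} (h : Rows n s) {r r' : ℕ} (hr : s.reg r < n) :
    (Expr.idx r r').eval s = s.reg r * n + s.reg r' := by
  simp [Expr.idx, Expr.eval, h.2 _ hr]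

theorem Rows.congr {n : ℕ} {s s' : State} (h : Rows n s) (h0 : s'.reg 0 = s.reg 0)
    (h3 : s'.arr 3 = s.arr 3) : Rows n s' := ⟨h0.trans h.1, fun u hu => by rw [h3]; exact h.2 u hu⟩

namespace Cmd

/-- The registers and arrays that the command `p` does not write are the same in `s` and `s'`. -/
def Frame (p : Cmd) (s s' : State) : Prop :=
  (∀ x, x ∉ p.regs → s'.reg x = s.reg x) ∧ ∀ a, a ∉ p.arrs → s'.arr a = s.arr a

theorem frame_run (p : Cmd) (s : State) : p.Frame s (p.run s) :=
  ⟨fun _ h => p.run_reg s h, fun _ h => p.run_arr s h⟩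

theorem Frame.rows {p : Cmd} {s s' : State} (h : p.Frame s s') {n : ℕ} (hs : Rows n s)
    (h0 : 0 ∉ p.regs) (h3 : 3 ∉ p.arrs) : Rows n s' :=
  hs.congr (h.1 _ h0) (h.2 _ h3)

theorem Frame.trans {p q p' : Cmd} {s s' s'' : State} (h : p.Frame s s') (h' : q.Frame s' s'')
    (hp : p.regs ⊆ p'.regs) (hq : q.regs ⊆ p'.regs) (hp' : p.arrs ⊆ p'.arrs)
    (hq' : q.arrs ⊆ p'.arrs) : p'.Frame s s'' :=
  ⟨fun x hx => (h'.1 x fun hx' => hx (hq hx')).trans (h.1 x fun hx' => hx (hp hx')),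
    fun x hx => (h'.2 x fun hx' => hx (hq' hx')).trans (h.2 x fun hx' => hx (hp' hx'))⟩

/-- The invariant rule for an invariant that does not depend on the counter. -/
theorem iter_rule {r : ℕ} {p : Cmd} {s : State} {n : ℕ} (hn : s.reg 0 = n)
    (I : ℕ → State → Prop)
    (hI : ∀ k s' x, I k s' → I k (s'.setReg r x)) (h0 : I 0 s)
    (hs : ∀ j s', j < n → s'.reg r = j → (iter r p).Frame s s' → I j s' → I (j + 1) (p.run s')) :
    I n ((iter r p).run s) := by
  subst hn
  exact iter_induction I (hI _ _ _ h0) fun j s' hj hr hf hf' h =>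
    hI _ _ _ (hs j s' hj hr ⟨hf, hf'⟩ h)

/-- The invariant rule for two nested loops over the entries of a matrix. -/
theorem iter_iter_rule {r r' : ℕ} {p : Cmd} {s : State} {n : ℕ} (hn : s.reg 0 = n)
    (hrr : r ≠ r') (hrp : r ∉ p.regs) (h0p : 0 ∉ p.regs) (hr0 : r ≠ 0) (hr0' : r' ≠ 0)
    (I : ℕ → State → Prop)
    (hI : ∀ k s' x, I k s' → I k (s'.setReg r x)) (hI' : ∀ k s' x, I k s' → I k (s'.setReg r' x))
    (h0 : I 0 s)
    (hs : ∀ u v s', u < n → v < n → s'.reg r = u → s'.reg r' = v →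
      (iter r (iter r' p)).Frame s s' → I (u * n + v) s' → I (u * n + v + 1) (p.run s')) :
    I (n * n) ((iter r (iter r' p)).run s) := by
  refine iter_rule hn (fun u => I (u * n)) (fun k s' x => hI _ s' x) (by simpa using h0) ?_
  intro u s' hu hru hf h
  have hn' : s'.reg 0 = n := by
    rw [hf.1 0 (by simp [regs, hr0.symm, hr0'.symm, h0p]), hn]
  have := iter_rule (r := r') (p := p) hn' (fun v => I (u * n + v)) (fun k s' x => hI' _ s' x) h
    fun v s'' hv hrv hf' h' => hs u v s'' hu hv (by
      rw [hf'.1 r (by simp [regs, hrr, hrp]), hru]) hrv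
      (hf.trans hf' subset_rfl (by simp [regs]) subset_rfl (by simp [arrs])) h'
  rwa [Nat.succ_mul]

/-- `fill a e r r'` sets the matrix in array `a` to the values of `e`, which may depend on the row
`reg r` and the column `reg r'`. -/
def fill (a : ℕ) (e : Expr) (r r' : ℕ) : Cmd := iter r (iter r' (store a (.idx r r') e))

theorem fill_run {a : ℕ} {e : Expr} {r r' n : ℕ} {s : State} (hs : Rows n s) (ha : a ≠ 3)
    (hrr : r ≠ r') (hr0 : r ≠ 0) (hr0' : r' ≠ 0) (f : ℕ → ℕ → ℕ)
    (he : ∀ u v s', u < n → v < n → s'.reg r = u → s'.reg r' = v → Rows n s' →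
      (fill a e r r').Frame s s' → e.eval s' = f u v) :
    ∀ u < n, ∀ v < n, ((fill a e r r').run s).arr a (u * n + v) = f u v := by
  have := iter_iter_rule (r := r) (r' := r') (p := store a (.idx r r') e) hs.1 hrr (by simp [regs])
    (by simp [regs]) hr0 hr0'
    (fun k s' => ∀ u < n, ∀ v < n, u * n + v < k → s'.arr a (u * n + v) = f u v)
    (fun k s' x h => h) (fun k s' x h => h) (by simp) (by
      intro u v s' hu hv hru hrv hf h u' hu' v' hv' hlt
      have hrows : Rows n s' := hf.rows hs (by simp [regs, hr0.symm, hr0'.symm])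
        (by simp [arrs, ha.symm])
      rw [run, hrows.eval_idx (hru ▸ hu), hru, hrv, State.setArr_arr, if_pos rfl]
      by_cases heq : u' * n + v' = u * n + v
      · rw [heq, Function.update_self, he u v s' hu hv hru hrv hrows hf,
          ((idx_inj hv' hv).1 heq).1, ((idx_inj hv' hv).1 heq).2]
      · rw [Function.update_of_ne heq]
        exact h u' hu' v' hv' (by omega))
  intro u hu v hv
  exact this u hu v hv (idx_lt hu hv)

/-- `copy a b r r'` copies the matrix in array `b` to array `a`. -/
def copy (a b r r' : ℕ) : Cmd := fill a (.arr b (.idx r r')) r r'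

theorem copy_run {a b r r' n : ℕ} {s : State} (hs : Rows n s) (ha : a ≠ 3) (hab : b ≠ a)
    (hrr : r ≠ r') (hr0 : r ≠ 0) (hr0' : r' ≠ 0) :
    ∀ u < n, ∀ v < n, ((copy a b r r').run s).arr a (u * n + v) = s.arr b (u * n + v) := by
  refine fill_run hs ha hrr hr0 hr0' (fun u v => s.arr b (u * n + v)) ?_
  intro u v s' hu hv hru hrv hrows hf
  rw [Expr.eval, hrows.eval_idx (hru ▸ hu), hru, hrv, hf.2 b (by simp [fill, arrs, hab])]

theorem markedPairs_copy_run {a b r r' n : ℕ} {s : State} (hs : Rows n s) (ha : a ≠ 3)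
    (hab : b ≠ a) (hrr : r ≠ r') (hr0 : r ≠ 0) (hr0' : r' ≠ 0) :
    markedPairs n (((copy a b r r').run s).arr a) = markedPairs n (s.arr b) :=
  markedPairs_congr (copy_run hs ha hab hrr hr0 hr0')

theorem marked_copy_run {a b r r' n : ℕ} {s : State} (hs : Rows n s) (ha : a ≠ 3)
    (hab : b ≠ a) (hrr : r ≠ r') (hr0 : r ≠ 0) (hr0' : r' ≠ 0) :
    marked n (((copy a b r r').run s).arr a) = marked n (s.arr b) :=
  marked_congr fun i hi => by simpa using copy_run hs ha hab hrr hr0 hr0' 0 (by omega) i hi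

/-- `search r f e` sets register `f` to `0` if no value of `r` below `n` satisfies `e`, and to the
successor of such a value otherwise. -/
def search (r f : ℕ) (e : Expr) : Cmd :=
  assign f (.const 0) ;; iter r (cond e (assign f (.add (.reg r) (.const 1))) skip)

theorem search_run {r f : ℕ} {e : Expr} {n : ℕ} {s : State} (hn : s.reg 0 = n) (hf0 : f ≠ 0)
    (hrf : r ≠ f) (P : ℕ → Prop)
    (he : ∀ w s', w < n → s'.reg r = w → (search r f e).Frame s s' → (e.eval s' ≠ 0 ↔ P w)) :
    (((search r f e).run s).reg f = 0 ∧ ∀ w < n, ¬ P w) ∨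
      ∃ w < n, ((search r f e).run s).reg f = w + 1 ∧ P w := by
  have := iter_rule (r := r) (p := cond e (assign f (.add (.reg r) (.const 1))) skip)
    (s := s.setReg f 0) (n := n) (by simpa [hf0.symm] using hn)
    (fun k s' => (s'.reg f = 0 ∧ ∀ w < k, ¬ P w) ∨ ∃ w < n, s'.reg f = w + 1 ∧ P w)
    (fun k s' x h => by simpa [hrf.symm] using h) (by simp) (by
      intro w s' hw hr hf h
      have he' := he w s' hw hr ⟨fun x hx => by
        rw [hf.1 x (by simpa [search, regs] using hx), State.setReg_reg, if_neg]
        rintro rfl; simp [search, regs] at hx, fun a ha => hf.2 a (by simp [arrs])⟩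
      simp only [run]
      split_ifs with h0
      · right
        exact ⟨w, hw, by simp [Expr.eval, hr], he'.1 h0⟩
      · rcases h with ⟨h1, h2⟩ | h
        · left
          refine ⟨h1, fun w' hw' => ?_⟩
          rcases Nat.lt_succ_iff_lt_or_eq.1 hw' with h | rfl
          · exact h2 _ h
          · exact fun hP => h0 (he'.2 hP)
        · exact .inr h)
  exact this

end Cmd

end RAM

/-! ### All-pairs distances by breadth-first search -/

namespace SCSS

/-- The state of a breadth-first search from every vertex after `j` rounds. -/
structure DistInv (G : ℕ → ℕ → Prop) (n j : ℕ) (D : ℕ → ℕ → ℕ) : Prop where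
  le : ∀ u < n, ∀ v < n, D u v ≤ j ∨ D u v = n
  self : ∀ v < n, D v v = 0
  head : ∀ u v w, G u w → v < n → D w v < j → D u v ≤ D w v + 1
  step : ∀ u < n, ∀ v < n, D u v < n → D u v ≠ 0 → ∃ w, G u w ∧ D w v + 1 = D u v
  eq_of_zero : ∀ u < n, ∀ v < n, D u v = 0 → u = v

/-- One round of the breadth-first search. -/
def RoundAt (G : ℕ → ℕ → Prop) (n j : ℕ) (D D' : ℕ → ℕ → ℕ) (u v : ℕ) : Prop :=
  (D u v = n ∧ (∃ w < n, G u w ∧ D w v = j) ∧ D' u v = j + 1) ∨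
    (¬ (D u v = n ∧ ∃ w < n, G u w ∧ D w v = j) ∧ D' u v = D u v)

/-- A round changes only entries equal to n, and turns them into j + 1. Values below n are therefore
final, and the entries that become finite are those with an out-neighbour at value exactly j. -/
theorem DistInv.succ {G : ℕ → ℕ → Prop} {n j : ℕ} {D D' : ℕ → ℕ → ℕ} (h : DistInv G n j D)
    (hG : ∀ u v, G u v → u < n ∧ v < n) (hj : j < n)
    (hD : ∀ u < n, ∀ v < n, RoundAt G n j D D' u v) : DistInv G n (j + 1) D' where
  le u hu v hv := by
    rcases hD u hu v hv with ⟨h1, h2, h3⟩ | ⟨h1, h2⟩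
    · omega
    · have := h.le u hu v hv; omega
  self v hv := by
    have := h.self v hv
    rcases hD v hv v hv with ⟨h1, h2, h3⟩ | ⟨h1, h2⟩ <;> omega
  head u v w huw hv hlt := by
    obtain ⟨hu, hw⟩ := hG _ _ huw
    have hwv : D' w v = D w v := by
      rcases hD w hw v hv with ⟨h1, h2, h3⟩ | ⟨h1, h2⟩ <;> omega
    rcases Nat.lt_or_ge (D w v) j with hlt' | hge
    · have h4 := h.head u v w huw hv hlt'
      rcases hD u hu v hv with ⟨h1, h2, h3⟩ | ⟨h1, h2⟩ <;> omega
    · rcases hD u hu v hv with ⟨h1, h2, h3⟩ | ⟨h1, h2⟩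
      · omega
      · have h3 : D u v ≠ n := fun h3 => h1 ⟨h3, w, hw, huw, by omega⟩
        have := h.le u hu v hv
        omega
  step u hu v hv hlt hne := by
    have key : ∀ w < n, D w v ≠ n → D' w v = D w v := by
      intro w hw hwn
      rcases hD w hw v hv with ⟨h1, h2, h3⟩ | ⟨h1, h2⟩ <;> omega
    rcases hD u hu v hv with ⟨h1, ⟨w, hw, huw, hwv⟩, h3⟩ | ⟨h1, h2⟩
    · exact ⟨w, huw, by rw [key w hw (by omega)]; omega⟩
    · obtain ⟨w, huw, hwv⟩ := h.step u hu v hv (by omega) (by omega)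
      exact ⟨w, huw, by rw [key w (hG _ _ huw).2 (by omega)]; omega⟩
  eq_of_zero u hu v hv h0 := by
    rcases hD u hu v hv with ⟨h1, h2, h3⟩ | ⟨h1, h2⟩
    · omega
    · exact h.eq_of_zero u hu v hv (by omega)

theorem DistInv.isDist {G : ℕ → ℕ → Prop} {n : ℕ} {D : ℕ → ℕ → ℕ} (h : DistInv G n n D)
    (hG : ∀ u v, G u v → u < n ∧ v < n) : IsDist G n D :=
  IsLocalDist.isDist ⟨hG, fun u hu v hv => by have := h.le u hu v hv; omega, h.self, h.head, h.step,
    h.eq_of_zero⟩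

end SCSS

namespace RAM

open SCSS

/-- The digraph whose adjacency matrix is stored in the array `A`. -/
def graph (n : ℕ) (A : ℕ → ℕ) (u v : ℕ) : Prop := (u, v) ∈ markedPairs n A

/-- The matrix stored in the array `A`. -/
def mat (n : ℕ) (A : ℕ → ℕ) (u v : ℕ) : ℕ := A (u * n + v)

theorem graph_bound {n : ℕ} {A : ℕ → ℕ} (u v : ℕ) (h : graph n A u v) : u < n ∧ v < n :=
  (mem_markedPairs.1 h).1

namespace Cmd

/-- The update of the distance from `reg 1` to `reg 2` in round `reg 5`. -/
def distCell : Cmd :=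
  cond (.eq (.arr 5 (.idx 1 2)) (.reg 0))
    (search 3 4 (.and (.arr 4 (.idx 1 3)) (.eq (.arr 5 (.idx 3 2)) (.reg 5))) ;;
      cond (.reg 4) (store 5 (.idx 1 2) (.add (.reg 5) (.const 1))) skip) skip

/-- Compute the distances in the digraph in array `4` into array `5`. -/
def dist : Cmd :=
  fill 5 (.reg 0) 1 2 ;; iter 1 (store 5 (.idx 1 1) (.const 0)) ;;
    iter 5 (iter 1 (iter 2 distCell))

theorem distCell_run {n u v j : ℕ} {s : State} (hs : Rows n s) (hu : u < n)
    (h1 : s.reg 1 = u) (h2 : s.reg 2 = v) (h5 : s.reg 5 = j) :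
    (∀ i, i ≠ u * n + v → (distCell.run s).arr 5 i = s.arr 5 i) ∧
    RoundAt (graph n (s.arr 4)) n j (mat n (s.arr 5)) (mat n ((distCell.run s).arr 5)) u v := by
  have hidx : (Expr.idx 1 2).eval s = u * n + v := by rw [hs.eval_idx (h1 ▸ hu), h1, h2]
  have hc : (Expr.eq (.arr 5 (.idx 1 2)) (.reg 0)).eval s ≠ 0 ↔ mat n (s.arr 5) u v = n := by
    rw [Expr.eval_eq, Expr.eval, Expr.eval, hidx, hs.1]; rfl
  rw [distCell, run]
  split_ifs with h0
  · rw [hc] at h0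
    have hsearch := search_run (r := 3) (f := 4)
      (e := .and (.arr 4 (.idx 1 3)) (.eq (.arr 5 (.idx 3 2)) (.reg 5))) hs.1 (by simp) (by simp)
      (fun w => graph n (s.arr 4) u w ∧ mat n (s.arr 5) w v = j) (by
        intro w s' hw h3 hf
        have hs' := hf.rows hs (by simp [search, regs]) (by simp [search, arrs])
        have h1' := hf.1 1 (by simp [search, regs])
        have h2' := hf.1 2 (by simp [search, regs])
        have h5' := hf.1 5 (by simp [search, regs])
        have h4a := hf.2 4 (by simp [search, arrs])
        have h5a := hf.2 5 (by simp [search, arrs])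
        rw [Expr.eval_and, Expr.eval_eq, Expr.eval, Expr.eval, Expr.eval, hs'.eval_idx (by omega),
          hs'.eval_idx (by omega), h1', h1, h2', h2, h3, h5', h5, h4a, h5a]
        simp [graph, hu, hw, mat])
    set s' := (search 3 4 (.and (.arr 4 (.idx 1 3)) (.eq (.arr 5 (.idx 3 2)) (.reg 5)))).run s
      with hs'
    have hf : (search 3 4 (.and (.arr 4 (.idx 1 3)) (.eq (.arr 5 (.idx 3 2)) (.reg 5)))).Frame s s' :=
      frame_run _ _
    have hrows := hf.rows hs (by simp [search, regs]) (by simp [search, arrs])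
    have h1' := hf.1 1 (by simp [search, regs])
    have h2' := hf.1 2 (by simp [search, regs])
    have h5' := hf.1 5 (by simp [search, regs])
    have h5a := hf.2 5 (by simp [search, arrs])
    rw [run_seq, ← hs', run]
    rcases hsearch with ⟨hz, hno⟩ | ⟨w, hw, hz, hG, hD⟩
    · rw [if_neg (by simpa [Expr.eval] using hz), run, h5a]
      refine ⟨fun _ _ => rfl, .inr ⟨?_, rfl⟩⟩
      rintro ⟨-, w, hw, h⟩
      exact hno w hw h
    · rw [if_pos (by simp [Expr.eval, hz]), run, hrows.eval_idx (by omega), h1', h1, h2', h2,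
        State.setArr_arr, if_pos rfl, h5a]
      refine ⟨fun i hi => Function.update_of_ne hi _ _, .inl ⟨h0, ⟨w, hw, hG, hD⟩, ?_⟩⟩
      simp [mat, Expr.eval, h5', h5]
  · rw [hc] at h0
    exact ⟨fun _ _ => rfl, .inr ⟨fun h => h0 h.1, rfl⟩⟩

theorem distCell_regs : distCell.regs = {3, 4} := by decide
theorem distCell_arrs : distCell.arrs = {5} := by decide

theorem dist_run {n : ℕ} {s : State} (hs : Rows n s) :
    IsDist (graph n (s.arr 4)) n (mat n ((dist.run s).arr 5)) := by
  set G := graph n (s.arr 4) with hGdef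
  have hfill := fill_run (a := 5) (e := .reg 0) (r := 1) (r' := 2) hs (by simp) (by simp) (by simp)
    (by simp) (fun _ _ => n) (by
      intro u v s' _ _ _ _ h _
      exact h.1)
  rw [dist, run_seq, run_seq]
  set s₁ := (fill 5 (.reg 0) 1 2).run s with hs₁
  have hf₁ : (fill 5 (.reg 0) 1 2).Frame s s₁ := frame_run _ _
  have hrows₁ := hf₁.rows hs (by simp [fill, regs]) (by simp [fill, arrs])
  have h4₁ := hf₁.2 4 (by simp [fill, arrs])
  have hdiag := iter_rule (r := 1) (p := store 5 (.idx 1 1) (.const 0)) hrows₁.1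
    (fun k s' => ∀ u < n, ∀ v < n,
      s'.arr 5 (u * n + v) = if u = v ∧ u < k then 0 else n) (fun k s' x h => h)
    (fun u hu v hv => by simpa using hfill u hu v hv) (by
      intro j s' hj hr hf h u hu v hv
      have hrows := hf.rows hrows₁ (by simp [regs]) (by simp [arrs])
      rw [run, hrows.eval_idx (by omega), hr, State.setArr_arr, if_pos rfl,
        Function.update_apply]
      have := idx_inj (u := u) (u' := j) hv hj
      split_ifs with h1 h2 h2
      · rfl
      · omega
      · rw [h u hu v hv, if_pos ⟨h2.1, by
          rcases Nat.lt_succ_iff_lt_or_eq.1 h2.2 with h3 | h3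
          · exact h3
          · exact absurd (this.2 ⟨h3, by omega⟩) h1⟩]
      · rw [h u hu v hv, if_neg (by omega)])
  set s₂ := (iter 1 (store 5 (.idx 1 1) (.const 0))).run s₁ with hs₂
  have hf₂ : (iter 1 (store 5 (.idx 1 1) (.const 0))).Frame s₁ s₂ := frame_run _ _
  have hrows₂ := hf₂.rows hrows₁ (by simp [regs]) (by simp [arrs])
  have h4₂ : s₂.arr 4 = s.arr 4 := (hf₂.2 4 (by simp [arrs])).trans h4₁
  have hD₂ : ∀ u < n, ∀ v < n, mat n (s₂.arr 5) u v = if u = v then 0 else n := by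
    intro u hu v hv
    rw [mat, hdiag u hu v hv]
    simp [hu]
  refine DistInv.isDist ?_ graph_bound
  refine iter_rule (r := 5) hrows₂.1 (fun j s' => DistInv G n j (mat n (s'.arr 5)))
    (fun k s' x h => h) ?_ ?_
  · constructor
    · intro u hu v hv; rw [hD₂ u hu v hv]; split_ifs <;> simp
    · intro v hv; rw [hD₂ v hv v hv]; simp
    · intro u v w _ _ h; omega
    · intro u hu v hv h h'; rw [hD₂ u hu v hv] at h h'; split_ifs at h h' <;> omega
    · intro u hu v hv h; rw [hD₂ u hu v hv] at h; split_ifs at h <;> omega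
  · intro j s₃ hj hr hf₃ h
    have hrows₃ := hf₃.rows hrows₂ (by simp [regs, distCell_regs]) (by simp [arrs, distCell_arrs])
    have h4₃ := (hf₃.2 4 (by simp [arrs, distCell_arrs])).trans h4₂
    -- The matrix is overwritten in place: entries before k belong to the new round, the others to
    -- the old one. This is harmless because a round replaces n by j + 1, both different from j, so
    -- the test for the value j has the same result before and after (`hcur`).
    have key := iter_iter_rule (r := 1) (r' := 2) (p := distCell) hrows₃.1 (by simp)
      (by simp [distCell_regs]) (by simp [distCell_regs]) (by simp) (by simp)
      (fun k s' => ∀ u < n, ∀ v < n,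
        (u * n + v < k → RoundAt G n j (mat n (s₃.arr 5)) (mat n (s'.arr 5)) u v) ∧
        (k ≤ u * n + v → mat n (s'.arr 5) u v = mat n (s₃.arr 5) u v))
      (fun _ _ _ h => h) (fun _ _ _ h => h) (fun u _ v _ => ⟨by simp, fun _ => rfl⟩) (by
        intro u v s' hu hv hru hrv hf hI
        have hrows := hf.rows hrows₃ (by simp [regs, distCell_regs]) (by simp [arrs, distCell_arrs])
        have h4 := (hf.2 4 (by simp [arrs, distCell_arrs])).trans h4₃
        have h5 := (hf.1 5 (by simp [regs, distCell_regs])).trans hr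
        obtain ⟨hother, hround⟩ := distCell_run hrows hu hru hrv h5
        rw [h4] at hround
        have hcur : ∀ w < n, mat n (s'.arr 5) w v = j ↔ mat n (s₃.arr 5) w v = j := by
          intro w hw
          rcases Nat.lt_or_ge (w * n + v) (u * n + v) with hlt | hge
          · rcases (hI w hw v hv).1 hlt with ⟨h1, h2, h3⟩ | ⟨h1, h2⟩ <;> omega
          · rw [(hI w hw v hv).2 hge]
        have huv := (hI u hu v hv).2 le_rfl
        intro u' hu' v' hv'
        refine ⟨fun hlt => ?_, fun hge => ?_⟩
        · by_cases heq : u' * n + v' = u * n + v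
          · obtain ⟨rfl, rfl⟩ := (idx_inj hv' hv).1 heq
            have hex : (∃ w < n, graph n (s.arr 4) u' w ∧ mat n (s'.arr 5) w v' = j) ↔
                ∃ w < n, G u' w ∧ mat n (s₃.arr 5) w v' = j :=
              exists_congr fun w => and_congr_right fun hw => by rw [hcur w hw]
            rw [RoundAt, hex, huv] at hround
            exact hround
          · have hsame : mat n ((distCell.run s').arr 5) u' v' = mat n (s'.arr 5) u' v' :=
              hother _ heq
            rw [RoundAt, hsame]
            exact (hI u' hu' v' hv').1 (by omega)
        · rw [mat, hother _ (by omega)]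
          exact (hI u' hu' v' hv').2 (by omega))
    exact h.succ graph_bound hj fun u hu v hv => (key u hu v hv).1 (idx_lt hu hv)

theorem dist_regs : dist.regs = {1, 2, 3, 4, 5} := by decide
theorem dist_arrs : dist.arrs = {5} := by decide
theorem dist_wf : dist.WF := by
  simp [dist, WF, fill, distCell, search, regs]

end Cmd

end RAM

/-! ### The programs of the recursive greedy algorithm and its lowest level -/

namespace RAM

open SCSS

namespace Cmd

/-- `mul d a b j` sets register `d` to the product of the registers `a` and `b`. -/
def mul (d a b j : ℕ) : Cmd :=
  assign d (.const 0) ;; iter j (cond (.sub (.reg b) (.reg j)) (assign d (.add (.reg d) (.reg a))) skip)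

/-- Multiplication is repeated addition in a loop of n rounds, of which only the first `reg b` add
anything. Hence the requirement `s.reg b ≤ n`; the other factor may be arbitrarily large. -/
theorem mul_run {d a b j n : ℕ} {s : State} (hn : s.reg 0 = n) (hb : s.reg b ≤ n) (hd0 : d ≠ 0)
    (hda : d ≠ a) (hdb : d ≠ b) (hdj : d ≠ j) (hja : j ≠ a) (hjb : j ≠ b) :
    ((mul d a b j).run s).reg d = s.reg a * s.reg b := by
  have := iter_rule (r := j) (p := cond (.sub (.reg b) (.reg j))
      (assign d (.add (.reg d) (.reg a))) skip) (s := s.setReg d 0) (n := n)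
    (by simpa [hd0.symm] using hn) (fun k s' => s'.reg d = s.reg a * min k (s.reg b))
    (fun k s' x h => by simpa [hdj] using h) (by simp) (by
      intro k s' hk hr hf h
      have ha' : s'.reg a = s.reg a := by
        rw [hf.1 a (by simp [regs, hja.symm, hda.symm]), State.setReg_reg, if_neg hda.symm]
      have hb' : s'.reg b = s.reg b := by
        rw [hf.1 b (by simp [regs, hjb.symm, hdb.symm]), State.setReg_reg, if_neg hdb.symm]
      simp only [run]
      split_ifs with h0
      · simp only [Expr.eval, hr, hb'] at h0
        simp only [State.setReg_reg, if_true, Expr.eval, h, ha']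
        rw [show min (k + 1) (s.reg b) = min k (s.reg b) + 1 by omega, Nat.mul_succ]
      · simp only [Expr.eval, hr, hb'] at h0
        rw [h, show min (k + 1) (s.reg b) = min k (s.reg b) by omega])
  rw [mul, run_seq]
  rwa [min_eq_right hb] at this

/-- Cover the vertex of the array `b + 40` that is nearest to `reg (b + 40)`. -/
def nearest (b : ℕ) : Cmd :=
  assign (b + 41) (.reg 0) ;;
  iter (b + 43) (cond (.arr (b + 40) (.reg (b + 43)))
    (cond (.sub (.reg (b + 41)) (.arr 5 (.idx (b + 40) (b + 43))))
      (assign (b + 41) (.arr 5 (.idx (b + 40) (b + 43))) ;; assign (b + 44) (.reg (b + 43)))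
      skip) skip) ;;
  cond (.sub (.reg 0) (.reg (b + 41)))
    (store (b + 40) (.reg (b + 44)) (.const 0) ;;
      store (b + 41) (.idx (b + 40) (b + 44)) (.const 1) ;; assign (b + 42) (.const 1))
    (assign (b + 41) (.const 0) ;; assign (b + 42) (.const 0))

/-- One round of the greedy covering from `reg (b + 43)` by the command `p`. -/
def greedyRound (b : ℕ) (p : Cmd) : Cmd :=
  p ;; assign (b + 44) (.add (.reg (b + 44)) (.reg (b + 61))) ;;
  assign (b + 45) (.add (.reg (b + 45)) (.reg (b + 62))) ;;
  mul (b + 46) (b + 44) (b + 42) (b + 48) ;; mul (b + 47) (b + 41) (b + 45) (b + 48) ;;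
  cond (.sub (.reg (b + 47)) (.reg (b + 46)))
    (copy (b + 42) (b + 60) (b + 48) (b + 49) ;; copy (b + 43) (b + 61) (b + 48) (b + 49) ;;
      assign (b + 41) (.reg (b + 44)) ;; assign (b + 42) (.reg (b + 45))) skip

/-- The greedy covering from `reg (b + 43)`, starting with the pair of `reg (b + 40)` and
`reg (b + 43)`. -/
def greedyFrom (b : ℕ) (p : Cmd) : Cmd :=
  copy (b + 60) (b + 40) (b + 48) (b + 49) ;; copy (b + 61) (b + 41) (b + 48) (b + 49) ;;
  store (b + 61) (.idx (b + 40) (b + 43)) (.const 1) ;; assign (b + 60) (.reg (b + 43)) ;;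
  assign (b + 44) (.arr 5 (.idx (b + 40) (b + 43))) ;; assign (b + 45) (.const 0) ;;
  iter (b + 50) (greedyRound b p)

/-- Find a covering with small density from `reg (b + 40)`, where the command `p` finds one with
one level of recursion less. -/
def level (b : ℕ) (p : Cmd) : Cmd :=
  copy (b + 42) (b + 40) (b + 48) (b + 49) ;; copy (b + 43) (b + 41) (b + 48) (b + 49) ;;
  assign (b + 41) (.const 1) ;; assign (b + 42) (.const 0) ;;
  iter (b + 43) (cond (.sub (.reg 0) (.arr 5 (.idx (b + 40) (b + 43)))) (greedyFrom b p) skip) ;;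
  copy (b + 40) (b + 42) (b + 48) (b + 49) ;; copy (b + 41) (b + 43) (b + 48) (b + 49) ;;
  assign (b + 41) (.sub (.reg (b + 41)) (.sub (.const 1) (.reg (b + 42))))

/-- The recursive greedy algorithm with `i + 1` levels. -/
def block : ℕ → ℕ → Cmd
  | 0, b => nearest b
  | i + 1, b => level b (block i (b + 20))

/-- The effect of a covering command: `reg (b + 40)` is the root, array `b + 40` the set of vertices
not covered yet, array `b + 41` the set of chosen pairs, `reg (b + 41)` the cost and `reg (b + 42)`
the number of covered vertices. -/
structure Covers (G : ℕ → ℕ → Prop) (n : ℕ) (D : ℕ → ℕ → ℕ) (C e b : ℕ) (s s' : State) : Prop where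
  sound : Sound n D (s.reg (b + 40)) (marked n (s.arr (b + 40))) (markedPairs n (s.arr (b + 41)))
    (marked n (s'.arr (b + 40))) (markedPairs n (s'.arr (b + 41))) (s'.reg (b + 41))
    (s'.reg (b + 42))
  zero : s'.reg (b + 42) = 0 → s'.reg (b + 41) = 0
  quality : Quality G C e (s.reg (b + 40)) (marked n (s.arr (b + 40))) (s'.reg (b + 41))
    (s'.reg (b + 42))

/-- `p` is a covering command with base `b`. -/
structure IsCovering (C e b : ℕ) (p : Cmd) : Prop where
  wf : p.WF
  regs_lt : ∀ x ∈ p.regs, b + 40 < x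
  arrs_le : ∀ a ∈ p.arrs, b + 40 ≤ a
  covers : ∀ G n s, IsDist G n (mat n (s.arr 5)) → Rows n s → s.reg (b + 40) < n →
    Covers G n (mat n (s.arr 5)) C e b s (p.run s)

theorem nearest_isCovering (b : ℕ) : IsCovering 1 1 b (nearest b) where
  wf := by simp [nearest, WF, regs]
  regs_lt x hx := by
    simp [nearest, regs] at hx
    omega
  arrs_le x hx := by
    simp [nearest, arrs] at hx
    omega
  covers G n s hD hs hv := by
    set D := mat n (s.arr 5) with hDdef
    set v := s.reg (b + 40) with hvdef
    set X := s.arr (b + 40) with hX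
    have hloop := iter_rule (r := b + 43) (p := cond (.arr (b + 40) (.reg (b + 43)))
      (cond (.sub (.reg (b + 41)) (.arr 5 (.idx (b + 40) (b + 43))))
      (assign (b + 41) (.arr 5 (.idx (b + 40) (b + 43))) ;; assign (b + 44) (.reg (b + 43)))
      skip) skip) (s := s.setReg (b + 41) n) (n := n) (by simpa using hs.1)
      -- The value n means that no reachable vertex of X has been seen. Otherwise register `b + 44`
      -- names a vertex of X that attains the minimum.
      (fun k s' => (s'.reg (b + 41) = n ∨ (s'.reg (b + 41) < n ∧ s'.reg (b + 44) < n ∧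
          X (s'.reg (b + 44)) ≠ 0 ∧ D v (s'.reg (b + 44)) = s'.reg (b + 41))) ∧
        ∀ w < k, X w ≠ 0 → s'.reg (b + 41) ≤ D v w)
      (fun k s' x h => by simpa using h) (by simp) (by
        intro w s' hw hr hf h
        have hrows := hf.rows (hs.congr (s' := s.setReg (b + 41) n) (by simp) (by simp))
          (by simp [regs]) (by simp [arrs])
        have hv' : s'.reg (b + 40) = v := by rw [hf.1 _ (by simp [regs])]; simp [hvdef]
        have h5' : s'.arr 5 = s.arr 5 := hf.2 5 (by simp [arrs])
        have hX' : s'.arr (b + 40) = X := hf.2 (b + 40) (by simp [arrs])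
        have hidx : (Expr.idx (b + 40) (b + 43)).eval s' = v * n + w := by
          rw [hrows.eval_idx (by omega), hv', hr]
        have hDv : s.arr 5 (v * n + w) = D v w := rfl
        have hsplit : ∀ P : ℕ → Prop, (∀ w' < w, X w' ≠ 0 → P w') → (X w ≠ 0 → P w) →
            ∀ w' < w + 1, X w' ≠ 0 → P w' := by
          intro P h1 h2 w' hw'
          rcases Nat.lt_succ_iff_lt_or_eq.1 hw' with h | rfl
          · exact h1 w' h
          · exact h2
        have hc1 : (Expr.arr (b + 40) (.reg (b + 43))).eval s' = X w := by
          simp only [Expr.eval, hX', hr]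
        have hc2 : (Expr.sub (.reg (b + 41)) (.arr 5 (.idx (b + 40) (b + 43)))).eval s' =
            s'.reg (b + 41) - D v w := by
          simp only [Expr.eval, hidx, h5', hDv]
        simp only [run, hc1, hc2]
        split_ifs with h0 h1
        · simp only [State.setReg_reg, Expr.eval, hidx, h5', hDv, hr]
          simp only [Nat.add_left_cancel_iff, Nat.reduceEqDiff, if_true,
            if_false]
          refine ⟨.inr ⟨by omega, hw, h0, trivial⟩, hsplit _ (fun w' hw' hx => ?_) (fun _ => le_rfl)⟩
          have := h.2 w' hw' hx
          omega
        · exact ⟨h.1, hsplit _ h.2 (fun _ => by omega)⟩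
        · exact ⟨h.1, hsplit _ h.2 (fun hx => absurd hx h0)⟩)
    have hstart : (assign (b + 41) (.reg 0)).run s = s.setReg (b + 41) n := by
      simp [run, Expr.eval, hs.1]
    rw [nearest, run_seq, run_seq, hstart]
    set s₁ := (iter (b + 43) _).run (s.setReg (b + 41) n) with hs₁
    have hf : Frame _ (s.setReg (b + 41) n) s₁ := frame_run _ _
    have hrows := hf.rows (hs.congr (s' := s.setReg (b + 41) n) (by simp) (by simp))
          (by simp [regs]) (by simp [arrs])
    have hv' : s₁.reg (b + 40) = v := by rw [hf.1 _ (by simp [regs])]; simp [hvdef]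
    have hX' : s₁.arr (b + 40) = X := hf.2 (b + 40) (by simp [arrs])
    have hM' : s₁.arr (b + 41) = s.arr (b + 41) := hf.2 (b + 41) (by simp [arrs])
    obtain ⟨hcase, hmin⟩ := hloop
    by_cases hlt : s₁.reg (b + 41) < n
    · obtain ⟨-, ht, hXt, hDt⟩ := hcase.resolve_left hlt.ne
      have hc : (Expr.sub (.reg 0) (.reg (b + 41))).eval s₁ ≠ 0 := by
        simp only [Expr.eval, hrows.1]; omega
      set t := s₁.reg (b + 44) with htdef
      have hrows₂ : Rows n (s₁.setArr (b + 40) t 0) := hrows.congr rfl (by simp)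
      have hidx : (Expr.idx (b + 40) (b + 44)).eval (s₁.setArr (b + 40) t 0) = v * n + t := by
        rw [hrows₂.eval_idx (by simpa [hv'] using hv)]; simp [hv', htdef]
      simp only [run, hc, ne_eq, not_false_eq_true, if_true]
      simp only [Expr.eval.eq_2, Expr.eval.eq_1, ← htdef, hidx]
      have hXm : marked n (Function.update X t 0) = (marked n X).erase t := marked_update_zero t
      have hMm : markedPairs n (Function.update (s.arr (b + 41)) (v * n + t) 1) =
          insert (v, t) (markedPairs n (s.arr (b + 41))) := markedPairs_update hv ht (by simp)
      have htX : t ∈ marked n X := mem_marked.2 ⟨ht, hXt⟩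
      constructor
      · simp only [State.setReg_arr, State.setArr_arr, State.setReg_reg, State.setArr_reg,
          Nat.add_left_cancel_iff, Nat.reduceEqDiff, if_true, if_false, hX', hM', hXm, hMm]
        have := Sound.of_insert (v := v) (u := t) (n := n) (D := D) (X := marked n X)
          (M := markedPairs n (s.arr (b + 41))) (X' := (marked n X).erase t) (c := 0) (k := 1)
          ⟨Finset.erase_subset _ _, by
              have := Finset.card_pos.2 ⟨t, htX⟩
              rw [Finset.card_erase_of_mem htX]
              omega, subset_rfl, fun _ h h' => absurd h h', le_rfl,
            fun x hx hx' => by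
              have : x = t := by
                by_contra hne; exact hx' (Finset.mem_erase.2 ⟨hne, hx⟩)
              subst this; exact .refl⟩ (by omega)
        rwa [Nat.add_zero, hDt] at this
      · simp
      · simp only [State.setReg_reg, State.setArr_reg,
          Nat.add_left_cancel_iff, Nat.reduceEqDiff, if_true, if_false]
        refine Quality.of_nearest hD marked_subset_range fun w hw _ => ⟨by simp, ?_⟩
        exact hmin w (mem_marked.1 hw).1 (mem_marked.1 hw).2
    · have hc : (Expr.sub (.reg 0) (.reg (b + 41))).eval s₁ = 0 := by
        simp only [Expr.eval, hrows.1]; omega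
      have hn : s₁.reg (b + 41) = n := hcase.resolve_right (fun h => hlt h.1)
      simp only [run, hc, ne_eq, not_true_eq_false, if_false, Expr.eval.eq_1]
      constructor
      · simp only [State.setReg_arr, State.setReg_reg, Nat.add_left_cancel_iff, Nat.reduceEqDiff,
          if_true, if_false, hX', hM']
        exact Sound.refl _ _ _ _ _
      · simp
      · refine Quality.of_nearest hD marked_subset_range fun w hw hlt' => ?_
        have : s₁.reg (b + 41) ≤ D (s.reg (b + 40)) w :=
          hmin w (mem_marked.1 hw).1 (mem_marked.1 hw).2
        omega

end Cmd

end RAM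

/-! ### Correctness of one greedy round -/

namespace RAM

open SCSS

namespace Cmd

/-- The best covering that was found so far. -/
def Best (n : ℕ) (D : ℕ → ℕ → ℕ) (v : ℕ) (X : Finset ℕ) (M : Finset (ℕ × ℕ)) (b : ℕ) (s : State) :
    Prop :=
  Sound n D v X M (marked n (s.arr (b + 42))) (markedPairs n (s.arr (b + 43)))
    (s.reg (b + 41) - (1 - s.reg (b + 42))) (s.reg (b + 42)) ∧
    (s.reg (b + 42) = 0 → s.reg (b + 41) = 1)

/-- The invariant of the greedy covering from `u` after `j` rounds. -/
structure RoundInv (G : ℕ → ℕ → Prop) (n : ℕ) (D : ℕ → ℕ → ℕ) (C e v : ℕ) (X : Finset ℕ)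
    (M : Finset (ℕ × ℕ)) (U : Set ℕ) (u b j : ℕ) (s : State) : Prop where
  root : s.reg (b + 60) = u
  cur : ∃ A, s.reg (b + 44) = D v u + A ∧ Sound n D u X (insert (v, u) M)
    (marked n (s.arr (b + 60))) (markedPairs n (s.arr (b + 61))) A (s.reg (b + 45))
  best : Best n D v X M b s
  track : Track G (D v u) C e u X j (s.reg (b + 44)) (s.reg (b + 45)) (s.reg (b + 41))
    (s.reg (b + 42))
  seen : ∀ u' ∈ U, Seen G (D v u') C e u' X (s.reg (b + 41)) (s.reg (b + 42))

/-- Later rounds rely on the registers spared here: `b + 40` (root), `b + 43` (current u), `b + 50`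
(round counter) and `b + 60` (root of the recursive calls). -/
theorem greedyRound_regs {b : ℕ} {p : Cmd} (hp : ∀ x ∈ p.regs, b + 60 < x) :
    ∀ x ∈ (greedyRound b p).regs, (b + 41 ≤ x ∧ x ≤ b + 49 ∧ x ≠ b + 43) ∨ b + 60 < x := by
  intro x hx
  simp only [greedyRound, regs, Finset.mem_union] at hx
  rcases hx with h | hx
  · exact .inr (hp x h)
  · simp [regs, mul, copy, fill] at hx
    omega

theorem greedyRound_arrs {b : ℕ} {p : Cmd} (hp : ∀ x ∈ p.arrs, b + 60 ≤ x) :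
    ∀ x ∈ (greedyRound b p).arrs, x = b + 42 ∨ x = b + 43 ∨ b + 60 ≤ x := by
  intro x hx
  simp only [greedyRound, arrs, Finset.mem_union] at hx
  rcases hx with h | hx
  · exact .inr (.inr (hp x h))
  · simp [arrs, mul, copy, fill] at hx
    omega

/-- The candidate after a round consists of the pair (v, u) and all coverings from u so far
(`Sound.trans`, then `Sound.of_insert`). Replacing the record by a strictly better candidate
preserves `Seen` for the vertices already treated. -/
theorem greedyRound_run {G : ℕ → ℕ → Prop} {n C e b u v j : ℕ} {p : Cmd} {s : State} {D : ℕ → ℕ → ℕ}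
    {X : Finset ℕ} {M : Finset (ℕ × ℕ)} {U : Set ℕ} (hp : IsCovering C e (b + 20) p)
    (hs : Rows n s) (hD : mat n (s.arr 5) = D) (hdist : IsDist G n D) (hu : u < n)
    (hvu : D v u < n) (hX : X ⊆ Finset.range n) (h : RoundInv G n D C e v X M U u b j s) :
    RoundInv G n D C e v X M U u b (j + 1) ((greedyRound b p).run s) := by
  obtain ⟨A, hA, hcur⟩ := h.cur
  obtain ⟨hbest, hbest0⟩ := h.best
  obtain ⟨hsound, hzero, hqual⟩ := hp.covers G n s (by rwa [hD]) hs (by rw [h.root]; exact hu)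
  have hpr := hp.regs_lt
  have hpa := hp.arrs_le
  simp only [Nat.add_assoc, Nat.reduceAdd, hD, h.root] at hsound hzero hqual hpr hpa
  simp only [greedyRound, run_seq]
  obtain ⟨s₁, hs₁⟩ : ∃ s₁, s₁ = p.run s := ⟨_, rfl⟩
  rw [← hs₁] at hsound hzero hqual ⊢
  have r₁ : ∀ x, x ≤ b + 60 → s₁.reg x = s.reg x := fun x hx => by
    rw [hs₁]; exact p.run_reg s fun h => by have := hpr x h; omega
  have a₁ : ∀ x, x < b + 60 → s₁.arr x = s.arr x := fun x hx => by
    rw [hs₁]; exact p.run_arr s fun h => by have := hpa x h; omega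
  generalize hcost : s₁.reg (b + 61) = cost at hsound hzero hqual
  generalize hcov : s₁.reg (b + 62) = cov at hsound hzero hqual
  have htrans := hcur.trans hsound
  have hcand := htrans.of_insert hvu
  -- Both covered counts serve as multipliers in `mul`, so they must not exceed n; they count
  -- elements of X.
  have hkn : s.reg (b + 45) + cov ≤ n := by
    have h1 := hcand.card
    have h2 := Finset.card_le_card hX
    rw [Finset.card_range] at h2
    omega
  have hbkn : s.reg (b + 42) ≤ n := by
    have h1 := hbest.card
    have h2 := Finset.card_le_card hX
    rw [Finset.card_range] at h2
    omega
  have hrun₃ : (assign (b + 45) (.add (.reg (b + 45)) (.reg (b + 62)))).run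
      ((assign (b + 44) (.add (.reg (b + 44)) (.reg (b + 61)))).run s₁) =
      (s₁.setReg (b + 44) (s.reg (b + 44) + cost)).setReg (b + 45) (s.reg (b + 45) + cov) := by
    simp [run, Expr.eval, hcost, hcov, r₁]
  rw [hrun₃]
  obtain ⟨s₃, hs₃⟩ : ∃ s₃, s₃ = (s₁.setReg (b + 44) (s.reg (b + 44) + cost)).setReg (b + 45)
    (s.reg (b + 45) + cov) := ⟨_, rfl⟩
  rw [← hs₃]
  have r₃ : ∀ x, x ≤ b + 60 → s₃.reg x = if x = b + 45 then s.reg (b + 45) + cov else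
      if x = b + 44 then s.reg (b + 44) + cost else s.reg x := fun x hx => by
    rw [hs₃, State.setReg_reg, State.setReg_reg, r₁ x hx]
  have a₃ : s₃.arr = s₁.arr := by rw [hs₃]; rfl
  have hn₃ : s₃.reg 0 = n := by rw [r₃ 0 (by omega), if_neg (by omega), if_neg (by omega), hs.1]
  obtain ⟨s₄, hs₄⟩ : ∃ s₄, s₄ = (mul (b + 46) (b + 44) (b + 42) (b + 48)).run s₃ := ⟨_, rfl⟩
  have hmul₄ := mul_run (d := b + 46) (a := b + 44) (b := b + 42) (j := b + 48) (s := s₃) (n := n)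
    hn₃ (by simp [r₃, hbkn]) (by simp) (by simp) (by simp) (by simp) (by simp) (by simp)
  rw [← hs₄] at hmul₄ ⊢
  have f₄ : ∀ x, x ≠ b + 46 → x ≠ b + 48 → s₄.reg x = s₃.reg x := fun x h h' => by
    rw [hs₄]; exact run_reg _ _ (by simp [mul, regs, h, h'])
  have a₄ : s₄.arr = s₁.arr := by
    funext x
    rw [← a₃, hs₄]; exact run_arr _ _ (by simp [mul, arrs])
  have hn₄ : s₄.reg 0 = n := by rw [f₄ 0 (by omega) (by omega), hn₃]
  obtain ⟨s₅, hs₅⟩ : ∃ s₅, s₅ = (mul (b + 47) (b + 41) (b + 45) (b + 48)).run s₄ := ⟨_, rfl⟩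
  have hmul₅ := mul_run (d := b + 47) (a := b + 41) (b := b + 45) (j := b + 48) (s := s₄) (n := n)
    hn₄ (by simp [f₄, r₃, hkn]) (by simp) (by simp) (by simp) (by simp) (by simp) (by simp)
  rw [← hs₅] at hmul₅ ⊢
  have f₅ : ∀ x, x ≠ b + 47 → x ≠ b + 48 → s₅.reg x = s₄.reg x := fun x h h' => by
    rw [hs₅]; exact run_reg _ _ (by simp [mul, regs, h, h'])
  have a₅ : s₅.arr = s₁.arr := by
    funext x
    rw [← a₄, hs₅]; exact run_arr _ _ (by simp [mul, arrs])
  have hp1 : s₅.reg (b + 46) = (s.reg (b + 44) + cost) * s.reg (b + 42) := by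
    rw [f₅ _ (by simp) (by simp), hmul₄, r₃ _ (by simp), r₃ _ (by simp)]; simp
  have hp2 : s₅.reg (b + 47) = s.reg (b + 41) * (s.reg (b + 45) + cov) := by
    rw [hmul₅, f₄ _ (by simp) (by simp), f₄ _ (by simp) (by simp), r₃ _ (by simp),
      r₃ _ (by simp)]; simp
  have g₅ : ∀ x, x ≤ b + 60 → x ≠ b + 46 → x ≠ b + 47 → x ≠ b + 48 → s₅.reg x =
      if x = b + 45 then s.reg (b + 45) + cov else
      if x = b + 44 then s.reg (b + 44) + cost else s.reg x := fun x h0 h1 h2 h3 => by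
    rw [f₅ x h2 h3, f₄ x h1 h3, r₃ x h0]
  have hrows₅ : Rows n s₅ := hs.congr (by rw [g₅ 0 (by omega) (by omega) (by omega) (by omega),
    if_neg (by omega), if_neg (by omega)]) (by rw [a₅, a₁ 3 (by omega)])
  have hstep := h.track.step hcur.sub hcur.card hqual hbest0
  have hc : (Expr.sub (.reg (b + 47)) (.reg (b + 46))).eval s₅ ≠ 0 ↔
      (s.reg (b + 44) + cost) * s.reg (b + 42) < s.reg (b + 41) * (s.reg (b + 45) + cov) := by
    simp only [Expr.eval, hp1, hp2]; omega
  rw [run]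
  split_ifs with h0 <;> rw [hc] at h0
  · simp only [run_seq]
    obtain ⟨s₆, hs₆⟩ : ∃ s₆, s₆ = (copy (b + 42) (b + 60) (b + 48) (b + 49)).run s₅ := ⟨_, rfl⟩
    have hcopy₆ := marked_copy_run (a := b + 42) (b := b + 60) (r := b + 48) (r' := b + 49) hrows₅
      (by simp) (by simp) (by simp) (by simp) (by simp)
    rw [← hs₆] at hcopy₆ ⊢
    have f₆ : (copy (b + 42) (b + 60) (b + 48) (b + 49)).Frame s₅ s₆ := hs₆ ▸ frame_run _ _
    have hrows₆ := f₆.rows hrows₅ (by simp [copy, fill, regs]) (by simp [copy, fill, arrs])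
    obtain ⟨s₇, hs₇⟩ : ∃ s₇, s₇ = (copy (b + 43) (b + 61) (b + 48) (b + 49)).run s₆ := ⟨_, rfl⟩
    have hcopy₇ := markedPairs_copy_run (a := b + 43) (b := b + 61) (r := b + 48) (r' := b + 49)
      hrows₆ (by simp) (by simp) (by simp) (by simp) (by simp)
    rw [← hs₇] at hcopy₇ ⊢
    have f₇ : (copy (b + 43) (b + 61) (b + 48) (b + 49)).Frame s₆ s₇ := hs₇ ▸ frame_run _ _
    rw [f₆.2 (b + 61) (by simp [copy, fill, arrs])] at hcopy₇
    have hX₇ : marked n (s₇.arr (b + 42)) = marked n (s₁.arr (b + 60)) := by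
      rw [f₇.2 (b + 42) (by simp [copy, fill, arrs]), hcopy₆, a₅]
    have g₇ : ∀ x, x ≤ b + 60 → (x ≤ b + 45 ∨ b + 50 ≤ x) → s₇.reg x =
        if x = b + 45 then s.reg (b + 45) + cov else
        if x = b + 44 then s.reg (b + 44) + cost else s.reg x := fun x h0 h1 => by
      rw [f₇.1 x (by simp [copy, fill, regs]; omega), f₆.1 x (by simp [copy, fill, regs]; omega),
        g₅ x h0 (by omega) (by omega) (by omega)]
    have a₇ : ∀ x, x ≠ b + 42 → x ≠ b + 43 → s₇.arr x = s₁.arr x := fun x h h' => by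
      rw [f₇.2 x (by simp [copy, fill, arrs, h']), f₆.2 x (by simp [copy, fill, arrs, h]), a₅]
    have hrun : (assign (b + 42) (.reg (b + 45))).run ((assign (b + 41) (.reg (b + 44))).run s₇) =
        (s₇.setReg (b + 41) (s.reg (b + 44) + cost)).setReg (b + 42) (s.reg (b + 45) + cov) := by
      simp [run, Expr.eval, g₇]
    rw [hrun]
    rw [a₅] at hcopy₇
    -- A strict win forces a positive count, so no artificial cost is subtracted from the new
    -- record.
    have hk : s.reg (b + 45) + cov ≠ 0 := by
      intro h1; rw [h1] at h0; simp at h0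
    constructor
    · simp [g₇, h.root]
    · refine ⟨A + cost, ?_, ?_⟩
      · simp [g₇, hA]; omega
      · simpa [g₇, a₇] using htrans
    · constructor
      · simp only [State.setReg_arr, State.setReg_reg, hX₇, hcopy₇, Nat.add_left_cancel_iff,
          Nat.reduceEqDiff, if_true, if_false]
        rw [show 1 - (s.reg (b + 45) + cov) = 0 by omega, Nat.sub_zero, hA, Nat.add_assoc]
        exact hcand
      · simp; omega
    · simpa [g₇] using hstep.1 h0
    · intro u' hu'
      simpa [g₇] using (h.seen u' hu').of_lt h0
  · rw [run]
    constructor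
    · simp [g₅, h.root]
    · refine ⟨A + cost, ?_, ?_⟩
      · simp [g₅, hA]; omega
      · simpa [g₅, a₅] using htrans
    · simpa [Best, g₅, a₅, a₁] using h.best
    · simpa [g₅] using hstep.2 h0
    · simpa [g₅] using h.seen

end Cmd

end RAM

/-! ### Correctness of one level of the recursion -/

namespace RAM

open SCSS

namespace Cmd

theorem greedyFrom_regs {b : ℕ} {p : Cmd} (hp : ∀ x ∈ p.regs, b + 60 < x) :
    ∀ x ∈ (greedyFrom b p).regs, (b + 41 ≤ x ∧ x ≤ b + 50 ∧ x ≠ b + 43) ∨ b + 60 ≤ x := by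
  intro x hx
  have := greedyRound_regs hp x
  simp [greedyFrom, regs, copy, fill] at hx
  by_cases h : x ∈ (greedyRound b p).regs
  · have := this h; omega
  · simp only [h, or_false] at hx; omega

theorem greedyFrom_arrs {b : ℕ} {p : Cmd} (hp : ∀ x ∈ p.arrs, b + 60 ≤ x) :
    ∀ x ∈ (greedyFrom b p).arrs, x = b + 42 ∨ x = b + 43 ∨ b + 60 ≤ x := by
  intro x hx
  have := greedyRound_arrs hp x
  simp [greedyFrom, arrs, copy, fill] at hx
  by_cases h : x ∈ (greedyRound b p).arrs
  · exact this h
  · simp only [h, or_false] at hx; omega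

/-- The run starts with cost D v u and nothing covered, where `Track.zero` applies; after n rounds
`Track.seen` adds u to the vertices treated. -/
theorem greedyFrom_run {G : ℕ → ℕ → Prop} {n C e b u v : ℕ} {p : Cmd} {s : State} {D : ℕ → ℕ → ℕ}
    {U : Set ℕ} {X : Finset ℕ} {M : Finset (ℕ × ℕ)} (hp : IsCovering C e (b + 20) p)
    (hs : Rows n s) (hD : mat n (s.arr 5) = D) (hdist : IsDist G n D)
    (hu : u < n) (hv : v < n) (hvu : D v u < n) (hsu : s.reg (b + 43) = u)
    (hsv : s.reg (b + 40) = v) (hX : marked n (s.arr (b + 40)) = X)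
    (hM : markedPairs n (s.arr (b + 41)) = M) (hbest : Best n D v X M b s)
    (hseen : ∀ u' ∈ U, Seen G (D v u') C e u' X (s.reg (b + 41)) (s.reg (b + 42))) :
    let s' := (greedyFrom b p).run s
    Best n D v X M b s' ∧
      ∀ u' ∈ insert u U, Seen G (D v u') C e u' X (s'.reg (b + 41)) (s'.reg (b + 42)) := by
  intro s'
  have hpr := hp.regs_lt
  have hpa := hp.arrs_le
  simp only [Nat.add_assoc, Nat.reduceAdd] at hpr hpa
  have hs' : s' = (greedyFrom b p).run s := rfl
  simp only [greedyFrom, run_seq] at hs'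
  obtain ⟨s₁, hs₁⟩ : ∃ s₁, s₁ = (copy (b + 60) (b + 40) (b + 48) (b + 49)).run s := ⟨_, rfl⟩
  have hcopy₁ := marked_copy_run (a := b + 60) (b := b + 40) (r := b + 48) (r' := b + 49) hs
    (by simp) (by simp) (by simp) (by simp) (by simp)
  rw [← hs₁] at hcopy₁ hs'
  have f₁ : (copy (b + 60) (b + 40) (b + 48) (b + 49)).Frame s s₁ := hs₁ ▸ frame_run _ _
  have hrows₁ := f₁.rows hs (by simp [copy, fill, regs]) (by simp [copy, fill, arrs])
  obtain ⟨s₂, hs₂⟩ : ∃ s₂, s₂ = (copy (b + 61) (b + 41) (b + 48) (b + 49)).run s₁ := ⟨_, rfl⟩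
  have hcopy₂ := markedPairs_copy_run (a := b + 61) (b := b + 41) (r := b + 48) (r' := b + 49) hrows₁
    (by simp) (by simp) (by simp) (by simp) (by simp)
  rw [← hs₂] at hcopy₂ hs'
  have f₂ : (copy (b + 61) (b + 41) (b + 48) (b + 49)).Frame s₁ s₂ := hs₂ ▸ frame_run _ _
  have hrows₂ := f₂.rows hrows₁ (by simp [copy, fill, regs]) (by simp [copy, fill, arrs])
  rw [f₁.2 (b + 41) (by simp [copy, fill, arrs])] at hcopy₂
  have g₂ : ∀ x, (x ≤ b + 47 ∨ b + 50 ≤ x) → s₂.reg x = s.reg x := fun x hx => by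
    rw [f₂.1 x (by simp [copy, fill, regs]; omega), f₁.1 x (by simp [copy, fill, regs]; omega)]
  have a₂ : ∀ x, x ≠ b + 60 → x ≠ b + 61 → s₂.arr x = s.arr x := fun x h h' => by
    rw [f₂.2 x (by simp [copy, fill, arrs, h']), f₁.2 x (by simp [copy, fill, arrs, h])]
  have hX₂ : marked n (s₂.arr (b + 60)) = X := by
    rw [f₂.2 (b + 60) (by simp [copy, fill, arrs]), hcopy₁, hX]
  have hidx : (Expr.idx (b + 40) (b + 43)).eval s₂ = v * n + u := by
    rw [hrows₂.eval_idx (by rw [g₂ _ (by omega), hsv]; exact hv), g₂ _ (by omega), hsv,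
      g₂ _ (by omega), hsu]
  obtain ⟨s₃, hs₃⟩ : ∃ s₃, s₃ = (((s₂.setArr (b + 61) (v * n + u) 1).setReg (b + 60) u).setReg
    (b + 44) (D v u)).setReg (b + 45) 0 := ⟨_, rfl⟩
  have hrun₃ : (assign (b + 45) (.const 0)).run ((assign (b + 44)
      (.arr 5 (.idx (b + 40) (b + 43)))).run ((assign (b + 60) (.reg (b + 43))).run
      ((store (b + 61) (.idx (b + 40) (b + 43)) (.const 1)).run s₂))) = s₃ := by
    have h5 : s.arr 5 (v * n + u) = D v u := by rw [← hD]; rfl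
    have h3 : s₂.arr 3 v = v * n := hrows₂.2 v hv
    have h61 : (3 : ℕ) ≠ b + 61 := by omega
    have h61' : (5 : ℕ) ≠ b + 61 := by omega
    rw [hs₃]
    simp only [run, hidx]
    simp [Expr.eval, Expr.idx, g₂, hsu, hsv, h3, a₂, h5]
  rw [hrun₃] at hs'
  have hrows₃ : Rows n s₃ := hrows₂.congr (by simp [hs₃]) (by simp [hs₃])
  have hD₃ : mat n (s₃.arr 5) = D := by
    rw [← hD, ← a₂ 5 (by omega) (by omega)]; simp [hs₃]
  have hinit : RoundInv G n D C e v X M U u b 0 s₃ := by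
    constructor
    · simp [hs₃]
    · refine ⟨0, by simp [hs₃], ?_⟩
      have : markedPairs n (s₃.arr (b + 61)) = insert (v, u) M := by
        simp only [hs₃, State.setReg_arr, State.setArr_arr, if_true]
        rw [markedPairs_update hv hu (by simp), hcopy₂, hM]
      have hX₃ : marked n (s₃.arr (b + 60)) = X := by
        simpa [hs₃] using hX₂
      rw [this, hX₃]
      simpa [hs₃] using Sound.refl n D u X (insert (v, u) M)
    · simpa [Best, hs₃, g₂, a₂] using hbest
    · simpa [hs₃] using Track.zero
    · simpa [hs₃, g₂] using hseen
  have hfinal := iter_rule (r := b + 50) (p := greedyRound b p) hrows₃.1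
    (fun j s => RoundInv G n D C e v X M U u b j s)
    (fun k s x h => ⟨by simpa using h.root, by simpa using h.cur, by simpa [Best] using h.best,
      by simpa using h.track, by simpa using h.seen⟩) hinit
    (by
      intro j s'' hj hr hf h
      have hR : ∀ x ∈ (iter (b + 50) (greedyRound b p)).regs, x ≠ 0 := by
        intro x hx
        simp only [regs, Finset.mem_insert] at hx
        rcases hx with rfl | hx
        · omega
        · have := greedyRound_regs hpr x hx; omega
      have hA : ∀ x ∈ (iter (b + 50) (greedyRound b p)).arrs, 40 ≤ x := by
        intro x hx
        have := greedyRound_arrs hpa x hx; omega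
      refine greedyRound_run hp (hf.rows hrows₃ (fun h => hR 0 h rfl) (fun h => ?_)) ?_ hdist hu hvu
        (hX ▸ marked_subset_range) h
      · have := hA 3 h; omega
      · rw [hf.2 5 (fun h => by have := hA 5 h; omega), hD₃])
  rw [← hs'] at hfinal
  refine ⟨hfinal.best, ?_⟩
  rintro u' (rfl | hu')
  · exact hfinal.track.seen (hX ▸ marked_subset_range)
  · exact hfinal.seen u' hu'

/-- Every u at finite distance from v is tried, so the final record competes with the unknown root
of the good piece, and `Quality.of_seen` applies. -/
theorem IsCovering.level {C e b : ℕ} {p : Cmd} (hp : IsCovering C e (b + 20) p) :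
    IsCovering (4 * (C + 1)) (e + 1) b (level b p) := by
  have hpr := hp.regs_lt
  have hpa := hp.arrs_le
  simp only [Nat.add_assoc, Nat.reduceAdd] at hpr hpa
  have hFr := greedyFrom_regs hpr
  have hFa := greedyFrom_arrs hpa
  have hRr := greedyRound_regs hpr
  constructor
  · have h1 : b + 50 ∉ (greedyRound b p).regs := fun h => by have := hRr _ h; omega
    have h2 : 0 ∉ (greedyRound b p).regs := fun h => by have := hRr _ h; omega
    have h3 : b + 43 ∉ (greedyFrom b p).regs := fun h => by have := hFr _ h; omega
    have h4 : 0 ∉ (greedyFrom b p).regs := fun h => by have := hFr _ h; omega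
    have h5 : (greedyRound b p).WF := by
      simp [greedyRound, WF, regs, mul, copy, fill, hp.wf]
    have h6 : (greedyFrom b p).WF := by
      simp [greedyFrom, WF, regs, copy, fill, h1, h2, h5]
    simp [Cmd.level, WF, regs, copy, fill, h3, h4, h6]
  · intro x hx
    have := hFr x
    simp [Cmd.level, regs, copy, fill] at hx
    by_cases h : x ∈ (greedyFrom b p).regs
    · have := this h; omega
    · simp [h] at hx; omega
  · intro x hx
    have := hFa x
    simp [Cmd.level, arrs, copy, fill] at hx
    by_cases h : x ∈ (greedyFrom b p).arrs
    · have := this h; omega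
    · simp [h] at hx; omega
  · intro G n s hdist hs hv
    obtain ⟨D, hD⟩ : ∃ D, D = mat n (s.arr 5) := ⟨_, rfl⟩
    obtain ⟨v, hvdef⟩ : ∃ v, v = s.reg (b + 40) := ⟨_, rfl⟩
    obtain ⟨X, hX⟩ : ∃ X, X = marked n (s.arr (b + 40)) := ⟨_, rfl⟩
    obtain ⟨M, hM⟩ : ∃ M, M = markedPairs n (s.arr (b + 41)) := ⟨_, rfl⟩
    rw [← hD] at hdist ⊢
    rw [← hvdef] at hv
    obtain ⟨s', hs'⟩ : ∃ s', s' = (Cmd.level b p).run s := ⟨_, rfl⟩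
    rw [← hs']
    simp only [Cmd.level, run_seq] at hs'
    obtain ⟨s₁, hs₁⟩ : ∃ s₁, s₁ = (copy (b + 42) (b + 40) (b + 48) (b + 49)).run s := ⟨_, rfl⟩
    have hcopy₁ := marked_copy_run (a := b + 42) (b := b + 40) (r := b + 48) (r' := b + 49) hs
      (by simp) (by simp) (by simp) (by simp) (by simp)
    rw [← hs₁] at hcopy₁ hs'
    have f₁ : (copy (b + 42) (b + 40) (b + 48) (b + 49)).Frame s s₁ := hs₁ ▸ frame_run _ _
    have hrows₁ := f₁.rows hs (by simp [copy, fill, regs]) (by simp [copy, fill, arrs])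
    obtain ⟨s₂, hs₂⟩ : ∃ s₂, s₂ = (copy (b + 43) (b + 41) (b + 48) (b + 49)).run s₁ := ⟨_, rfl⟩
    have hcopy₂ := markedPairs_copy_run (a := b + 43) (b := b + 41) (r := b + 48) (r' := b + 49)
      hrows₁ (by simp) (by simp) (by simp) (by simp) (by simp)
    rw [← hs₂] at hcopy₂ hs'
    have f₂ : (copy (b + 43) (b + 41) (b + 48) (b + 49)).Frame s₁ s₂ := hs₂ ▸ frame_run _ _
    have hrows₂ := f₂.rows hrows₁ (by simp [copy, fill, regs]) (by simp [copy, fill, arrs])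
    rw [f₁.2 (b + 41) (by simp [copy, fill, arrs]), ← hM] at hcopy₂
    have g₂ : ∀ x, (x ≤ b + 47 ∨ b + 50 ≤ x) → s₂.reg x = s.reg x := fun x hx => by
      rw [f₂.1 x (by simp [copy, fill, regs]; omega), f₁.1 x (by simp [copy, fill, regs]; omega)]
    have a₂ : ∀ x, x ≠ b + 42 → x ≠ b + 43 → s₂.arr x = s.arr x := fun x h h' => by
      rw [f₂.2 x (by simp [copy, fill, arrs, h']), f₁.2 x (by simp [copy, fill, arrs, h])]
    have hX₂ : marked n (s₂.arr (b + 42)) = X := by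
      rw [f₂.2 (b + 42) (by simp [copy, fill, arrs]), hcopy₁, hX]
    obtain ⟨s₃, hs₃⟩ : ∃ s₃, s₃ = (s₂.setReg (b + 41) 1).setReg (b + 42) 0 := ⟨_, rfl⟩
    have hrun₃ : (assign (b + 42) (.const 0)).run ((assign (b + 41) (.const 1)).run s₂) = s₃ := by
      simp [run, Expr.eval, hs₃]
    rw [hrun₃] at hs'
    have hrows₃ : Rows n s₃ := hrows₂.congr (by simp [hs₃]) (by simp [hs₃])
    -- The record starts as 1 / 0, worse than any density with a positive count. The term 1 - `reg
    -- (b + 42)` in `Best` removes this artificial cost as long as nothing is covered.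
    have hbest₃ : Best n D v X M b s₃ := by
      have := Sound.refl n D v X M
      simpa [Best, hs₃, hX₂, hcopy₂] using this
    have hloop := iter_rule (r := b + 43)
      (p := cond (.sub (.reg 0) (.arr 5 (.idx (b + 40) (b + 43)))) (greedyFrom b p) skip) hrows₃.1
      (fun k s => Best n D v X M b s ∧
        ∀ u ∈ {u | u < k ∧ D v u < n}, Seen G (D v u) C e u X (s.reg (b + 41)) (s.reg (b + 42)))
      (fun k s x h => by simpa [Best] using h) ⟨hbest₃, by simp⟩
      (by
        intro u t hu hr hf h
        have hR : ∀ x ∈ (iter (b + 43) (cond (.sub (.reg 0) (.arr 5 (.idx (b + 40) (b + 43))))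
            (greedyFrom b p) skip)).regs, b + 41 ≤ x := by
          intro x hx
          simp only [regs, Finset.mem_insert, Finset.mem_union, Finset.notMem_empty, or_false] at hx
          rcases hx with rfl | hx
          · omega
          · have := hFr x hx; omega
        have hA : ∀ x ∈ (iter (b + 43) (cond (.sub (.reg 0) (.arr 5 (.idx (b + 40) (b + 43))))
            (greedyFrom b p) skip)).arrs, b + 42 ≤ x := by
          intro x hx
          simp only [arrs, Finset.mem_union, Finset.notMem_empty, or_false] at hx
          have := hFa x hx; omega
        have gt : ∀ x, x ≤ b + 40 → t.reg x = s.reg x := fun x hx => by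
          rw [hf.1 x (fun h => by have := hR x h; omega), hs₃, State.setReg_reg, State.setReg_reg,
            if_neg (by omega), if_neg (by omega), g₂ x (by omega)]
        have ar : ∀ x, x ≤ b + 41 → t.arr x = s.arr x := fun x hx => by
          rw [hf.2 x (fun h => by have := hA x h; omega), hs₃, State.setReg_arr, State.setReg_arr,
            a₂ x (by omega) (by omega)]
        have hrows : Rows n t := hs.congr (gt 0 (by omega)) (ar 3 (by omega))
        have hvt : t.reg (b + 40) = v := by rw [gt _ le_rfl, hvdef]
        have hc : (Expr.sub (.reg 0) (.arr 5 (.idx (b + 40) (b + 43)))).eval t ≠ 0 ↔ D v u < n := by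
          simp only [Expr.eval]
          rw [hrows.eval_idx (by rw [hvt]; exact hv), hrows.1, hvt, hr, ar 5 (by omega), hD, mat]
          omega
        rw [run]
        split_ifs with h0 <;> rw [hc] at h0
        · have := greedyFrom_run (X := X) (M := M) hp hrows
            (by rw [ar 5 (by omega), hD]) hdist hu hv h0 hr hvt (by rw [ar _ (by omega), hX])
            (by rw [ar _ le_rfl, hM]) h.1 h.2
          refine ⟨this.1, fun u' hu' => this.2 u' ?_⟩
          simp only [Set.mem_ofPred_eq, Set.mem_insert_iff] at hu' ⊢
          omega
        · refine ⟨h.1, fun u' hu' => h.2 u' ?_⟩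
          simp only [Set.mem_ofPred_eq] at hu' ⊢
          refine ⟨?_, hu'.2⟩
          rcases Nat.lt_succ_iff_lt_or_eq.1 hu'.1 with h | rfl
          · exact h
          · exact absurd hu'.2 h0)
    obtain ⟨s₄, hs₄⟩ : ∃ s₄, s₄ = (iter (b + 43)
      (cond (.sub (.reg 0) (.arr 5 (.idx (b + 40) (b + 43)))) (greedyFrom b p) skip)).run s₃ :=
      ⟨_, rfl⟩
    rw [← hs₄] at hloop hs'
    have f₄ : (iter (b + 43)
      (cond (.sub (.reg 0) (.arr 5 (.idx (b + 40) (b + 43)))) (greedyFrom b p) skip)).Frame s₃ s₄ :=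
      hs₄ ▸ frame_run _ _
    have hrows₄ := f₄.rows hrows₃ (by
        simp only [regs, Finset.mem_insert, Finset.mem_union, Finset.notMem_empty, or_false]
        rintro (h | h)
        · omega
        · have := hFr 0 h; omega) (by
        simp only [arrs, Finset.mem_union, Finset.notMem_empty, or_false]
        intro h
        have := hFa 3 h; omega)
    obtain ⟨s₅, hs₅⟩ : ∃ s₅, s₅ = (copy (b + 40) (b + 42) (b + 48) (b + 49)).run s₄ := ⟨_, rfl⟩
    have hcopy₅ := marked_copy_run (a := b + 40) (b := b + 42) (r := b + 48) (r' := b + 49) hrows₄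
      (by simp) (by simp) (by simp) (by simp) (by simp)
    rw [← hs₅] at hcopy₅ hs'
    have f₅ : (copy (b + 40) (b + 42) (b + 48) (b + 49)).Frame s₄ s₅ := hs₅ ▸ frame_run _ _
    have hrows₅ := f₅.rows hrows₄ (by simp [copy, fill, regs]) (by simp [copy, fill, arrs])
    obtain ⟨s₆, hs₆⟩ : ∃ s₆, s₆ = (copy (b + 41) (b + 43) (b + 48) (b + 49)).run s₅ := ⟨_, rfl⟩
    have hcopy₆ := markedPairs_copy_run (a := b + 41) (b := b + 43) (r := b + 48) (r' := b + 49)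
      hrows₅ (by simp) (by simp) (by simp) (by simp) (by simp)
    rw [← hs₆] at hcopy₆ hs'
    have f₆ : (copy (b + 41) (b + 43) (b + 48) (b + 49)).Frame s₅ s₆ := hs₆ ▸ frame_run _ _
    rw [f₅.2 (b + 43) (by simp [copy, fill, arrs])] at hcopy₆
    have hX₆ : marked n (s₆.arr (b + 40)) = marked n (s₄.arr (b + 42)) := by
      rw [f₆.2 (b + 40) (by simp [copy, fill, arrs]), hcopy₅]
    have g₆ : ∀ x, x ≤ b + 47 → s₆.reg x = s₄.reg x := fun x hx => by
      rw [f₆.1 x (by simp [copy, fill, regs]; omega), f₅.1 x (by simp [copy, fill, regs]; omega)]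
    have hend : s' = s₆.setReg (b + 41) (s₄.reg (b + 41) - (1 - s₄.reg (b + 42))) := by
      rw [hs']; simp [run, Expr.eval, g₆]
    obtain ⟨⟨hsound, hzero⟩, hseen⟩ := hloop
    have hcost : s'.reg (b + 41) = s₄.reg (b + 41) - (1 - s₄.reg (b + 42)) := by simp [hend]
    have hcov : s'.reg (b + 42) = s₄.reg (b + 42) := by simp [hend, g₆]
    constructor
    · rw [← hvdef, ← hX, ← hM, hcost, hcov]
      simpa [hend, hX₆, hcopy₆] using hsound
    · rw [hcost, hcov]
      intro h0
      rw [hzero h0, h0]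
    · rw [← hvdef, ← hX, hcost, hcov]
      -- The guarantee is proved for the recorded cost; removing the artificial 1 only lowers it.
      have := Quality.of_seen hdist hv (fun u hu h => hseen u ⟨hu, h⟩)
      intro q S c hT hS hne hq
      obtain ⟨h1, h2⟩ := this q S c hT hS hne hq
      exact ⟨h1, (Nat.mul_le_mul_right _ (Nat.sub_le _ _)).trans h2⟩

/-- The constant in the approximation guarantee of `block i`. -/
def blockConst : ℕ → ℕ
  | 0 => 1
  | i + 1 => 4 * (blockConst i + 1)

/-- Each level raises the exponent of q ^ e by one but multiplies the loss by a constant only. The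
shift of the base by 20 keeps the storage of the levels apart. -/
theorem block_isCovering (i b : ℕ) : IsCovering (blockConst i) (i + 1) b (block i b) := by
  induction i generalizing b with
  | zero => exact nearest_isCovering b
  | succ i ih => exact (ih (b + 20)).level

end Cmd

end RAM

/-! ### From coverings to subgraphs -/

namespace RAM

open SCSS

namespace Cmd

/-- One step from `reg 8` towards `reg 2` on a shortest path, whose arc is added to array `6`. -/
def walkStep : Cmd :=
  cond (.arr 5 (.idx 8 2))
    (search 3 4 (.and (.arr 4 (.idx 8 3))
        (.eq (.add (.arr 5 (.idx 3 2)) (.const 1)) (.arr 5 (.idx 8 2)))) ;;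
      assign 4 (.sub (.reg 4) (.const 1)) ;; store 6 (.idx 8 4) (.const 1) ;; assign 8 (.reg 4))
    skip

/-- Add a shortest path from `reg 1` to `reg 2` to array `6`. -/
def walk : Cmd := assign 8 (.reg 1) ;; iter 9 walkStep

/-- Compute in array `6` a subgraph of the digraph in array `4` that leads from `reg 6` to the
vertices in array `1`. -/
def outTree (i : ℕ) : Cmd :=
  dist ;; copy 40 1 1 2 ;; fill 41 (.const 0) 1 2 ;; assign 40 (.reg 6) ;; iter 7 (block i 0) ;;
    fill 6 (.const 0) 1 2 ;; iter 1 (iter 2 (cond (.arr 41 (.idx 1 2)) walk skip))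

theorem walkStep_regs : walkStep.regs = {3, 4, 8} := by decide
theorem walkStep_arrs : walkStep.arrs = {6} := by decide
theorem walk_regs : walk.regs = {3, 4, 8, 9} := by decide
theorem walk_arrs : walk.arrs = {6} := by decide

theorem walkStep_run {n u v : ℕ} {s : State} {G : ℕ → ℕ → Prop} {D : ℕ → ℕ → ℕ} (hs : Rows n s)
    (hG : graph n (s.arr 4) = G) (hD : mat n (s.arr 5) = D) (hdist : IsDist G n D)
    (hu : u < n) (hv : v < n) (h8 : s.reg 8 = u) (h2 : s.reg 2 = v) (hlt : D u v < n) :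
    (D u v = 0 ∧ walkStep.run s = s) ∨ ∃ w < n, G u w ∧ D w v + 1 = D u v ∧
      (walkStep.run s).reg 8 = w ∧
      markedPairs n ((walkStep.run s).arr 6) = insert (u, w) (markedPairs n (s.arr 6)) := by
  have hidx : (Expr.idx 8 2).eval s = u * n + v := by rw [hs.eval_idx (by omega), h8, h2]
  have hDuv : s.arr 5 (u * n + v) = D u v := by rw [← hD]; rfl
  have hc : (Expr.arr 5 (.idx 8 2)).eval s = D u v := by rw [Expr.eval, hidx, hDuv]
  rw [walkStep, run, hc]
  split_ifs with h0
  · right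
    have hsearch := search_run (r := 3) (f := 4) (e := .and (.arr 4 (.idx 8 3))
        (.eq (.add (.arr 5 (.idx 3 2)) (.const 1)) (.arr 5 (.idx 8 2)))) hs.1 (by simp) (by simp)
      (fun w => G u w ∧ D w v + 1 = D u v) (by
        intro w s' hw h3 hf
        have hs' := hf.rows hs (by simp [search, regs]) (by simp [search, arrs])
        have h8' := hf.1 8 (by simp [search, regs])
        have h2' := hf.1 2 (by simp [search, regs])
        have h4a := hf.2 4 (by simp [search, arrs])
        have h5a := hf.2 5 (by simp [search, arrs])
        rw [Expr.eval_and, Expr.eval_eq, Expr.eval, Expr.eval, Expr.eval, Expr.eval, Expr.eval,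
          hs'.eval_idx (by omega), hs'.eval_idx (by omega), hs'.eval_idx (by omega), h8', h8, h2',
          h2, h3, h4a, h5a, hDuv, ← hG, ← hD]
        simp [graph, hu, hw, mat])
    set s₁ := (search 3 4 (.and (.arr 4 (.idx 8 3))
        (.eq (.add (.arr 5 (.idx 3 2)) (.const 1)) (.arr 5 (.idx 8 2))))).run s with hs₁
    have hf : Frame _ s s₁ := frame_run _ _
    have hrows := hf.rows hs (by simp [search, regs]) (by simp [search, arrs])
    have h8' := (hf.1 8 (by simp [search, regs])).trans h8
    have h6a := hf.2 6 (by simp [search, arrs])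
    obtain ⟨w, hw, h4, hGw, hDw⟩ := hsearch.resolve_left (fun h => by
      obtain ⟨w, hGw, hDw⟩ := hdist.step u hu v hv hlt h0
      exact h.2 w (hdist.bound _ _ hGw).2 ⟨hGw, hDw⟩)
    have hrun : (assign 8 (.reg 4)).run ((store 6 (.idx 8 4) (.const 1)).run
        ((assign 4 (.sub (.reg 4) (.const 1))).run s₁)) =
        ((s₁.setReg 4 w).setArr 6 (u * n + w) 1).setReg 8 w := by
      have h3 := hrows.2 u hu
      simp [run, Expr.eval, Expr.idx, h4, h8', h3]
    simp only [run_seq]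
    rw [← hs₁, hrun]
    refine ⟨w, hw, hGw, hDw, by simp, ?_⟩
    simp only [State.setReg_arr, State.setArr_arr, if_true]
    rw [markedPairs_update hu hw (by simp), h6a]
  · exact .inl ⟨not_not.1 h0, rfl⟩

theorem walk_run {n u v : ℕ} {s : State} {G : ℕ → ℕ → Prop} {D : ℕ → ℕ → ℕ} (hs : Rows n s)
    (hG : graph n (s.arr 4) = G) (hD : mat n (s.arr 5) = D) (hdist : IsDist G n D)
    (hu : u < n) (hv : v < n) (h1 : s.reg 1 = u) (h2 : s.reg 2 = v) (hlt : D u v < n) :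
    markedPairs n (s.arr 6) ⊆ markedPairs n ((walk.run s).arr 6) ∧
    (∀ p ∈ markedPairs n ((walk.run s).arr 6), p ∈ markedPairs n (s.arr 6) ∨ G p.1 p.2) ∧
    (markedPairs n ((walk.run s).arr 6)).card ≤ (markedPairs n (s.arr 6)).card + D u v ∧
    Reach (markedPairs n ((walk.run s).arr 6)) u v := by
  have hstart : (assign 8 (.reg 1)).run s = s.setReg 8 u := by simp [run, Expr.eval, h1]
  have hrows₁ : Rows n (s.setReg 8 u) := hs.congr (by simp) rfl
  have := iter_rule (r := 9) (p := walkStep) hrows₁.1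
    -- Each round brings the current vertex one step closer until it is v. As D u v < n, the n
    -- rounds suffice, and the arcs added so far plus the remaining distance never exceed D u v.
    (fun k s' => s'.reg 8 < n ∧ (D (s'.reg 8) v + k ≤ D u v ∨ D (s'.reg 8) v = 0) ∧
      markedPairs n (s.arr 6) ⊆ markedPairs n (s'.arr 6) ∧
      (∀ p ∈ markedPairs n (s'.arr 6), p ∈ markedPairs n (s.arr 6) ∨ G p.1 p.2) ∧
      (markedPairs n (s'.arr 6)).card + D (s'.reg 8) v ≤ (markedPairs n (s.arr 6)).card + D u v ∧
      Reach (markedPairs n (s'.arr 6)) u (s'.reg 8)) (fun k s x h => by simpa using h)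
    ⟨by simpa using hu, by simp, subset_rfl, fun p hp => .inl hp, by simp, by
      rw [State.setReg_reg, if_pos rfl]; exact .refl⟩ (by
      rintro j s' hj hr hf ⟨hcur, hj', hsub, hG', hcard, hreach⟩
      have hrows := hf.rows hrows₁ (by simp [regs, walkStep_regs]) (by simp [arrs, walkStep_arrs])
      have h4 := hf.2 4 (by simp [arrs, walkStep_arrs])
      have h5 := hf.2 5 (by simp [arrs, walkStep_arrs])
      have h2' : s'.reg 2 = v := by rw [hf.1 2 (by simp [regs, walkStep_regs])]; simpa using h2
      rcases walkStep_run hrows (by rw [h4]; exact hG) (by rw [h5]; exact hD) hdist hcur hv rfl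
          h2' (by omega) with
        ⟨h0, heq⟩ | ⟨w, hw, hGw, hDw, h8, hO⟩
      · rw [heq]
        exact ⟨hcur, .inr h0, hsub, hG', hcard, hreach⟩
      · rw [h8, hO]
        refine ⟨hw, by omega, hsub.trans (Finset.subset_insert _ _), ?_, ?_, ?_⟩
        · intro p hp
          rcases Finset.mem_insert.1 hp with rfl | hp
          · exact .inr hGw
          · exact hG' p hp
        · have := Finset.card_insert_le (s'.reg 8, w) (markedPairs n (s'.arr 6))
          omega
        · exact .tail (hreach.mono (Finset.subset_insert _ _)) (Finset.mem_insert_self _ _))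
  rw [walk, run_seq, hstart]
  obtain ⟨hcur, hj, hsub, hG', hcard, hreach⟩ := this
  have h0 := hdist.eq_of_zero _ hcur v hv (by omega)
  rw [h0] at hreach
  exact ⟨hsub, hG', by omega, hreach⟩

theorem block_regs {i x : ℕ} (h : x ∈ (block i 0).regs) : 40 < x := by
  simpa using (block_isCovering i 0).regs_lt x h

theorem block_arrs {i x : ℕ} (h : x ∈ (block i 0).arrs) : 40 ≤ x := by
  simpa using (block_isCovering i 0).arrs_le x h

theorem outTree_regs {i x : ℕ} (h : x ∈ (outTree i).regs) : (1 ≤ x ∧ x ≤ 9 ∧ x ≠ 6) ∨ 40 ≤ x := by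
  simp [outTree, regs, copy, fill, dist_regs, walk_regs] at h
  by_cases hx : x ∈ (block i 0).regs
  · have := block_regs hx; omega
  · simp [hx] at h; omega

theorem outTree_arrs {i x : ℕ} (h : x ∈ (outTree i).arrs) : x = 5 ∨ x = 6 ∨ 40 ≤ x := by
  simp [outTree, arrs, copy, fill, dist_arrs, walk_arrs] at h
  by_cases hx : x ∈ (block i 0).arrs
  · have := block_arrs hx; omega
  · simp [hx] at h; omega

theorem outTree_wf (i : ℕ) : (outTree i).WF := by
  have h1 : 7 ∉ (block i 0).regs := fun h => by have := block_regs h; omega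
  have h2 : 0 ∉ (block i 0).regs := fun h => by have := block_regs h; omega
  simp [outTree, WF, regs, copy, fill, dist_wf, h1, h2, (block_isCovering i 0).wf, walk,
    walkStep_regs]
  simp [walkStep, WF, search, regs]

/-- Repeated covering leads to a logarithmic factor. -/
theorem iter_block_run {i n r c q : ℕ} {s : State} {G : ℕ → ℕ → Prop} {D : ℕ → ℕ → ℕ}
    {T : Finset ℕ} (hs : Rows n s) (hD : mat n (s.arr 5) = D) (hdist : IsDist G n D)
    (hr : r < n) (h40 : s.reg 40 = r) (hT : marked n (s.arr 40) = T)
    (hM : markedPairs n (s.arr 41) = ∅) (htree : Tree G r T c) (hq : T.card ≤ q ^ (i + 1)) :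
    let M := markedPairs n (((iter 7 (block i 0)).run s).arr 41)
    (∀ p ∈ M, D p.1 p.2 < n) ∧ (∀ t ∈ T, Reach M r t) ∧
      (weight D M : ℝ) ≤ blockConst i * q * c * harmonic T.card := by
  have hcard : T.card ≤ n := by
    have := Finset.card_le_card (hT ▸ marked_subset_range : T ⊆ Finset.range n)
    simpa using this
  have hcov := block_isCovering i 0
  have hloop := iter_rule (r := 7) (p := block i 0) hs.1
    -- While vertices remain, each call covers at least one, so n ≥ |T| calls suffice. The cost A is
    -- bounded by a multiple of the drop of the potential H(|X|) from H(|T|).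
    (fun j s' => ((marked n (s'.arr 40)).card + j ≤ T.card ∨ marked n (s'.arr 40) = ∅) ∧
      ∃ A k : ℕ, Sound n D r T ∅ (marked n (s'.arr 40)) (markedPairs n (s'.arr 41)) A k ∧
        (A : ℝ) ≤ blockConst i * q * c *
          ((harmonic T.card : ℝ) - harmonic (marked n (s'.arr 40)).card))
    (fun k s' x h => by simpa using h) (by
      rw [hT, hM]
      exact ⟨.inl le_rfl, 0, 0, Sound.refl _ _ _ _ _, by simp⟩) (by
      rintro j s' hj hr7 hf ⟨hX, A, k, hsound, hA⟩
      have hR : ∀ x < 40, x ≠ 7 → s'.reg x = s.reg x := fun x hx hx7 => hf.1 x (fun h => by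
        simp only [regs, Finset.mem_insert] at h
        rcases h with h | h
        · exact hx7 h
        · have := block_regs h; omega)
      have h40' : s'.reg 40 = r := by
        rw [hf.1 40 (fun h => by
          simp only [regs, Finset.mem_insert] at h
          rcases h with h | h
          · omega
          · have := block_regs h; omega), h40]
      have hA' : ∀ x < 40, s'.arr x = s.arr x := fun x hx => hf.2 x (fun h => by
        have := block_arrs h; omega)
      have hrows : Rows n s' := hs.congr (hR 0 (by omega) (by omega)) (hA' 3 (by omega))
      obtain ⟨hs1, hs2, hs3⟩ := hcov.covers G n s' (by rw [hA' 5 (by omega), hD]; exact hdist)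
        hrows (by simpa [h40'] using hr)
      simp only [Nat.zero_add, h40', hA' 5 (by omega), hD] at hs1 hs2 hs3
      set X := marked n (s'.arr 40) with hXdef
      set s'' := (block i 0).run s' with hs''
      have hc1 := hs1.card
      rcases Finset.eq_empty_or_nonempty X with hXe | hXne
      -- Once X is empty, further calls cover nothing and, by the field `zero` of `Covers`, cost
      -- nothing.
      · have hX' : marked n (s''.arr 40) = ∅ := by
          have := hs1.sub; rw [hXe] at this; exact Finset.subset_empty.1 this
        have hcov0 : s''.reg 42 = 0 := by rw [hXe, hX'] at hc1; simpa using hc1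
        refine ⟨.inr hX', _, _, hsound.trans hs1, ?_⟩
        rw [hs2 hcov0, hX', ← hXe]
        simpa using hA
      · have hXT : X ⊆ T := hsound.sub
        have hXpos : 0 < X.card := Finset.card_pos.2 hXne
        -- The full tree, at unchanged cost c, is the comparison for the vertices that remain.
        obtain ⟨hpos, hle⟩ := hs3 q X c (htree.mono hXT) subset_rfl hXne
          ((Finset.card_le_card hXT).trans hq)
        refine ⟨.inl ?_, _, _, hsound.trans hs1, ?_⟩
        · rcases hX with hX | hX
          · omega
          · rw [hX] at hXpos; simp at hXpos
        · have h1 := div_le_harmonic_sub hc1 hXpos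
          have h2 : (s''.reg 41 : ℝ) ≤ blockConst i * q * c * ((s''.reg 42 : ℝ) / X.card) := by
            rw [← mul_div_assoc, le_div_iff₀ (by exact_mod_cast hXpos)]
            exact_mod_cast hle
          have h3 : (blockConst i * q * c : ℝ) * ((s''.reg 42 : ℝ) / X.card) ≤
              blockConst i * q * c * (harmonic X.card - harmonic (marked n (s''.arr 40)).card) :=
            mul_le_mul_of_nonneg_left h1 (by positivity)
          push_cast
          linarith)
  obtain ⟨hX, A, k, hsound, hA⟩ := hloop
  have hXe : marked n (((iter 7 (block i 0)).run s).arr 40) = ∅ := by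
    rcases hX with h | h
    · exact Finset.card_eq_zero.1 (by omega)
    · exact h
  rw [hXe] at hsound hA
  refine ⟨fun p hp => hsound.lt p hp (by simp), fun t ht => hsound.reach t ht (by simp), ?_⟩
  have h1 := hsound.weight_le
  simp only [weight, Finset.sum_empty, Nat.zero_add] at h1
  have h2 : ((∑ p ∈ markedPairs n (((iter 7 (block i 0)).run s).arr 41), D p.1 p.2 : ℕ) : ℝ) ≤ A := by
    exact_mod_cast h1
  simp only [Finset.card_empty, harmonic_zero, Rat.cast_zero, sub_zero] at hA
  exact h2.trans hA

/-- All pairs in array `41` are replaced by shortest paths. -/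
theorem iter_walk_run {n : ℕ} {s : State} {G : ℕ → ℕ → Prop} {D : ℕ → ℕ → ℕ}
    {M : Finset (ℕ × ℕ)} (hs : Rows n s) (hG : graph n (s.arr 4) = G) (hD : mat n (s.arr 5) = D)
    (hdist : IsDist G n D) (hM : markedPairs n (s.arr 41) = M) (hlt : ∀ p ∈ M, D p.1 p.2 < n)
    (h6 : markedPairs n (s.arr 6) = ∅) :
    let O := markedPairs n (((iter 1 (iter 2 (cond (.arr 41 (.idx 1 2)) walk skip))).run s).arr 6)
    (∀ p ∈ O, G p.1 p.2) ∧ O.card ≤ weight D M ∧ ∀ p ∈ M, Reach O p.1 p.2 := by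
  have hloop := iter_iter_rule (r := 1) (r' := 2) (p := cond (.arr 41 (.idx 1 2)) walk skip) hs.1
    (by simp) (by simp [regs, walk_regs]) (by simp [regs, walk_regs]) (by simp) (by simp)
    (fun k s' => (∀ p ∈ markedPairs n (s'.arr 6), G p.1 p.2) ∧
      (markedPairs n (s'.arr 6)).card ≤ weight D (M.filter fun p => p.1 * n + p.2 < k) ∧
      ∀ p ∈ M, p.1 * n + p.2 < k → Reach (markedPairs n (s'.arr 6)) p.1 p.2)
    (fun _ _ _ h => h) (fun _ _ _ h => h) (by simp [h6]) (by
      rintro u v s' hu hv hr1 hr2 hf ⟨hO, hcard, hreach⟩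
      have hrows := hf.rows hs (by simp [regs, walk_regs]) (by simp [arrs, walk_arrs])
      have h4 := hf.2 4 (by simp [arrs, walk_arrs])
      have h5 := hf.2 5 (by simp [arrs, walk_arrs])
      have h41 := hf.2 41 (by simp [arrs, walk_arrs])
      have hc : (Expr.arr 41 (.idx 1 2)).eval s' ≠ 0 ↔ (u, v) ∈ M := by
        rw [Expr.eval, hrows.eval_idx (by omega), hr1, hr2, h41, ← hM, mem_markedPairs]
        simp [hu, hv]
      have hbound : ∀ p ∈ M, p.1 < n ∧ p.2 < n := fun p hp => by
        rw [← hM] at hp; exact (mem_markedPairs.1 hp).1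
      have hnext : ∀ p ∈ M, p.1 * n + p.2 < u * n + v + 1 ↔ p.1 * n + p.2 < u * n + v ∨ p = (u, v) := by
        intro p hp
        have := idx_inj (u := p.1) (u' := u) (hbound p hp).2 hv
        rw [Prod.ext_iff, ← this]
        omega
      rw [run]
      split_ifs with h0 <;> rw [hc] at h0
      · obtain ⟨hsub, hG', hcard', hr⟩ := walk_run hrows (by rw [h4, hG]) (by rw [h5, hD]) hdist hu
          hv hr1 hr2 (hlt _ h0)
        refine ⟨fun p hp => (hG' p hp).elim (hO p) id, ?_, fun p hp hk => ?_⟩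
        · have : M.filter (fun p => p.1 * n + p.2 < u * n + v + 1) =
              insert (u, v) (M.filter fun p => p.1 * n + p.2 < u * n + v) := by
            ext p
            simp only [Finset.mem_filter, Finset.mem_insert]
            constructor
            · rintro ⟨h1, h2⟩
              rcases (hnext p h1).1 h2 with h3 | h3
              · exact .inr ⟨h1, h3⟩
              · exact .inl h3
            · rintro (rfl | ⟨h1, h2⟩)
              · exact ⟨h0, (hnext _ h0).2 (.inr rfl)⟩
              · exact ⟨h1, (hnext _ h1).2 (.inl h2)⟩
          rw [this, weight, Finset.sum_insert (by simp)]
          rw [weight] at hcard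
          dsimp only
          omega
        · rcases (hnext p hp).1 hk with hk | rfl
          · exact (hreach p hp hk).mono hsub
          · exact hr
      · have : M.filter (fun p => p.1 * n + p.2 < u * n + v + 1) =
            M.filter fun p => p.1 * n + p.2 < u * n + v := by
          refine Finset.filter_congr fun p hp => ?_
          rw [hnext p hp]
          exact or_iff_left (by rintro rfl; exact h0 hp)
        rw [this]
        refine ⟨hO, hcard, fun p hp hk => hreach p hp ?_⟩
        rcases (hnext p hp).1 hk with hk | rfl
        · exact hk
        · exact absurd hp h0)
  have hbound : ∀ p ∈ M, p.1 * n + p.2 < n * n := fun p hp => by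
    rw [← hM] at hp
    exact idx_lt (mem_markedPairs.1 hp).1.1 (mem_markedPairs.1 hp).1.2
  rw [Finset.filter_true_of_mem hbound] at hloop
  exact ⟨hloop.1, hloop.2.1, fun p hp => hloop.2.2 p hp (hbound p hp)⟩

/-- Each chosen pair has finite distance and is replaced by a shortest path, so the number of arcs
is at most the total weight of the pairs, and reachability by pairs becomes reachability by arcs. -/
theorem outTree_run {i n r c q : ℕ} {s : State} (hs : Rows n s) (hr : r < n) (h6 : s.reg 6 = r)
    (htree : Tree (graph n (s.arr 4)) r (marked n (s.arr 1)) c)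
    (hq : (marked n (s.arr 1)).card ≤ q ^ (i + 1)) :
    let O := markedPairs n (((outTree i).run s).arr 6)
    O ⊆ markedPairs n (s.arr 4) ∧ (∀ t ∈ marked n (s.arr 1), Reach O r t) ∧
      (O.card : ℝ) ≤ blockConst i * q * c * harmonic (marked n (s.arr 1)).card := by
  intro O
  obtain ⟨s', hs'⟩ : ∃ s', s' = (outTree i).run s := ⟨_, rfl⟩
  have hO : O = markedPairs n (s'.arr 6) := by rw [hs']
  rw [hO]
  obtain ⟨s₁, hs₁⟩ : ∃ s₁, s₁ = dist.run s := ⟨_, rfl⟩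
  have hdist := dist_run hs
  simp only [outTree, run_seq] at hs'
  rw [← hs₁] at hdist hs'
  have f₁ : dist.Frame s s₁ := hs₁ ▸ frame_run _ _
  have hrows₁ := f₁.rows hs (by simp [dist_regs]) (by simp [dist_arrs])
  obtain ⟨D, hD⟩ : ∃ D, D = mat n (s₁.arr 5) := ⟨_, rfl⟩
  rw [← hD] at hdist
  obtain ⟨s₂, hs₂⟩ : ∃ s₂, s₂ = (copy 40 1 1 2).run s₁ := ⟨_, rfl⟩
  have hcopy := marked_copy_run (a := 40) (b := 1) (r := 1) (r' := 2) hrows₁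
    (by simp) (by simp) (by simp) (by simp) (by simp)
  rw [← hs₂] at hcopy hs'
  have f₂ : (copy 40 1 1 2).Frame s₁ s₂ := hs₂ ▸ frame_run _ _
  have hrows₂ := f₂.rows hrows₁ (by simp [copy, fill, regs]) (by simp [copy, fill, arrs])
  obtain ⟨s₃, hs₃⟩ : ∃ s₃, s₃ = (fill 41 (.const 0) 1 2).run s₂ := ⟨_, rfl⟩
  have hfill := fill_run (a := 41) (e := .const 0) (r := 1) (r' := 2) hrows₂ (by simp) (by simp)
    (by simp) (by simp) (fun _ _ => 0) (fun _ _ _ _ _ _ _ _ _ => rfl)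
  rw [← hs₃] at hfill hs'
  have f₃ : (fill 41 (.const 0) 1 2).Frame s₂ s₃ := hs₃ ▸ frame_run _ _
  have hrows₃ := f₃.rows hrows₂ (by simp [fill, regs]) (by simp [fill, arrs])
  have g₃ : s₃.reg 6 = r := by
    rw [f₃.1 6 (by simp [fill, regs]), f₂.1 6 (by simp [copy, fill, regs]),
      f₁.1 6 (by simp [dist_regs]), h6]
  have a₃ : ∀ x, x ≠ 5 → x ≠ 40 → x ≠ 41 → s₃.arr x = s.arr x := fun x h5 h40 h41 => by
    rw [f₃.2 x (by simp [fill, arrs, h41]), f₂.2 x (by simp [copy, fill, arrs, h40]),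
      f₁.2 x (by simp [dist_arrs, h5])]
  have hD₃ : mat n (s₃.arr 5) = D := by
    rw [f₃.2 5 (by simp [fill, arrs]), f₂.2 5 (by simp [copy, fill, arrs]), hD]
  have hX₃ : marked n (s₃.arr 40) = marked n (s.arr 1) := by
    rw [f₃.2 40 (by simp [fill, arrs]), hcopy, f₁.2 1 (by simp [dist_arrs])]
  have hM₃ : markedPairs n (s₃.arr 41) = ∅ := by
    refine Finset.eq_empty_of_forall_notMem fun p hp => ?_
    have := mem_markedPairs.1 hp
    exact this.2 (hfill _ this.1.1 _ this.1.2)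
  obtain ⟨s₄, hs₄⟩ : ∃ s₄, s₄ = s₃.setReg 40 r := ⟨_, rfl⟩
  have hrun₄ : (assign 40 (.reg 6)).run s₃ = s₄ := by rw [hs₄]; simp [run, Expr.eval, g₃]
  rw [hrun₄] at hs'
  have ha₄ : s₄.arr = s₃.arr := by rw [hs₄]; rfl
  have hrows₄ : Rows n s₄ := hrows₃.congr (by simp [hs₄]) (by rw [ha₄])
  obtain ⟨s₅, hs₅⟩ : ∃ s₅, s₅ = (iter 7 (block i 0)).run s₄ := ⟨_, rfl⟩
  have hmain := iter_block_run (i := i) (c := c) (q := q) hrows₄ (by rw [ha₄]; exact hD₃) hdist hr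
    (by simp [hs₄]) (by rw [ha₄]; exact hX₃) (by rw [ha₄]; exact hM₃) htree hq
  rw [← hs₅] at hmain hs'
  have f₅ : (iter 7 (block i 0)).Frame s₄ s₅ := hs₅ ▸ frame_run _ _
  have hA₅ : ∀ x < 40, s₅.arr x = s₃.arr x := fun x hx => by
    rw [f₅.2 x (fun h => by have := block_arrs h; omega), ha₄]
  have hrows₅ := f₅.rows hrows₄ (by
    intro h
    simp only [regs, Finset.mem_insert] at h
    rcases h with h | h
    · omega
    · have := block_regs h; omega) (fun h => by have := block_arrs h; omega)
  obtain ⟨s₆, hs₆⟩ : ∃ s₆, s₆ = (fill 6 (.const 0) 1 2).run s₅ := ⟨_, rfl⟩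
  have hfill₆ := fill_run (a := 6) (e := .const 0) (r := 1) (r' := 2) hrows₅ (by simp) (by simp)
    (by simp) (by simp) (fun _ _ => 0) (fun _ _ _ _ _ _ _ _ _ => rfl)
  rw [← hs₆] at hfill₆ hs'
  have f₆ : (fill 6 (.const 0) 1 2).Frame s₅ s₆ := hs₆ ▸ frame_run _ _
  have hrows₆ := f₆.rows hrows₅ (by simp [fill, regs]) (by simp [fill, arrs])
  have h6e : markedPairs n (s₆.arr 6) = ∅ := by
    refine Finset.eq_empty_of_forall_notMem fun p hp => ?_
    have := mem_markedPairs.1 hp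
    exact this.2 (hfill₆ _ this.1.1 _ this.1.2)
  have a₆ : ∀ x, x ≠ 6 → s₆.arr x = s₅.arr x := fun x h => f₆.2 x (by simp [fill, arrs, h])
  have hend := iter_walk_run (M := markedPairs n (s₅.arr 41)) (G := graph n (s.arr 4)) (D := D)
    hrows₆ (by rw [a₆ 4 (by simp), hA₅ 4 (by simp), a₃ 4 (by simp) (by simp) (by simp)])
    (by rw [a₆ 5 (by simp), hA₅ 5 (by simp), hD₃]) hdist (by rw [a₆ 41 (by simp)]) hmain.1 h6e
  rw [← hs'] at hend
  refine ⟨fun p hp => hend.1 p hp, fun t ht => ?_, ?_⟩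
  · have h1 := hmain.2.1 t ht
    clear ht
    induction h1 with
    | refl => exact .refl
    | tail _ h ih => exact ih.trans (hend.2.2 _ h)
  · have : ((markedPairs n (s'.arr 6)).card : ℝ) ≤ weight D (markedPairs n (s₅.arr 41)) := by
      exact_mod_cast hend.2.1
    exact this.trans hmain.2.2

end Cmd

end RAM

/-! ### Exhaustive search for small solutions -/

namespace SCSS

/-- `F` leads from every vertex of `T` to every vertex of `T`. -/
def Connects (T : Finset ℕ) (F : Finset (ℕ × ℕ)) : Prop := ∀ s ∈ T, ∀ t ∈ T, Reach F s t

/-- The converse of `lt_of_reach`: with both, D u v < n is a test for reachability. -/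
theorem IsDist.reach {G : ℕ → ℕ → Prop} {n : ℕ} {D : ℕ → ℕ → ℕ} (hD : IsDist G n D) {v : ℕ}
    (hv : v < n) : ∀ m u, u < n → D u v = m → m < n → Relation.ReflTransGen G u v := by
  intro m
  induction m with
  | zero => intro u hu h _; rw [hD.eq_of_zero u hu v hv h]
  | succ m ih =>
    intro u hu h hm
    obtain ⟨w, hw, hwv⟩ := hD.step u hu v hv (by omega) (by omega)
    exact .head hw (ih w (hD.bound _ _ hw).2 (by omega) (by omega))

end SCSS

namespace RAM

open SCSS

namespace Cmd

/-- Set `reg 10` to `0` if and only if the digraph in array `4` connects the vertices in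
array `1`. -/
def check : Cmd :=
  dist ;; assign 10 (.const 0) ;;
  iter 1 (iter 2 (cond (.and (.and (.arr 1 (.reg 1)) (.arr 1 (.reg 2)))
    (.eq (.sub (.reg 0) (.arr 5 (.idx 1 2))) (.const 0))) (assign 10 (.const 1)) skip))

/-- If `reg 11` is zero, then check the digraph in array `4`, and if it is a solution, copy it to
array `2` and set `reg 11` to `1`. -/
def tryGraph : Cmd :=
  check ;; cond (.reg 10) skip (cond (.reg 11) skip (copy 2 4 1 2 ;; assign 11 (.const 1)))

/-- Try all ways of adding `c` arcs of the digraph in array `0` to the digraph in array `4`. -/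
def extend : ℕ → Cmd
  | 0 => tryGraph
  | c + 1 => iter (12 + 2 * c) (iter (13 + 2 * c)
      (cond (.arr 0 (.idx (12 + 2 * c) (13 + 2 * c)))
        (cond (.arr 4 (.idx (12 + 2 * c) (13 + 2 * c))) skip
          (store 4 (.idx (12 + 2 * c) (13 + 2 * c)) (.const 1) ;; extend c ;;
            store 4 (.idx (12 + 2 * c) (13 + 2 * c)) (.const 0))) skip))

/-- Try all subgraphs with at most `C` arcs in the order of their size. -/
def tryAll : ℕ → Cmd
  | 0 => extend 0
  | C + 1 => tryAll C ;; extend (C + 1)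

theorem check_regs : check.regs = {1, 2, 3, 4, 5, 10} := by decide
theorem check_arrs : check.arrs = {5} := by decide
theorem check_wf : check.WF := by simp [check, WF, regs, dist_wf]
theorem tryGraph_regs : tryGraph.regs = {1, 2, 3, 4, 5, 10, 11} := by decide
theorem tryGraph_arrs : tryGraph.arrs = {2, 5} := by decide

theorem extend_regs : ∀ {c x : ℕ}, x ∈ (extend c).regs → 1 ≤ x ∧ x < 12 + 2 * c
  | 0, x, h => by simp [extend, tryGraph_regs] at h; omega
  | c + 1, x, h => by
    have ih := @extend_regs c x
    simp [extend, regs] at h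
    by_cases hx : x ∈ (extend c).regs
    · have := ih hx; omega
    · simp [hx] at h; omega

theorem extend_arrs : ∀ {c x : ℕ}, x ∈ (extend c).arrs → x = 2 ∨ x = 4 ∨ x = 5
  | 0, x, h => by simp [extend, tryGraph_arrs] at h; omega
  | c + 1, x, h => by
    have ih := @extend_arrs c x
    simp [extend, arrs] at h
    by_cases hx : x ∈ (extend c).arrs
    · exact ih hx
    · simp [hx] at h; omega

theorem extend_wf : ∀ c : ℕ, (extend c).WF
  | 0 => by simp [extend, tryGraph, WF, copy, fill, regs, check_wf]
  | c + 1 => by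
    have ih := extend_wf c
    have h1 : 12 + 2 * c ∉ (extend c).regs := fun h => by have := extend_regs h; omega
    have h2 : 13 + 2 * c ∉ (extend c).regs := fun h => by have := extend_regs h; omega
    have h3 : 0 ∉ (extend c).regs := fun h => by have := extend_regs h; omega
    have h5 : 0 ≠ 13 + 2 * c := by omega
    simp [extend, WF, regs, ih, h1, h2, h3, h5]

theorem tryAll_regs : ∀ {C x : ℕ}, x ∈ (tryAll C).regs → 1 ≤ x
  | 0, _, h => (extend_regs h).1
  | C + 1, _, h => by
    simp only [tryAll, regs, Finset.mem_union] at h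
    exact h.elim tryAll_regs fun h => (extend_regs h).1

theorem tryAll_arrs : ∀ {C x : ℕ}, x ∈ (tryAll C).arrs → x = 2 ∨ x = 4 ∨ x = 5
  | 0, _, h => extend_arrs h
  | C + 1, _, h => by
    simp only [tryAll, arrs, Finset.mem_union] at h
    exact h.elim tryAll_arrs extend_arrs

theorem tryAll_wf : ∀ C : ℕ, (tryAll C).WF
  | 0 => extend_wf 0
  | C + 1 => ⟨tryAll_wf C, extend_wf _⟩

theorem check_run {n : ℕ} {s : State} (hs : Rows n s) :
    (check.run s).reg 10 = 0 ↔ Connects (marked n (s.arr 1)) (markedPairs n (s.arr 4)) := by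
  have hdist := dist_run hs
  obtain ⟨s₁, hs₁⟩ : ∃ s₁, s₁ = dist.run s := ⟨_, rfl⟩
  simp only [check, run_seq]
  rw [← hs₁] at hdist ⊢
  have f₁ : dist.Frame s s₁ := hs₁ ▸ frame_run _ _
  have hrows₁ := f₁.rows hs (by simp [dist_regs]) (by simp [dist_arrs])
  have h1 := f₁.2 1 (by simp [dist_arrs])
  obtain ⟨D, hD⟩ : ∃ D, D = mat n (s₁.arr 5) := ⟨_, rfl⟩
  rw [← hD] at hdist
  have hstart : (assign 10 (.const 0)).run s₁ = s₁.setReg 10 0 := rfl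
  rw [hstart]
  have hrows₂ : Rows n (s₁.setReg 10 0) := hrows₁.congr (by simp) rfl
  have hloop := iter_iter_rule (r := 1) (r' := 2)
    (p := cond (.and (.and (.arr 1 (.reg 1)) (.arr 1 (.reg 2)))
      (.eq (.sub (.reg 0) (.arr 5 (.idx 1 2))) (.const 0))) (assign 10 (.const 1)) skip) hrows₂.1
    (by simp) (by simp [regs]) (by simp [regs]) (by simp) (by simp)
    (fun k s' => s'.reg 10 = 0 ↔ ∀ u ∈ marked n (s.arr 1), ∀ v ∈ marked n (s.arr 1),
      u * n + v < k → D u v < n)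
    (fun _ _ _ h => by simpa using h) (fun _ _ _ h => by simpa using h) (by simp) (by
      intro u v s' hu hv hr1 hr2 hf h
      have hrows := hf.rows hrows₂ (by simp [regs]) (by simp [arrs])
      have h1' := (hf.2 1 (by simp [arrs])).trans h1
      have h5' : s'.arr 5 = s₁.arr 5 := hf.2 5 (by simp [arrs])
      have hDuv : s₁.arr 5 (u * n + v) = D u v := by rw [hD]; rfl
      have hc : (Expr.and (.and (.arr 1 (.reg 1)) (.arr 1 (.reg 2)))
          (.eq (.sub (.reg 0) (.arr 5 (.idx 1 2))) (.const 0))).eval s' ≠ 0 ↔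
          u ∈ marked n (s.arr 1) ∧ v ∈ marked n (s.arr 1) ∧ ¬ D u v < n := by
        rw [Expr.eval_and, Expr.eval_and, Expr.eval_eq]
        simp only [Expr.eval, hrows.eval_idx (r := 1) (r' := 2) (by omega), hrows.1, hr1, hr2, h1',
          h5', hDuv, mem_marked, hu, hv, true_and, and_assoc, not_lt, Nat.sub_eq_zero_iff_le]
      have hnext : ∀ u' ∈ marked n (s.arr 1), ∀ v' ∈ marked n (s.arr 1),
          (u' * n + v' < u * n + v + 1 ↔ u' * n + v' < u * n + v ∨ (u' = u ∧ v' = v)) := by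
        intro u' _ v' hv'
        rw [← idx_inj (mem_marked.1 hv').1 hv]
        omega
      rw [run]
      split_ifs with h0 <;> rw [hc] at h0
      · refine iff_of_false (by simp [run, Expr.eval]) fun hall => h0.2.2 ?_
        exact hall u h0.1 v h0.2.1 (by omega)
      · rw [run, h]
        refine ⟨fun hall u' hu' v' hv' hlt => ?_, fun hall u' hu' v' hv' hlt =>
          hall u' hu' v' hv' (by omega)⟩
        rcases (hnext u' hu' v' hv').1 hlt with hlt | ⟨rfl, rfl⟩
        · exact hall u' hu' v' hv' hlt
        · by_contra hcon
          exact h0 ⟨hu', hv', hcon⟩)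
  rw [hloop]
  constructor
  · intro hall u hu v hv
    have hu' := (mem_marked.1 hu).1
    have hv' := (mem_marked.1 hv).1
    exact hdist.reach hv' _ u hu' rfl (hall u hu v hv (idx_lt hu' hv'))
  · intro hall u hu v hv _
    exact hdist.lt_of_reach u v (mem_marked.1 hv).1 (hall u hu v hv)

/-- `F` is a solution with `k` arcs that contains `F₀`. -/
def IsExtension (E : Finset (ℕ × ℕ)) (T : Finset ℕ) (F₀ : Finset (ℕ × ℕ)) (k : ℕ)
    (F : Finset (ℕ × ℕ)) : Prop :=
  F₀ ⊆ F ∧ F ⊆ E ∧ F.card = k ∧ Connects T F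

/-- The effect of looking for a set of pairs with the property `P`: `reg 11` tells whether one was
found before in `s` or is found in `s'`, and array `2` holds it. -/
def Finds (n : ℕ) (P : Finset (ℕ × ℕ) → Prop) (s s' : State) : Prop :=
  (s.reg 11 ≠ 0 ∧ s'.reg 11 ≠ 0 ∧ s'.arr 2 = s.arr 2) ∨
    (s.reg 11 = 0 ∧ s'.reg 11 = 0 ∧ ∀ F, ¬ P F) ∨
    (s.reg 11 = 0 ∧ s'.reg 11 ≠ 0 ∧ P (markedPairs n (s'.arr 2)))

/-- The only set of |F₀| pairs that contains F₀ is F₀ itself, so testing F₀ decides whether such an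
extension exists. -/
theorem tryGraph_run {n : ℕ} {s : State} {E F₀ : Finset (ℕ × ℕ)} {T : Finset ℕ} (hs : Rows n s)
    (hT : marked n (s.arr 1) = T) (hF : markedPairs n (s.arr 4) = F₀) (hFE : F₀ ⊆ E) :
    Finds n (IsExtension E T F₀ F₀.card) s (tryGraph.run s) := by
  have hcheck := check_run hs
  obtain ⟨s₁, hs₁⟩ : ∃ s₁, s₁ = check.run s := ⟨_, rfl⟩
  rw [tryGraph, run_seq]
  rw [← hs₁, hT, hF] at hcheck
  rw [← hs₁]
  have f₁ : check.Frame s s₁ := hs₁ ▸ frame_run _ _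
  have hrows₁ := f₁.rows hs (by simp [check_regs]) (by simp [check_arrs])
  have h11 := f₁.1 11 (by simp [check_regs])
  have h2 := f₁.2 2 (by simp [check_arrs])
  have h4 := f₁.2 4 (by simp [check_arrs])
  rw [run]
  split_ifs with h0
  · rw [run]
    by_cases h : s.reg 11 = 0
    · refine .inr (.inl ⟨h, by rw [h11, h], fun F hF' => h0 (hcheck.2 ?_)⟩)
      rw [Finset.eq_of_subset_of_card_le hF'.1 hF'.2.2.1.le]
      exact hF'.2.2.2
    · exact .inl ⟨h, by rwa [h11], h2⟩
  · rw [run]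
    split_ifs with h1
    · rw [run]
      exact .inl ⟨by rwa [← h11], h1, h2⟩
    · refine .inr (.inr ⟨by rw [← h11]; exact not_not.1 h1, by simp [run, Expr.eval], ?_⟩)
      rw [run_seq, run, State.setReg_arr, markedPairs_copy_run hrows₁ (by simp) (by simp) (by simp)
        (by simp) (by simp), h4, hF]
      exact ⟨subset_rfl, hFE, rfl, hcheck.1 (not_not.1 h0)⟩

/-- Backtracking: an extension by c + 1 arcs is a choice of one new arc followed by an extension of
the enlarged set by c arcs. The arc is removed after the recursive call, so array `4` is restored;
once `reg 11` is nonzero, array `2` is no longer changed. -/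
theorem extend_run {n : ℕ} {E : Finset (ℕ × ℕ)} {T : Finset ℕ} : ∀ (c : ℕ) {s : State}
    {F₀ : Finset (ℕ × ℕ)}, Rows n s → markedPairs n (s.arr 0) = E → marked n (s.arr 1) = T →
    markedPairs n (s.arr 4) = F₀ → F₀ ⊆ E →
    markedPairs n (((extend c).run s).arr 4) = F₀ ∧
      Finds n (IsExtension E T F₀ (F₀.card + c)) s ((extend c).run s)
  | 0, s, F₀, hs, hE, hT, hF, hFE =>
    ⟨by rw [extend, run_arr _ _ (by simp [tryGraph_arrs]), hF], tryGraph_run hs hT hF hFE⟩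
  | c + 1, s, F₀, hs, hE, hT, hF, hFE => by
    have hr1 : 12 + 2 * c ∉ (extend c).regs := fun h => by have := extend_regs h; omega
    have hr2 : 13 + 2 * c ∉ (extend c).regs := fun h => by have := extend_regs h; omega
    have hr0 : 0 ∉ (extend c).regs := fun h => by have := extend_regs h; omega
    have ha0 : 0 ∉ (extend c).arrs := fun h => by have := extend_arrs h; omega
    have ha1 : 1 ∉ (extend c).arrs := fun h => by have := extend_arrs h; omega
    have ha3 : 3 ∉ (extend c).arrs := fun h => by have := extend_arrs h; omega
    have hE2 : ∀ p ∈ E, p.2 < n := fun p hp => by rw [← hE] at hp; exact (mem_markedPairs.1 hp).1.2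
    have hE1 : ∀ p ∈ E, p.1 < n := fun p hp => by rw [← hE] at hp; exact (mem_markedPairs.1 hp).1.1
    obtain ⟨P, hP⟩ : ∃ P, P = IsExtension E T F₀ (F₀.card + (c + 1)) := ⟨_, rfl⟩
    have hloop := iter_iter_rule (r := 12 + 2 * c) (r' := 13 + 2 * c)
      (p := cond (.arr 0 (.idx (12 + 2 * c) (13 + 2 * c)))
        (cond (.arr 4 (.idx (12 + 2 * c) (13 + 2 * c))) skip
          (store 4 (.idx (12 + 2 * c) (13 + 2 * c)) (.const 1) ;; extend c ;;
            store 4 (.idx (12 + 2 * c) (13 + 2 * c)) (.const 0))) skip) hs.1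
      (by omega) (by simp [regs, hr1]) (by simp [regs, hr0]) (by omega) (by omega)
      -- After k entries of the matrix, the search is complete for those extensions that have a new
      -- arc with index below k.
      (fun k s' => markedPairs n (s'.arr 4) = F₀ ∧
        Finds n (fun F => P F ∧ ∃ p ∈ F, p ∉ F₀ ∧ p.1 * n + p.2 < k) s s')
      (fun k s' x h => by
        have : 11 ≠ 12 + 2 * c := by omega
        simpa [Finds, this] using h)
      (fun k s' x h => by
        have : 11 ≠ 13 + 2 * c := by omega
        simpa [Finds, this] using h)
      ⟨hF, by
        by_cases h : s.reg 11 = 0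
        · exact .inr (.inl ⟨h, h, by simp⟩)
        · exact .inl ⟨h, h, rfl⟩⟩ (by
        rintro u v s' hu hv hru hrv hf ⟨h4, hfind⟩
        have hrows := hf.rows hs (by simp [regs, hr0]; omega) (by simp [arrs, ha3])
        have h0' := hf.2 0 (by simp [arrs, ha0])
        have h1' := hf.2 1 (by simp [arrs, ha1])
        have hidx : ∀ s'' : State, Rows n s'' → s''.reg (12 + 2 * c) = u →
            s''.reg (13 + 2 * c) = v →
            (Expr.idx (12 + 2 * c) (13 + 2 * c)).eval s'' = u * n + v := by
          intro s'' h ha hb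
          rw [h.eval_idx (by omega), ha, hb]
        have hnext : ∀ p ∈ E, p.1 * n + p.2 < u * n + v + 1 →
            p.1 * n + p.2 < u * n + v ∨ p = (u, v) := by
          intro p hp hlt
          rw [Prod.ext_iff, ← idx_inj (hE2 p hp) hv]
          dsimp only
          omega
        have hc0 : (Expr.arr 0 (.idx (12 + 2 * c) (13 + 2 * c))).eval s' ≠ 0 ↔ (u, v) ∈ E := by
          rw [Expr.eval, hidx s' hrows hru hrv, h0', ← hE, mem_markedPairs]; simp [hu, hv]
        have hc4 : (Expr.arr 4 (.idx (12 + 2 * c) (13 + 2 * c))).eval s' ≠ 0 ↔ (u, v) ∈ F₀ := by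
          rw [Expr.eval, hidx s' hrows hru hrv, ← h4, mem_markedPairs]; simp [hu, hv]
        have hsame : ((u, v) ∈ E → (u, v) ∈ F₀) → Finds n (fun F => P F ∧
            ∃ p ∈ F, p ∉ F₀ ∧ p.1 * n + p.2 < u * n + v + 1) s s' := by
          intro huv
          rcases hfind with h | ⟨ha, hb, hno⟩ | ⟨ha, hb, hyes, p, hp, hp0, hlt⟩
          · exact .inl h
          · refine .inr (.inl ⟨ha, hb, ?_⟩)
            rintro F ⟨hPF, p, hp, hp0, hlt⟩
            have hpE : p ∈ E := by rw [hP] at hPF; exact hPF.2.1 hp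
            rcases hnext p hpE hlt with hlt | rfl
            · exact hno F ⟨hPF, p, hp, hp0, hlt⟩
            · exact hp0 (huv hpE)
          · exact .inr (.inr ⟨ha, hb, hyes, p, hp, hp0, by omega⟩)
        rw [run]
        split_ifs with hif0 <;> rw [hc0] at hif0
        · rw [run]
          split_ifs with hif4 <;> rw [hc4] at hif4
          · exact ⟨h4, hsame fun _ => hif4⟩
          · have hrun₁ : (store 4 (.idx (12 + 2 * c) (13 + 2 * c)) (.const 1)).run s' =
                s'.setArr 4 (u * n + v) 1 := by rw [run, hidx s' hrows hru hrv]; rfl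
            simp only [run_seq]
            rw [hrun₁]
            have hrows₁ : Rows n (s'.setArr 4 (u * n + v) 1) := hrows.congr rfl (by simp)
            have hcard := Finset.card_insert_of_notMem hif4
            obtain ⟨he4, hefind⟩ := extend_run (E := E) (T := T) c
              (s := s'.setArr 4 (u * n + v) 1) (F₀ := insert (u, v) F₀) hrows₁ (by simp [h0', hE]) (by simp [h1', hT])
              (by simp only [State.setArr_arr, if_true]
                  rw [markedPairs_update hu hv (by simp), h4])
              (Finset.insert_subset hif0 hFE)
            obtain ⟨s₂, hs₂⟩ : ∃ s₂, s₂ = (extend c).run (s'.setArr 4 (u * n + v) 1) := ⟨_, rfl⟩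
            rw [← hs₂] at he4 hefind ⊢
            have f₂ : (extend c).Frame (s'.setArr 4 (u * n + v) 1) s₂ := hs₂ ▸ frame_run _ _
            have hrows₂ := f₂.rows hrows₁ hr0 ha3
            have hrun₃ : (store 4 (.idx (12 + 2 * c) (13 + 2 * c)) (.const 0)).run s₂ =
                s₂.setArr 4 (u * n + v) 0 := by
              rw [run, hidx s₂ hrows₂ ((f₂.1 _ hr1).trans hru) ((f₂.1 _ hr2).trans hrv)]; rfl
            rw [hrun₃]
            refine ⟨?_, ?_⟩
            · simp only [State.setArr_arr, if_true]
              rw [markedPairs_update_zero hv, he4, Finset.erase_insert hif4]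
            · have h24 : ((2 : ℕ) = 4) = False := by simp
              simp only [Finds, State.setArr_reg, State.setArr_arr, h24, if_false] at hefind ⊢
              rcases hfind with ⟨ha, hb, hsm⟩ | ⟨ha, hb, hno⟩ | ⟨ha, hb, hyes, p, hp, hp0, hlt⟩
              · left
                rcases hefind with h | h | h
                · exact ⟨ha, h.2.1, h.2.2.trans hsm⟩
                · exact absurd h.1 hb
                · exact absurd h.1 hb
              · right
                rcases hefind with h | h | h
                · exact absurd hb h.1
                · refine .inl ⟨ha, h.2.1, ?_⟩
                  rintro F ⟨hPF, p, hp, hp0, hlt⟩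
                  have hPF' := hPF
                  rw [hP] at hPF'
                  rcases hnext p (hPF'.2.1 hp) hlt with hlt | rfl
                  · exact hno F ⟨hPF, p, hp, hp0, hlt⟩
                  · exact h.2.2 F ⟨Finset.insert_subset hp hPF'.1, hPF'.2.1, by
                      rw [hPF'.2.2.1, hcard]; omega, hPF'.2.2.2⟩
                · obtain ⟨h1, h2, h3, h5, h6, h7⟩ := h
                  refine .inr ⟨ha, h2, ?_, (u, v), h3 (Finset.mem_insert_self _ _), hif4, by
                    dsimp only; omega⟩
                  rw [hP]
                  exact ⟨(Finset.subset_insert _ _).trans h3, h5, by rw [h6, hcard]; omega, h7⟩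
              · right; right
                rcases hefind with h | h | h
                · rw [h.2.2]
                  exact ⟨ha, h.2.1, hyes, p, hp, hp0, by omega⟩
                · exact absurd h.1 hb
                · exact absurd h.1 hb
        · rw [run]
          exact ⟨h4, hsame fun h => absurd h hif0⟩)
    rw [extend]
    refine ⟨hloop.1, ?_⟩
    rw [← hP]
    rcases hloop.2 with h | ⟨ha, hb, hno⟩ | ⟨ha, hb, hyes, -⟩
    · exact .inl h
    · refine .inr (.inl ⟨ha, hb, fun F hPF => ?_⟩)
      have hPF' := hPF
      rw [hP] at hPF'
      obtain ⟨h1, h2, h3, -⟩ := hPF'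
      -- An extension by at least one arc has some new arc, and its index is below n * n; so the
      -- finished loop has dealt with every extension.
      obtain ⟨p, hp, hp0⟩ := Finset.exists_mem_notMem_of_card_lt_card
        (show F₀.card < F.card by omega)
      exact hno F ⟨hPF, p, hp, hp0, idx_lt (hE1 p (h2 hp)) (hE2 p (h2 hp))⟩
    · exact .inr (.inr ⟨ha, hb, hyes⟩)

/-- The sizes are tried in increasing order and the first success is kept, so a solution found has
minimum size, and failure excludes all solutions with at most C arcs. -/
theorem tryAll_run {n : ℕ} {s : State} {E : Finset (ℕ × ℕ)} {T : Finset ℕ} (hs : Rows n s)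
    (hE : markedPairs n (s.arr 0) = E) (hT : marked n (s.arr 1) = T)
    (h4 : markedPairs n (s.arr 4) = ∅) (h11 : s.reg 11 = 0) (C : ℕ) :
    markedPairs n (((tryAll C).run s).arr 4) = ∅ ∧
    ((((tryAll C).run s).reg 11 = 0 ∧ ∀ F ⊆ E, Connects T F → C < F.card) ∨
      (((tryAll C).run s).reg 11 ≠ 0 ∧ markedPairs n (((tryAll C).run s).arr 2) ⊆ E ∧
        Connects T (markedPairs n (((tryAll C).run s).arr 2)) ∧
        ∀ F ⊆ E, Connects T F → (markedPairs n (((tryAll C).run s).arr 2)).card ≤ F.card)) := by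
  induction C with
  | zero =>
    obtain ⟨h1, h2⟩ := extend_run 0 hs hE hT h4 (by simp)
    refine ⟨h1, ?_⟩
    rcases h2 with h | ⟨-, hb, hno⟩ | ⟨-, hb, h3, h5, h6, h7⟩
    · exact absurd h11 h.1
    · refine .inl ⟨hb, fun F hF hc => Nat.pos_of_ne_zero fun h0 => hno F ⟨by simp, hF, by
        simpa using h0, hc⟩⟩
    · refine .inr ⟨hb, h5, h7, fun F _ _ => ?_⟩
      rw [tryAll, h6]; simp
  | succ C ih =>
    obtain ⟨ih4, ih⟩ := ih
    obtain ⟨s₁, hs₁⟩ : ∃ s₁, s₁ = (tryAll C).run s := ⟨_, rfl⟩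
    simp only [tryAll, run_seq]
    rw [← hs₁] at ih4 ih ⊢
    have f₁ : (tryAll C).Frame s s₁ := hs₁ ▸ frame_run _ _
    have hA : ∀ x, x ≠ 2 → x ≠ 4 → x ≠ 5 → s₁.arr x = s.arr x := fun x h2 h4 h5 =>
      f₁.2 x fun h => by have := tryAll_arrs h; omega
    have hrows₁ := f₁.rows hs (fun h => by have := tryAll_regs h; omega)
      (fun h => by have := tryAll_arrs h; omega)
    obtain ⟨h1, h2⟩ := extend_run (C + 1) hrows₁ (by rw [hA 0 (by simp) (by simp) (by simp), hE])
      (by rw [hA 1 (by simp) (by simp) (by simp), hT]) ih4 (Finset.empty_subset E)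
    refine ⟨h1, ?_⟩
    rcases h2 with ⟨ha, hb, h3⟩ | ⟨ha, hb, hno⟩ | ⟨ha, hb, h3, h5, h6, h7⟩
    · right
      rw [h3]
      exact ⟨hb, (ih.resolve_left fun h => ha h.1).2⟩
    · left
      refine ⟨hb, fun F hF hc => ?_⟩
      have := (ih.resolve_right fun h => h.1 ha).2 F hF hc
      have : F.card ≠ C + 1 := fun h => hno F ⟨by simp, hF, by simpa using h, hc⟩
      omega
    · refine .inr ⟨hb, h5, h7, fun F hF hc => ?_⟩
      have := (ih.resolve_right fun h => h.1 ha).2 F hF hc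
      simp only [Finset.card_empty, Nat.zero_add] at h6
      omega

end Cmd

end RAM

/-! ### The complete algorithm -/

namespace RAM

open SCSS

namespace Cmd

/-- Combine an approximate tree from a root to all vertices in array `1` and one to the root from
all of them. -/
def approx (i : ℕ) : Cmd :=
  search 1 6 (.arr 1 (.reg 1)) ;; assign 6 (.sub (.reg 6) (.const 1)) ;;
  copy 4 0 1 2 ;; outTree i ;; copy 7 6 1 2 ;;
  fill 4 (.arr 0 (.idx 2 1)) 1 2 ;; outTree i ;;
  fill 2 (.add (.arr 7 (.idx 1 2)) (.arr 6 (.idx 2 1))) 1 2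

/-- The whole algorithm. -/
def algorithm (i C : ℕ) : Cmd :=
  iter 1 (store 3 (.reg 1) (.reg 2) ;; assign 2 (.add (.reg 2) (.reg 0))) ;;
  tryAll C ;; cond (.reg 11) skip (approx i)

theorem algorithm_wf (i C : ℕ) : (algorithm i C).WF := by
  simp [algorithm, approx, WF, regs, copy, fill, search, tryAll_wf, outTree_wf]

theorem algorithm_regs (i C : ℕ) : 0 ∉ (algorithm i C).regs := by
  have h1 : 0 ∉ (tryAll C).regs := fun h => by have := tryAll_regs h; omega
  have h2 : 0 ∉ (outTree i).regs := fun h => by have := outTree_regs h; omega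
  simp [algorithm, approx, regs, copy, fill, search, h1, h2]

theorem rows_run {n : ℕ} {s : State} (hn : s.reg 0 = n) (h2 : s.reg 2 = 0) :
    Rows n ((iter 1 (store 3 (.reg 1) (.reg 2) ;; assign 2 (.add (.reg 2) (.reg 0)))).run s) := by
  have := iter_rule (r := 1) (p := store 3 (.reg 1) (.reg 2) ;; assign 2 (.add (.reg 2) (.reg 0)))
    hn (fun k s' => s'.reg 2 = k * n ∧ ∀ u < k, s'.arr 3 u = u * n)
    (fun k s' x h => by simpa using h) (by simp [h2]) (by
      rintro j s' hj hr hf ⟨h, h'⟩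
      have h0 : s'.reg 0 = n := (hf.1 0 (by simp [regs])).trans hn
      refine ⟨by simp [run, Expr.eval, h, h0, Nat.succ_mul], fun u hu => ?_⟩
      simp only [run, Expr.eval, State.setReg_arr, State.setArr_arr, if_true, hr, h,
        Function.update_apply]
      split_ifs with hu'
      · rw [hu']
      · exact h' u (by omega))
  exact ⟨(run_reg _ _ (by simp [regs])).trans hn, this.2⟩

/-- By `exists_tree`, any arc set F that reaches the terminals contains a tree with at most |F|
arcs, so the guarantee may be stated relative to |F|. -/
theorem outTree_connects {i n r q : ℕ} {s : State} {F : Finset (ℕ × ℕ)} (hs : Rows n s) (hr : r < n)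
    (h6 : s.reg 6 = r) (hF : F ⊆ markedPairs n (s.arr 4))
    (hreach : ∀ t ∈ marked n (s.arr 1), Reach F r t)
    (hq : (marked n (s.arr 1)).card ≤ q ^ (i + 1)) :
    let O := markedPairs n (((outTree i).run s).arr 6)
    O ⊆ markedPairs n (s.arr 4) ∧ (∀ t ∈ marked n (s.arr 1), Reach O r t) ∧
      (O.card : ℝ) ≤ blockConst i * q * F.card * harmonic (marked n (s.arr 1)).card := by
  obtain ⟨c, hc, htree⟩ := exists_tree hreach
  obtain ⟨h1, h2, h3⟩ := outTree_run hs hr h6 (htree.mono_graph fun u v h => hF h) hq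
  refine ⟨h1, h2, h3.trans ?_⟩
  have hH : (0 : ℝ) ≤ harmonic (marked n (s.arr 1)).card := by
    simp only [harmonic]; push_cast; positivity
  have : (c : ℝ) ≤ F.card := by exact_mod_cast hc
  gcongr

theorem _root_.SCSS.Reach.swap {M M' : Finset (ℕ × ℕ)} (h : ∀ u v, (u, v) ∈ M → (v, u) ∈ M')
    {u v : ℕ} (hr : Reach M u v) : Reach M' v u := by
  induction hr with
  | refl => exact .refl
  | tail _ hab ih => exact .head (h _ _ hab) ih

/-- Any two terminals are connected through r: the in-tree leads from the first to r, the out-tree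
from r to the second. Each tree is compared with F, which gives the factor 2. -/
theorem approx_run {i n q : ℕ} {s : State} {E F : Finset (ℕ × ℕ)} {T : Finset ℕ} (hs : Rows n s)
    (hE : markedPairs n (s.arr 0) = E) (hT : marked n (s.arr 1) = T) (hne : T.Nonempty)
    (hF : F ⊆ E) (hFT : Connects T F) (hq : T.card ≤ q ^ (i + 1)) :
    let O := markedPairs n (((approx i).run s).arr 2)
    O ⊆ E ∧ Connects T O ∧
      (O.card : ℝ) ≤ 2 * (blockConst i * q * F.card * harmonic T.card) := by
  intro O
  obtain ⟨s', hs'⟩ : ∃ s', s' = (approx i).run s := ⟨_, rfl⟩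
  have hO : O = markedPairs n (s'.arr 2) := by rw [hs']
  rw [hO]
  simp only [approx, run_seq] at hs'
  have hsearch := search_run (r := 1) (f := 6) (e := .arr 1 (.reg 1)) hs.1 (by simp) (by simp)
    (fun w => s.arr 1 w ≠ 0) (by
      intro w t hw hr hf
      rw [Expr.eval, Expr.eval, hr, hf.2 1 (by simp [search, arrs])])
  obtain ⟨s₁, hs₁⟩ : ∃ s₁, s₁ = (search 1 6 (.arr 1 (.reg 1))).run s := ⟨_, rfl⟩
  rw [← hs₁] at hsearch hs'
  have f₁ : (search 1 6 (.arr 1 (.reg 1))).Frame s s₁ := hs₁ ▸ frame_run _ _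
  have hrows₁ := f₁.rows hs (by simp [search, regs]) (by simp [search, arrs])
  obtain ⟨r, hr, h6, hTr⟩ := hsearch.resolve_left (fun h => by
    obtain ⟨t, ht⟩ := hne
    rw [← hT, mem_marked] at ht
    exact h.2 t ht.1 ht.2)
  have hrT : r ∈ T := by rw [← hT, mem_marked]; exact ⟨hr, hTr⟩
  have a₁ : s₁.arr = s.arr := funext fun x => f₁.2 x (by simp [search, arrs])
  have hrun₂ : (assign 6 (.sub (.reg 6) (.const 1))).run s₁ = s₁.setReg 6 r := by
    simp [run, Expr.eval, h6]
  rw [hrun₂] at hs'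
  have hrows₂ : Rows n (s₁.setReg 6 r) := hrows₁.congr (by simp) rfl
  obtain ⟨s₃, hs₃⟩ : ∃ s₃, s₃ = (copy 4 0 1 2).run (s₁.setReg 6 r) := ⟨_, rfl⟩
  have hcopy₃ := markedPairs_copy_run (a := 4) (b := 0) (r := 1) (r' := 2) hrows₂
    (by simp) (by simp) (by simp) (by simp) (by simp)
  rw [← hs₃, State.setReg_arr, a₁, hE] at hcopy₃
  rw [← hs₃] at hs'
  have f₃ : (copy 4 0 1 2).Frame (s₁.setReg 6 r) s₃ := hs₃ ▸ frame_run _ _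
  have hrows₃ := f₃.rows hrows₂ (by simp [copy, fill, regs]) (by simp [copy, fill, arrs])
  have h6₃ : s₃.reg 6 = r := by rw [f₃.1 6 (by simp [copy, fill, regs])]; simp
  have a₃ : ∀ x, x ≠ 4 → s₃.arr x = s.arr x := fun x h => by
    rw [f₃.2 x (by simp [copy, fill, arrs, h]), State.setReg_arr, a₁]
  have hT₃ : marked n (s₃.arr 1) = T := by rw [a₃ 1 (by simp), hT]
  have hout₃ := outTree_connects (i := i) (q := q) (F := F) hrows₃ hr h6₃ (by rw [hcopy₃]; exact hF)
    (by rw [hT₃]; exact fun t ht => hFT r hrT t ht) (by rw [hT₃]; exact hq)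
  obtain ⟨s₄, hs₄⟩ : ∃ s₄, s₄ = (outTree i).run s₃ := ⟨_, rfl⟩
  rw [← hs₄] at hs'
  rw [← hs₄, hT₃, hcopy₃] at hout₃
  obtain ⟨ho1, ho2, ho3⟩ := hout₃
  have f₄ : (outTree i).Frame s₃ s₄ := hs₄ ▸ frame_run _ _
  have h6₄ : s₄.reg 6 = r := (f₄.1 6 fun h => by have := outTree_regs h; omega).trans h6₃
  have a₄ : ∀ x, x < 4 → s₄.arr x = s.arr x := fun x h => by
    rw [f₄.2 x fun h => by have := outTree_arrs h; omega, a₃ x (by omega)]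
  have hrows₄ := f₄.rows hrows₃ (fun h => by have := outTree_regs h; omega)
    (fun h => by have := outTree_arrs h; omega)
  obtain ⟨s₅, hs₅⟩ : ∃ s₅, s₅ = (copy 7 6 1 2).run s₄ := ⟨_, rfl⟩
  have hcopy₅ := markedPairs_copy_run (a := 7) (b := 6) (r := 1) (r' := 2) hrows₄
    (by simp) (by simp) (by simp) (by simp) (by simp)
  rw [← hs₅] at hcopy₅ hs'
  have f₅ : (copy 7 6 1 2).Frame s₄ s₅ := hs₅ ▸ frame_run _ _
  have hrows₅ := f₅.rows hrows₄ (by simp [copy, fill, regs]) (by simp [copy, fill, arrs])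
  obtain ⟨s₆, hs₆⟩ : ∃ s₆, s₆ = (fill 4 (.arr 0 (.idx 2 1)) 1 2).run s₅ := ⟨_, rfl⟩
  have hfill₆ := fill_run (a := 4) (e := .arr 0 (.idx 2 1)) (r := 1) (r' := 2) hrows₅
    (by simp) (by simp) (by simp) (by simp) (fun u v => s.arr 0 (v * n + u)) (by
      intro u v t hu hv hru hrv hrows hf
      rw [Expr.eval, hrows.eval_idx (by omega), hru, hrv, hf.2 0 (by simp [fill, arrs]),
        f₅.2 0 (by simp [copy, fill, arrs]), a₄ 0 (by simp)])
  rw [← hs₆] at hfill₆ hs'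
  have f₆ : (fill 4 (.arr 0 (.idx 2 1)) 1 2).Frame s₅ s₆ := hs₆ ▸ frame_run _ _
  have hrows₆ := f₆.rows hrows₅ (by simp [fill, regs]) (by simp [fill, arrs])
  have h6₆ : s₆.reg 6 = r := by
    rw [f₆.1 6 (by simp [fill, regs]), f₅.1 6 (by simp [copy, fill, regs]), h6₄]
  have h7₆ : markedPairs n (s₆.arr 7) = markedPairs n (s₄.arr 6) := by
    rw [f₆.2 7 (by simp [fill, arrs]), hcopy₅]
  have hT₆ : marked n (s₆.arr 1) = T := by
    rw [f₆.2 1 (by simp [fill, arrs]), f₅.2 1 (by simp [copy, fill, arrs]), a₄ 1 (by simp), hT]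
  have hE₆ : ∀ u v, (u, v) ∈ markedPairs n (s₆.arr 4) ↔ (v, u) ∈ E := by
    intro u v
    rw [← hE, mem_markedPairs, mem_markedPairs]
    constructor
    · rintro ⟨h, h'⟩; rw [hfill₆ u h.1 v h.2] at h'; exact ⟨h.symm, h'⟩
    · rintro ⟨h, h'⟩; refine ⟨h.symm, ?_⟩; rw [hfill₆ u h.2 v h.1]; exact h'
  -- An in-tree is an out-tree of the reversed digraph, and the reversal of F, which has the same
  -- size, is the comparison.
  have hout₆ := outTree_connects (i := i) (q := q) (F := F.image Prod.swap) hrows₆ hr h6₆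
    (by
      intro p hp
      obtain ⟨p', hp', rfl⟩ := Finset.mem_image.1 hp
      exact (hE₆ _ _).2 (hF hp'))
    (by
      rw [hT₆]
      exact fun t ht => (hFT t ht r hrT).swap fun u v h => Finset.mem_image_of_mem Prod.swap h)
    (by rw [hT₆]; exact hq)
  obtain ⟨s₇, hs₇⟩ : ∃ s₇, s₇ = (outTree i).run s₆ := ⟨_, rfl⟩
  rw [← hs₇] at hs'
  rw [← hs₇, hT₆, Finset.card_image_of_injective _ Prod.swap_injective] at hout₆
  obtain ⟨hi1, hi2, hi3⟩ := hout₆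
  have f₇ : (outTree i).Frame s₆ s₇ := hs₇ ▸ frame_run _ _
  have hrows₇ := f₇.rows hrows₆ (fun h => by have := outTree_regs h; omega)
    (fun h => by have := outTree_arrs h; omega)
  have h7₇ : markedPairs n (s₇.arr 7) = markedPairs n (s₄.arr 6) := by
    rw [f₇.2 7 fun h => by have := outTree_arrs h; omega, h7₆]
  have hfill := fill_run (a := 2) (e := .add (.arr 7 (.idx 1 2)) (.arr 6 (.idx 2 1))) (r := 1)
    (r' := 2) hrows₇ (by simp) (by simp) (by simp) (by simp)
    (fun u v => s₇.arr 7 (u * n + v) + s₇.arr 6 (v * n + u)) (by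
      intro u v t hu hv hru hrv hrows hf
      rw [Expr.eval, Expr.eval, Expr.eval, hrows.eval_idx (by omega), hrows.eval_idx (by omega), hru,
        hrv, hf.2 7 (by simp [fill, arrs]), hf.2 6 (by simp [fill, arrs])])
  rw [← hs'] at hfill
  have hmem : ∀ u v, (u, v) ∈ markedPairs n (s'.arr 2) ↔
      (u, v) ∈ markedPairs n (s₄.arr 6) ∨ (v, u) ∈ markedPairs n (s₇.arr 6) := by
    intro u v
    rw [← h7₇, mem_markedPairs, mem_markedPairs, mem_markedPairs]
    dsimp only
    by_cases h : u < n ∧ v < n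
    · rw [hfill u h.1 v h.2]
      simp only [h, true_and, and_self, ne_eq, Nat.add_eq_zero_iff, not_and_or]
    · have h' : ¬ (v < n ∧ u < n) := fun h' => h h'.symm
      simp only [h, h', false_and, or_self]
  have hunion : markedPairs n (s'.arr 2) =
      markedPairs n (s₄.arr 6) ∪ (markedPairs n (s₇.arr 6)).image Prod.swap := by
    ext ⟨u, v⟩
    rw [hmem, Finset.mem_union, Finset.mem_image]
    refine or_congr_right ⟨fun h => ⟨_, h, rfl⟩, ?_⟩
    rintro ⟨p, hp, h⟩
    rw [← Prod.swap_swap p, h] at hp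
    exact hp
  refine ⟨?_, ?_, ?_⟩
  · rintro ⟨u, v⟩ hp
    rcases (hmem u v).1 hp with h | h
    · exact ho1 h
    · exact (hE₆ _ _).1 (hi1 h)
  · intro a ha b hb
    have h1 : Reach (markedPairs n (s'.arr 2)) a r :=
      (hi2 a ha).swap fun u v h => (hmem v u).2 (.inr h)
    have h2 : Reach (markedPairs n (s'.arr 2)) r b :=
      (ho2 b hb).mono fun p h => (hmem p.1 p.2).2 (.inl h)
    exact Relation.ReflTransGen.trans h1 h2
  · have h1 : (markedPairs n (s'.arr 2)).card ≤
        (markedPairs n (s₄.arr 6)).card + (markedPairs n (s₇.arr 6)).card := by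
      rw [hunion]
      exact (Finset.card_union_le _ _).trans (Nat.add_le_add_left Finset.card_image_le _)
    have h2 : ((markedPairs n (s'.arr 2)).card : ℝ) ≤
        (markedPairs n (s₄.arr 6)).card + (markedPairs n (s₇.arr 6)).card := by exact_mod_cast h1
    linarith

/-- The combined guarantee of exhaustive search and approximation. -/
theorem algorithm_run {i C n : ℕ} {s : State} {E F : Finset (ℕ × ℕ)} {T : Finset ℕ}
    (hn : s.reg 0 = n) (h2 : s.reg 2 = 0) (h11 : s.reg 11 = 0) (h4 : markedPairs n (s.arr 4) = ∅)
    (hE : markedPairs n (s.arr 0) = E) (hT : marked n (s.arr 1) = T)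
    (hF : F ⊆ E) (hFT : Connects T F) :
    let O := markedPairs n (((algorithm i C).run s).arr 2)
    O ⊆ E ∧ Connects T O ∧ (O.card ≤ F.card ∨ (2 ≤ T.card ∧ (∀ F ⊆ E, Connects T F → C < F.card) ∧
      ∀ q : ℕ, T.card ≤ q ^ (i + 1) →
        (O.card : ℝ) ≤ 2 * (blockConst i * q * F.card * harmonic T.card))) := by
  have hrows := rows_run hn h2
  obtain ⟨s₁, hs₁⟩ : ∃ s₁, s₁ =
    (iter 1 (store 3 (.reg 1) (.reg 2) ;; assign 2 (.add (.reg 2) (.reg 0)))).run s := ⟨_, rfl⟩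
  simp only [algorithm, run_seq]
  rw [← hs₁] at hrows ⊢
  have f₁ : (iter 1 (store 3 (.reg 1) (.reg 2) ;; assign 2 (.add (.reg 2) (.reg 0)))).Frame s s₁ :=
    hs₁ ▸ frame_run _ _
  obtain ⟨-, hall⟩ := tryAll_run (E := E) (T := T) hrows (by rw [f₁.2 0 (by simp [arrs]), hE])
    (by rw [f₁.2 1 (by simp [arrs]), hT]) (by rw [f₁.2 4 (by simp [arrs]), h4])
    (by rw [f₁.1 11 (by simp [regs]), h11]) C
  obtain ⟨s₂, hs₂⟩ : ∃ s₂, s₂ = (tryAll C).run s₁ := ⟨_, rfl⟩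
  rw [← hs₂] at hall ⊢
  have f₂ : (tryAll C).Frame s₁ s₂ := hs₂ ▸ frame_run _ _
  have hrows₂ := f₂.rows hrows (fun h => by have := tryAll_regs h; omega)
    (fun h => by have := tryAll_arrs h; omega)
  have a₂ : ∀ x < 2, s₂.arr x = s.arr x := fun x hx => by
    rw [f₂.2 x fun h => by have := tryAll_arrs h; omega, f₁.2 x (by simp [arrs]; omega)]
  rw [run]
  split_ifs with h0
  · obtain ⟨-, h3, h5, h6⟩ := hall.resolve_left fun h => h0 h.1
    exact ⟨h3, h5, .inl (h6 F hF hFT)⟩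
  · have hno := (hall.resolve_right fun h => h0 h.1).2
    -- With at most one terminal the empty set is a solution, and the exhaustive search would have
    -- found it.
    have hcard : 2 ≤ T.card := by
      by_contra hlt
      have := hno ∅ (by simp) fun u hu v hv => by
        rw [Finset.card_le_one.1 (by omega) u hu v hv]; exact .refl
      simp at this
    have hne : T.Nonempty := Finset.card_pos.1 (by omega)
    have happ := fun q hq => approx_run (i := i) (q := q) (E := E) (F := F) (T := T) hrows₂
      (by rw [a₂ 0 (by simp), hE]) (by rw [a₂ 1 (by simp), hT]) hne hF hFT hq
    -- The value q = |T| is always admissible; it is used only to extract the claims that do not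
    -- involve q.
    have hT1 := happ T.card (Nat.le_self_pow (by omega) _)
    exact ⟨hT1.1, hT1.2.1, .inr ⟨hcard, hno, fun q hq => (happ q hq).2.2⟩⟩

end Cmd

end RAM

/-! ### Transfer to instances and the approximation ratio -/

namespace SCSS

open RAM

/-- A terminal that is reached from a different terminal is the head of an arc of F. This converts a
ratio in |T| into a ratio in OPT. -/
theorem Connects.card_le {T : Finset ℕ} {F : Finset (ℕ × ℕ)} (h : Connects T F) (hT : 2 ≤ T.card) :
    T.card ≤ F.card := by
  have : T ⊆ F.image Prod.snd := by
    intro t ht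
    obtain ⟨s, hs, hst⟩ := Finset.exists_mem_ne (by omega : 1 < T.card) t
    rcases Relation.ReflTransGen.cases_tail (h s hs t ht) with h | ⟨w, -, hw⟩
    · exact absurd h.symm hst
    · exact Finset.mem_image_of_mem Prod.snd hw
  exact (Finset.card_le_card this).trans Finset.card_image_le

/-- A set of pairs of vertices as a set of pairs of natural numbers. -/
def toNat {n : ℕ} (F : Finset (Fin n × Fin n)) : Finset (ℕ × ℕ) :=
  F.image fun p => (p.1.val, p.2.val)

section toNat

variable {n : ℕ} {F : Finset (Fin n × Fin n)}

theorem mem_toNat {u v : Fin n} : (u.val, v.val) ∈ toNat F ↔ (u, v) ∈ F := by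
  simp [toNat, Fin.val_inj]

theorem card_toNat (F : Finset (Fin n × Fin n)) : (toNat F).card = F.card := by
  refine Finset.card_image_of_injective _ fun p q h => ?_
  simp only [Prod.mk.injEq, Fin.val_inj] at h
  exact Prod.ext h.1 h.2

theorem toNat_subset {F' : Finset (Fin n × Fin n)} : toNat F ⊆ toNat F' ↔ F ⊆ F' := by
  refine ⟨fun h p hp => mem_toNat.1 (h (mem_toNat.2 hp)), fun h => Finset.image_subset_image h⟩

theorem hasPath_iff {u v : Fin n} : HasPath F u v ↔ Reach (toNat F) u v := by
  constructor
  · intro h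
    induction h with
    | refl => exact .refl
    | tail _ hab ih => exact .tail ih (mem_toNat.2 hab)
  · intro h
    obtain ⟨w, hw⟩ : ∃ w, w = v.val := ⟨_, rfl⟩
    rw [← hw] at h
    induction h generalizing v with
    | refl => rw [Fin.ext hw]; exact .refl
    | @tail a b _ hab ih =>
      subst hw
      obtain ⟨p, hp, h⟩ := Finset.mem_image.1 hab
      simp only [Prod.mk.injEq] at h
      obtain ⟨h1, h2⟩ := h
      refine Relation.ReflTransGen.tail (ih (v := p.1) h1.symm) ?_
      rw [← Fin.ext h2]
      exact hp

theorem markedPairs_output (n : ℕ) (s : State) : markedPairs n (s.arr 2) = toNat (output n s) := by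
  ext ⟨u, v⟩
  rw [mem_markedPairs]
  constructor
  · rintro ⟨⟨hu, hv⟩, h⟩
    exact mem_toNat (u := ⟨u, hu⟩) (v := ⟨v, hv⟩) |>.2 (by simpa [output] using h)
  · intro h
    obtain ⟨p, hp, hpe⟩ := Finset.mem_image.1 h
    simp only [Prod.mk.injEq] at hpe
    obtain ⟨rfl, rfl⟩ := hpe
    simpa [output] using hp

end toNat

namespace Instance

variable (x : Instance)

theorem markedPairs_input : markedPairs x.n (x.input.arr 0) = toNat x.E := by
  ext ⟨u, v⟩
  rw [mem_markedPairs]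
  simp only [input, if_true]
  constructor
  · rintro ⟨⟨hu, hv⟩, h⟩
    have h' : ∃ u' v' : Fin x.n, (u', v') ∈ x.E ∧ u * x.n + v = u'.val * x.n + v'.val := by
      by_contra hcon
      exact h (if_neg hcon)
    obtain ⟨u', v', he, h⟩ := h'
    obtain ⟨rfl, rfl⟩ := (idx_inj hv v'.2).1 h
    exact mem_toNat.2 he
  · intro h
    obtain ⟨p, hp, hpe⟩ := Finset.mem_image.1 h
    simp only [Prod.mk.injEq] at hpe
    obtain ⟨rfl, rfl⟩ := hpe
    refine ⟨⟨p.1.2, p.2.2⟩, ?_⟩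
    rw [if_pos ⟨p.1, p.2, hp, rfl⟩]
    exact one_ne_zero

theorem marked_input : marked x.n (x.input.arr 1) = x.T.image Fin.val := by
  ext u
  rw [mem_marked, Finset.mem_image]
  simp only [input, one_ne_zero, if_false, if_true]
  constructor
  · rintro ⟨hu, h⟩
    have h' : ∃ u' : Fin x.n, u' ∈ x.T ∧ u = u'.val := by
      by_contra hcon
      exact h (if_neg hcon)
    obtain ⟨u', h1, h2⟩ := h'
    exact ⟨u', h1, h2.symm⟩
  · rintro ⟨u', h1, rfl⟩
    refine ⟨u'.2, ?_⟩
    rw [if_pos ⟨u', h1, rfl⟩]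
    exact one_ne_zero

theorem isSolution_iff (F : Finset (Fin x.n × Fin x.n)) :
    x.IsSolution F ↔ toNat F ⊆ toNat x.E ∧ Connects (x.T.image Fin.val) (toNat F) := by
  rw [IsSolution, toNat_subset]
  refine and_congr_right fun _ => ?_
  constructor
  · intro h s hs t ht
    obtain ⟨s, hs', rfl⟩ := Finset.mem_image.1 hs
    obtain ⟨t, ht', rfl⟩ := Finset.mem_image.1 ht
    by_cases hst : s = t
    · rw [hst]; exact .refl
    · exact hasPath_iff.1 (h s hs' t ht' hst)
  · intro h s hs t ht _
    exact hasPath_iff.2 (h s (Finset.mem_image_of_mem _ hs) t (Finset.mem_image_of_mem _ ht))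

theorem exists_opt (h : x.Feasible) : ∃ F, x.IsSolution F ∧ F.card = x.opt :=
  Nat.sInf_mem (s := {k | ∃ F, x.IsSolution F ∧ F.card = k}) (h.elim fun F hF => ⟨_, F, hF, rfl⟩)

end Instance

open Filter Asymptotics in
/-- The approximation guarantee is `OPT ^ ε` for all but finitely many values of `OPT`. -/
theorem exists_ratio_le {ε : ℝ} (hε : 0 < ε) : ∃ i C : ℕ, ∀ m > C, ∀ k ≤ m, ∃ q : ℕ,
    k ≤ q ^ (i + 1) ∧ (Cmd.blockConst i * q * harmonic k : ℝ) ≤ (m : ℝ) ^ ε := by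
  -- Then 1 / (i + 1) ≤ ε / 2: half of the exponent is spent on q, the other half absorbs the
  -- constant and the logarithm.
  obtain ⟨i, hi⟩ := exists_nat_gt (2 / ε)
  have hi0 : (0 : ℝ) < (i + 1 : ℕ) := by positivity
  have hiε : (((i + 1 : ℕ) : ℝ))⁻¹ ≤ ε / 2 := by
    rw [inv_le_comm₀ hi0 (by positivity), inv_div]
    push_cast
    linarith
  obtain ⟨K, hK⟩ : ∃ K : ℝ, K = Cmd.blockConst i := ⟨_, rfl⟩
  have hK0 : 0 ≤ K := by rw [hK]; positivity
  have hlog : (fun x : ℝ => 1 + Real.log x) =o[atTop] fun x : ℝ => x ^ (ε / 2) := by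
    refine IsLittleO.add ?_ (isLittleO_log_rpow_atTop (by positivity))
    exact isLittleO_const_left.2 (.inr (tendsto_norm_atTop_atTop.comp
      (tendsto_rpow_atTop (by positivity))))
  -- This makes 2 K (1 + log m) at most m ^ (ε / 2) for large m; the 2 K comes from the bound 2 m ^
  -- (ε / 2) on q, and the + 1 avoids division by zero.
  have hbound := (hlog.bound (c := (2 * K + 1)⁻¹) (by positivity)).and (eventually_ge_atTop 1)
  obtain ⟨C, hC⟩ := eventually_atTop.1 (tendsto_natCast_atTop_atTop (R := ℝ) |>.eventually hbound)
  refine ⟨i, C, fun m hm k hk => ?_⟩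
  obtain ⟨h1, hm1⟩ := hC m hm.le
  have hlog0 : 0 ≤ Real.log m := Real.log_nonneg hm1
  have hpow0 : (0 : ℝ) < (m : ℝ) ^ (ε / 2) := Real.rpow_pos_of_pos (by linarith) _
  rw [Real.norm_of_nonneg (by linarith), Real.norm_of_nonneg hpow0.le, ← div_eq_inv_mul,
    le_div_iff₀ (by positivity)] at h1
  -- The least admissible q. Rounding up adds at most 1 ≤ m ^ (ε / 2), hence the bound 2 m ^ (ε / 2)
  -- on q.
  refine ⟨⌈(k : ℝ) ^ ((((i + 1 : ℕ) : ℝ))⁻¹)⌉₊, ?_, ?_⟩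
  · have h2 : (k : ℝ) ≤ (⌈(k : ℝ) ^ ((((i + 1 : ℕ) : ℝ))⁻¹)⌉₊ : ℝ) ^ (i + 1) := by
      calc (k : ℝ) = ((k : ℝ) ^ ((((i + 1 : ℕ) : ℝ))⁻¹)) ^ (i + 1) :=
            (Real.rpow_inv_natCast_pow (by positivity) (by omega)).symm
        _ ≤ _ := by
            gcongr
            exact Nat.le_ceil _
    exact_mod_cast h2
  · have hq : (⌈(k : ℝ) ^ ((((i + 1 : ℕ) : ℝ))⁻¹)⌉₊ : ℝ) ≤ 2 * (m : ℝ) ^ (ε / 2) := by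
      have h3 := (Nat.ceil_lt_add_one (a := (k : ℝ) ^ ((((i + 1 : ℕ) : ℝ))⁻¹)) (by positivity)).le
      have h4 : (k : ℝ) ^ ((((i + 1 : ℕ) : ℝ))⁻¹) ≤ (m : ℝ) ^ (ε / 2) :=
        calc (k : ℝ) ^ ((((i + 1 : ℕ) : ℝ))⁻¹) ≤ (m : ℝ) ^ ((((i + 1 : ℕ) : ℝ))⁻¹) := by
              gcongr
          _ ≤ _ := Real.rpow_le_rpow_of_exponent_le hm1 hiε
      have h5 : 1 ≤ (m : ℝ) ^ (ε / 2) := Real.one_le_rpow hm1 (by positivity)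
      linarith
    have hH : (harmonic k : ℝ) ≤ 1 + Real.log m := by
      refine (harmonic_le_one_add_log k).trans ?_
      rcases Nat.eq_zero_or_pos k with rfl | hk0
      · simpa using hlog0
      · gcongr
    have hH0 : (0 : ℝ) ≤ harmonic k := by simp only [harmonic]; push_cast; positivity
    rw [← hK]
    calc K * _ * (harmonic k : ℝ) ≤ K * (2 * (m : ℝ) ^ (ε / 2)) * (1 + Real.log m) := by gcongr
      _ = (2 * K * (1 + Real.log m)) * (m : ℝ) ^ (ε / 2) := by ring
      _ ≤ (m : ℝ) ^ (ε / 2) * (m : ℝ) ^ (ε / 2) := by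
          gcongr
          linarith
      _ = (m : ℝ) ^ ε := by
          rw [← Real.rpow_add (by linarith), add_halves]

/-- Natural coefficients make the time bound monotone, so n may be replaced by the size of the
instance. -/
theorem eval_mono (p : Polynomial ℕ) {a b : ℕ} (h : a ≤ b) : p.eval a ≤ p.eval b := by
  rw [Polynomial.eval_eq_sum, Polynomial.eval_eq_sum]
  exact Finset.sum_le_sum fun i _ => Nat.mul_le_mul_left _ (Nat.pow_le_pow_left h i)

end SCSS

theorem mainTheorem7 (ε : ℝ) (hε : 0 < ε) :
    ∃ P : RAM.Program, SCSS.IsPolyTimeApproxAlgorithm P (fun OPT => 2 * (OPT : ℝ) ^ ε) := by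
  obtain ⟨i, C, hratio⟩ := SCSS.exists_ratio_le hε
  refine ⟨(RAM.Cmd.algorithm i C).toProgram, (RAM.Cmd.algorithm i C).time, fun x => ?_⟩
  obtain ⟨t, hexec, ht⟩ := RAM.Cmd.exec_toProgram _ (RAM.Cmd.algorithm_wf i C)
    (RAM.Cmd.algorithm_regs i C) x.input
  refine ⟨_, t, hexec, ht.trans (SCSS.eval_mono _ ?_), fun hfeas => ?_⟩
  · simp only [SCSS.Instance.input, SCSS.Instance.size, if_true]
    omega
  · obtain ⟨F, hF, hcard⟩ := x.exists_opt hfeas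
    have hF' := (x.isSolution_iff F).1 hF
    obtain ⟨h1, h2, h3⟩ := RAM.Cmd.algorithm_run (i := i) (C := C) (n := x.n) (s := x.input)
      (by simp [SCSS.Instance.input]) (by simp [SCSS.Instance.input])
      (by simp [SCSS.Instance.input]) (by ext p; simp [SCSS.Instance.input])
      x.markedPairs_input x.marked_input hF'.1 hF'.2
    rw [SCSS.markedPairs_output] at h1 h2 h3
    refine ⟨(x.isSolution_iff _).2 ⟨h1, h2⟩, ?_⟩
    rw [SCSS.card_toNat, SCSS.card_toNat, hcard] at h3
    rcases h3 with h3 | ⟨hT, hC, h3⟩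
    -- The exhaustive search gives an optimal output. It is empty for OPT = 0, and for OPT ≥ 1 the
    -- ratio is at least 1.
    · rcases Nat.eq_zero_or_pos x.opt with h0 | hpos
      · rw [h0] at h3 ⊢
        simpa using h3
      · have h4 : (1 : ℝ) ≤ (x.opt : ℝ) := by exact_mod_cast hpos
        have h5 : 1 ≤ (x.opt : ℝ) ^ ε := Real.one_le_rpow h4 hε.le
        have h6 : ((SCSS.output x.n ((RAM.Cmd.algorithm i C).run x.input)).card : ℝ) ≤ x.opt := by
          exact_mod_cast h3
        nlinarith
    · have hopt : C < x.opt := by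
        have := hC _ hF'.1 hF'.2
        rwa [SCSS.card_toNat, hcard] at this
      have hTopt := SCSS.Connects.card_le hF'.2 hT
      rw [SCSS.card_toNat, hcard] at hTopt
      obtain ⟨q, hq, hle⟩ := hratio _ hopt _ hTopt
      refine (h3 q hq).trans ?_
      have h4 := mul_le_mul_of_nonneg_right hle (Nat.cast_nonneg (α := ℝ) x.opt)
      linarith
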